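/- Let $M$ be a smooth manifold (finite-dimensional, Hausdorff, second countable, without boundary) with a cooriented contact structure $\xi=\ker\alpha$, where $\alpha$ is a contact form determined up to multiplication by positive functions. Let $\mathrm{Diff}(M,\xi)$ be the group of diffeomorphisms of $M$ that preserve $\xi$ and its coorientation (contactomorphisms). Let $\pi\colon S\xi=\{p\in T^*M\mid \ker p=\xi \text{ as cooriented hyperplanes}\}\to M$ be the symplectization, with its Liouville form $\lambda_p=p\circ d\pi$, its symplectic form $\omega=d\lambda$ and the action $\tau_s(p)=e^sp$ of $\mathbb R$. A neighborhood of the positive (respectively negative) end of $S\xi$ is a set containing an open set that meets every fiber of $\pi$ and is invariant under $\tau_s$ for all $s\ge 0$ (respectively $s\le 0$). A symplectic pseudo-isotopy is a diffeomorphism $F$ of $S\xi$ with $F^*\omega=\omega$ that is the identity on a neighborhood of the negative end and satisfies $F^*\lambda=\lambda$ on a neighborhood of the positive end. A contactomorphism $\varphi$ is symplectically pseudo-isotopic to the identity if there is a symplectic pseudo-isotopy $F$ with $\pi\circ F=\varphi\circ\pi$ on a neighborhood of the positive end on which $F^*\lambda=\lambda$. A contactomorphism $\varphi$ is contact isotopic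 to the identity if there is a family $(\varphi_s)_{s\in[0,1]}$ of contactomorphisms with $\varphi_0=\mathrm{id}$ and $\varphi_1=\varphi$ such that $(s,x)\mapsto\varphi_s(x)$ is smooth on $[0,1]\times M$. Then the contactomorphisms that are symplectically pseudo-isotopic to the identity form a subgroup $\mathrm{Diff}_{\mathcal P}(M,\xi)$ of $\mathrm{Diff}(M,\xi)$, and this subgroup contains the identity component of $\mathrm{Diff}(M,\xi)$, i.e. the group of all contactomorphisms that are contact isotopic to the identity. -/

import Mathlib

open Set Bundle
open scoped Manifold ContDiff Bundle

noncomputable section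

namespace ContactGeometry

section Forms

/-! ### One-forms and their exterior derivative on a manifold -/

variable {E H : Type*} [NormedAddCommGroup E] [NormedSpace ℝ E] [TopologicalSpace H]
  (I : ModelWithCorners ℝ E H) {N : Type*} [TopologicalSpace N] [ChartedSpace H N]

/-- The expression of a one-form `η` in the preferred chart at `x`: the pull-back of `η` under the
inverse of that chart, a one-form on (an open subset of) the model vector space. -/
def oneFormInChart (η : ∀ x : N, TangentSpace I x →L[ℝ] ℝ) (x : N) (y : E) : E →L[ℝ] ℝ :=
  (η ((extChartAt I x).symm y)).comp (mfderiv 𝓘(ℝ, E) I (extChartAt I x).symm y)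

/-- The exterior derivative `dη` of a one-form on a manifold without boundary,
computed at `x` in the preferred chart at `x`
through `dη (v, w) = D_v (η w) - D_w (η v)` for constant vector fields `v`, `w`. -/
def extDerivOneForm (η : ∀ x : N, TangentSpace I x →L[ℝ] ℝ) (x : N) (v w : TangentSpace I x) : ℝ :=
  let D : E →L[ℝ] E →L[ℝ] ℝ := fderiv ℝ (oneFormInChart I η x) (extChartAt I x x)
  let v' : E := mfderiv I 𝓘(ℝ, E) (extChartAt I x) x v
  let w' : E := mfderiv I 𝓘(ℝ, E) (extChartAt I x) x w
  D v' w' - D w' v'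

end Forms

variable {E : Type*} [NormedAddCommGroup E] [NormedSpace ℝ E]
  {M : Type*} [TopologicalSpace M] [ChartedSpace E M]

section CotangentBundle

variable (E M)

/-- The cotangent bundle `T*M`. -/
abbrev CotangentBundle [IsManifold 𝓘(ℝ, E) ∞ M] : Type _ :=
  TotalSpace (E →L[ℝ] ℝ) (fun x : M => TangentSpace 𝓘(ℝ, E) x →L[ℝ] ℝ)

end CotangentBundle

/-- A smooth one-form, that is a smooth section of the cotangent bundle. -/
def IsSmoothOneForm [IsManifold 𝓘(ℝ, E) ∞ M]
    (α : ∀ x : M, TangentSpace 𝓘(ℝ, E) x →L[ℝ] ℝ) : Prop :=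
  ContMDiff 𝓘(ℝ, E) (𝓘(ℝ, E).prod 𝓘(ℝ, E →L[ℝ] ℝ)) ∞
    (fun x => (⟨x, α x⟩ : CotangentBundle E M))

/-- A contact form: a smooth, nowhere vanishing one-form `α` such that `dα` is nondegenerate
on the hyperplanes `ker α`. -/
structure IsContactForm [IsManifold 𝓘(ℝ, E) ∞ M]
    (α : ∀ x : M, TangentSpace 𝓘(ℝ, E) x →L[ℝ] ℝ) : Prop where
  smooth : IsSmoothOneForm α
  ne_zero : ∀ x, α x ≠ 0
  nondegenerate : ∀ (x : M) (u : TangentSpace 𝓘(ℝ, E) x), α x u = 0 →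
    (∀ v : TangentSpace 𝓘(ℝ, E) x, α x v = 0 → extDerivOneForm 𝓘(ℝ, E) α x u v = 0) → u = 0

variable (E M) in
/-- A cooriented contact structure on `M`: a hyperplane field together with a choice of a positive
side of each hyperplane, which are the kernel and the positive side of some contact form. -/
structure ContactStructure [IsManifold 𝓘(ℝ, E) ∞ M] where
  /-- the contact hyperplane at `x` -/
  plane : ∀ x : M, Submodule ℝ (TangentSpace 𝓘(ℝ, E) x)
  /-- the positive side of the contact hyperplane at `x` -/
  pos : ∀ x : M, Set (TangentSpace 𝓘(ℝ, E) x)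
  exists_form : ∃ α : ∀ x : M, TangentSpace 𝓘(ℝ, E) x →L[ℝ] ℝ, IsContactForm α ∧
    ∀ x v, (α x v = 0 ↔ v ∈ plane x) ∧ (0 < α x v ↔ v ∈ pos x)

namespace ContactStructure

variable [IsManifold 𝓘(ℝ, E) ∞ M] (ξ : ContactStructure E M)

/-- `ker p = ξ` at `x`, as an equality of cooriented hyperplanes. -/
def KerEq (x : M) (p : TangentSpace 𝓘(ℝ, E) x →L[ℝ] ℝ) : Prop :=
  ∀ v, (p v = 0 ↔ v ∈ ξ.plane x) ∧ (0 < p v ↔ v ∈ ξ.pos x)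

/-- The symplectization `Sξ = {p ∈ T*M | ker p = ξ}`, with the topology induced by `T*M`. -/
def Symplectization : Type _ := {p : CotangentBundle E M // ξ.KerEq p.proj p.snd}

instance : TopologicalSpace ξ.Symplectization :=
  inferInstanceAs (TopologicalSpace {p : CotangentBundle E M // ξ.KerEq p.proj p.snd})

/-- A contact form chosen among those defining `ξ` (with its coorientation). -/
def form : ∀ x : M, TangentSpace 𝓘(ℝ, E) x →L[ℝ] ℝ := ξ.exists_form.choose

lemma isContactForm_form : IsContactForm ξ.form := ξ.exists_form.choose_spec.1

lemma kerEq_form (x : M) : ξ.KerEq x (ξ.form x) := ξ.exists_form.choose_spec.2 x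

namespace Symplectization

variable {ξ}

/-- The inclusion of `Sξ` in `T*M`. -/
def incl (p : ξ.Symplectization) : CotangentBundle E M := p.1

/-- The projection `π : Sξ → M`. -/
abbrev proj (p : ξ.Symplectization) : M := p.1.proj

/-- The `ℝ`-action `τ_s p = e^s p`. -/
def translate (s : ℝ) (p : ξ.Symplectization) : ξ.Symplectization :=
  ⟨⟨p.1.proj, Real.exp s • p.1.snd⟩, fun v => by
    have h := p.2 v
    have hs := Real.exp_pos s
    constructor
    · rw [← h.1]
      simp [hs.ne']
    · rw [← h.2]
      simp [hs]⟩

/-! ### The manifold structure of `Sξ`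

A contact form `α` gives the bijection `(t, x) ↦ e^t α_x` from `ℝ × M` to `Sξ`. It is a
homeomorphism, through which `Sξ` receives its charts. The lemmas `contMDiff_incl` and
`contMDiff_of_incl_comp` below show that the resulting structure is the one of a submanifold
of `T*M`; in particular it does not depend on `α`. -/

lemma exists_pos_vector (x : M) : ∃ v, 0 < ξ.form x v := by
  by_contra! h
  refine ξ.isContactForm_form.ne_zero x ?_
  ext v
  have h1 := h v
  have h2 := h (-v)
  rw [map_neg] at h2
  simp only [zero_apply]
  linarith

lemma apply_eq_div_mul (p : ξ.Symplectization) {v : TangentSpace 𝓘(ℝ, E) p.proj}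
    (hv : 0 < ξ.form p.proj v) : 0 < p.1.snd v ∧
      p.1.snd = (p.1.snd v / ξ.form p.proj v) • ξ.form p.proj := by
  have hp : 0 < p.1.snd v := (p.2 v).2.2 ((ξ.kerEq_form p.proj v).2.1 hv)
  refine ⟨hp, ?_⟩
  ext w
  have h0 : ξ.form p.proj (w - (ξ.form p.proj w / ξ.form p.proj v) • v) = 0 := by
    rw [map_sub, map_smul, smul_eq_mul]; field_simp; ring
  have h1 : p.1.snd (w - (ξ.form p.proj w / ξ.form p.proj v) • v) = 0 :=
    (p.2 _).1.2 ((ξ.kerEq_form p.proj _).1.1 h0)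
  rw [map_sub, map_smul, smul_eq_mul] at h1
  simp only [smul_apply, smul_eq_mul]
  rw [sub_eq_zero.1 h1]
  field_simp

/-- The map `(t, x) ↦ e^t α_x`. -/
def ofProd (q : ℝ × M) : ξ.Symplectization :=
  translate q.1 ⟨⟨q.2, ξ.form q.2⟩, ξ.kerEq_form q.2⟩

/-- The inverse of `ofProd`. -/
def toProd (p : ξ.Symplectization) : ℝ × M :=
  (Real.log (p.1.snd (exists_pos_vector (ξ := ξ) p.proj).choose /
    ξ.form p.proj (exists_pos_vector (ξ := ξ) p.proj).choose), p.proj)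

lemma toProd_eq (p : ξ.Symplectization) {v : TangentSpace 𝓘(ℝ, E) p.proj}
    (hv : 0 < ξ.form p.proj v) :
    toProd p = (Real.log (p.1.snd v / ξ.form p.proj v), p.proj) := by
  have hw := (exists_pos_vector (ξ := ξ) p.proj).choose_spec
  set w := (exists_pos_vector (ξ := ξ) p.proj).choose with hwdef
  have h := (apply_eq_div_mul p hv).2
  have h2 : p.1.snd w / ξ.form p.proj w = p.1.snd v / ξ.form p.proj v := by
    rw [div_eq_iff hw.ne']
    have := DFunLike.congr_fun h w
    rwa [smul_apply, smul_eq_mul] at this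
  rw [toProd, ← hwdef, h2]

lemma toProd_ofProd (q : ℝ × M) : toProd (ofProd (ξ := ξ) q) = q := by
  obtain ⟨v, hv⟩ := exists_pos_vector (ξ := ξ) q.2
  rw [toProd_eq (ofProd (ξ := ξ) q) (v := v) hv]
  obtain ⟨t, x⟩ := q
  have : ((ofProd (ξ := ξ) (t, x)).1.snd v / ξ.form x v) = Real.exp t := by
    change (Real.exp t • ξ.form x) v / ξ.form x v = Real.exp t
    simp only [smul_apply, smul_eq_mul]
    exact mul_div_cancel_right₀ _ hv.ne'
  change (Real.log ((ofProd (ξ := ξ) (t, x)).1.snd v / ξ.form x v), x) = _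
  rw [this, Real.log_exp]

lemma ofProd_toProd (p : ξ.Symplectization) : ofProd (toProd p) = p := by
  obtain ⟨v, hv⟩ := exists_pos_vector (ξ := ξ) p.proj
  obtain ⟨h1, h2⟩ := apply_eq_div_mul p hv
  rw [toProd_eq p hv]
  apply Subtype.ext
  change (⟨p.proj, Real.exp (Real.log (p.1.snd v / ξ.form p.proj v)) • ξ.form p.proj⟩ :
    CotangentBundle E M) = p.1
  rw [Real.exp_log (div_pos h1 hv), ← h2]

section Smooth

variable {E' H' : Type*} [NormedAddCommGroup E'] [NormedSpace ℝ E'] [TopologicalSpace H']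
  {J : ModelWithCorners ℝ E' H'} {N : Type*} [TopologicalSpace N] [ChartedSpace H' N]

lemma contMDiff_incl_ofProd :
    ContMDiff (𝓘(ℝ, ℝ).prod 𝓘(ℝ, E)) (𝓘(ℝ, E).prod 𝓘(ℝ, E →L[ℝ] ℝ)) ∞
      (fun q : ℝ × M => incl (ofProd (ξ := ξ) q)) := by
  intro q
  have h : ContMDiff (𝓘(ℝ, ℝ).prod 𝓘(ℝ, E)) (𝓘(ℝ, E).prod 𝓘(ℝ, E →L[ℝ] ℝ)) ∞
      (fun q : ℝ × M => (⟨q.2, ξ.form q.2⟩ : CotangentBundle E M)) :=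
    ξ.isContactForm_form.smooth.comp contMDiff_snd
  have h1 := h q
  rw [contMDiffAt_totalSpace] at h1 ⊢
  refine ⟨h1.1, ?_⟩
  have h2 : ContMDiffAt (𝓘(ℝ, ℝ).prod 𝓘(ℝ, E)) 𝓘(ℝ, ℝ) ∞
      (fun q : ℝ × M => Real.exp q.1) q :=
    (Real.contDiff_exp.contMDiff (n := ∞)).contMDiffAt.comp q contMDiffAt_fst
  refine (h2.smul h1.2).congr_of_eventuallyEq ?_
  have hb : ∀ᶠ r in nhds q, (r : ℝ × M).2 ∈ (trivializationAt (E →L[ℝ] ℝ)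
      (fun x : M => TangentSpace 𝓘(ℝ, E) x →L[ℝ] ℝ) q.2).baseSet :=
    continuous_snd.continuousAt.eventually
      (IsOpen.eventually_mem (Trivialization.open_baseSet _) (mem_baseSet_trivializationAt _ _ q.2))
  filter_upwards [hb] with r hr
  exact ((trivializationAt (E →L[ℝ] ℝ)
      (fun x : M => TangentSpace 𝓘(ℝ, E) x →L[ℝ] ℝ) q.2).linear ℝ hr).map_smul (Real.exp r.1) _

lemma exists_local_extension_toProd (p₀ : ξ.Symplectization) :
    ∃ G : CotangentBundle E M → ℝ × M,
      ContMDiffAt (𝓘(ℝ, E).prod 𝓘(ℝ, E →L[ℝ] ℝ)) (𝓘(ℝ, ℝ).prod 𝓘(ℝ, E)) ∞ G (incl p₀) ∧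
      ∀ᶠ z in nhds (incl p₀), ∀ p : ξ.Symplectization, incl p = z → toProd p = G z := by
  obtain ⟨v, hv⟩ := exists_pos_vector (ξ := ξ) p₀.proj
  have hp : 0 < p₀.1.snd v := (apply_eq_div_mul p₀ hv).1
  let V : ∀ x : M, TangentSpace 𝓘(ℝ, E) x := FiberBundle.extend E v
  have hV : ContMDiffAt 𝓘(ℝ, E) (𝓘(ℝ, E).prod 𝓘(ℝ, E)) ∞
      (fun x => (⟨x, V x⟩ : TangentBundle 𝓘(ℝ, E) M)) p₀.proj :=
    FiberBundle.contMDiffAt_extend 𝓘(ℝ, E) E v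
  have hVv : V p₀.proj = v := FiberBundle.extend_apply_self ..
  have hα : ContMDiffAt 𝓘(ℝ, E) 𝓘(ℝ, ℝ) ∞ (fun x => ξ.form x (V x)) p₀.proj := by
    have := (ξ.isContactForm_form.smooth p₀.proj).clm_bundle_apply
      (E₂ := Bundle.Trivial M ℝ) hV
    exact (contMDiffAt_totalSpace.1 this).2
  have hπ : ContMDiffAt (𝓘(ℝ, E).prod 𝓘(ℝ, E →L[ℝ] ℝ)) 𝓘(ℝ, E) ∞
      (fun z : CotangentBundle E M => z.proj) (incl p₀) := contMDiffAt_proj _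
  have hβ : ContMDiffAt (𝓘(ℝ, E).prod 𝓘(ℝ, E →L[ℝ] ℝ)) 𝓘(ℝ, ℝ) ∞
      (fun z : CotangentBundle E M => z.snd (V z.proj)) (incl p₀) := by
    have := (contMDiffAt_id (I := 𝓘(ℝ, E).prod 𝓘(ℝ, E →L[ℝ] ℝ)) (n := ∞)
      (x := incl p₀)).clm_bundle_apply
      (E₂ := Bundle.Trivial M ℝ) (hV.comp (incl p₀) hπ)
    exact (contMDiffAt_totalSpace.1 this).2
  refine ⟨fun z => (Real.log (z.snd (V z.proj) / ξ.form z.proj (V z.proj)), z.proj), ?_, ?_⟩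
  · have hα' := hα.comp (incl p₀) hπ
    have h0 : ξ.form p₀.proj (V p₀.proj) ≠ 0 := by rw [hVv]; exact hv.ne'
    have hq := hβ.div₀ hα' h0
    have hlog : ContMDiffAt 𝓘(ℝ, ℝ) 𝓘(ℝ, ℝ) ∞ Real.log
        (p₀.1.snd (V p₀.proj) / ξ.form p₀.proj (V p₀.proj)) := by
      rw [hVv]
      exact (Real.contDiffAt_log.2 (div_pos hp hv).ne').contMDiffAt
    exact ContMDiffAt.prodMk (ContMDiffAt.comp (incl p₀) hlog hq) hπ
  · have h0 : 0 < ξ.form p₀.proj (V p₀.proj) := by rw [hVv]; exact hv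
    have hev : ∀ᶠ z in nhds (incl p₀), 0 < ξ.form z.proj (V z.proj) :=
      (hα.comp (incl p₀) hπ).continuousAt.eventually (lt_mem_nhds h0)
    filter_upwards [hev] with z hz p hpz
    subst hpz
    exact toProd_eq p hz

lemma contMDiff_toProd_comp {f : N → ξ.Symplectization}
    (hf : ContMDiff J (𝓘(ℝ, E).prod 𝓘(ℝ, E →L[ℝ] ℝ)) ∞ (fun y => incl (f y))) :
    ContMDiff J (𝓘(ℝ, ℝ).prod 𝓘(ℝ, E)) ∞ (fun y => toProd (f y)) := by
  intro y
  obtain ⟨G, hG, hev⟩ := exists_local_extension_toProd (f y)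
  refine (hG.comp y (hf y)).congr_of_eventuallyEq ?_
  filter_upwards [(hf y).continuousAt.eventually hev] with z hz
  exact hz (f z) rfl

variable (ξ) in
/-- The homeomorphism `Sξ ≃ ℝ × M` defined by a contact form. -/
def homeo : ξ.Symplectization ≃ₜ ℝ × M where
  toFun := toProd
  invFun := ofProd
  left_inv := ofProd_toProd
  right_inv := toProd_ofProd
  continuous_toFun := continuous_iff_continuousAt.2 fun p => by
    obtain ⟨G, hG, hev⟩ := exists_local_extension_toProd p
    have hi : ContinuousAt (incl (ξ := ξ)) p := continuous_subtype_val.continuousAt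
    refine (ContinuousAt.comp (x := p) hG.continuousAt hi).congr ?_
    filter_upwards [hi.eventually hev] with z hz
    exact (hz z rfl).symm
  continuous_invFun := contMDiff_incl_ofProd.continuous.subtype_mk _

instance : ChartedSpace (ModelProd ℝ E) ξ.Symplectization where
  atlas := (fun e => (homeo ξ).toOpenPartialHomeomorph.trans e) '' atlas (ModelProd ℝ E) (ℝ × M)
  chartAt p := (homeo ξ).toOpenPartialHomeomorph.trans (chartAt (ModelProd ℝ E) (homeo ξ p))
  mem_chart_source p := by simp
  chart_mem_atlas p := mem_image_of_mem _ (chart_mem_atlas _ _)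

instance : IsManifold (𝓘(ℝ, ℝ).prod 𝓘(ℝ, E)) ∞ ξ.Symplectization where
  compatible := by
    rintro _ _ ⟨e, he, rfl⟩ ⟨e', he', rfl⟩
    have h := (contDiffGroupoid ∞ (𝓘(ℝ, ℝ).prod 𝓘(ℝ, E))).compatible he he'
    have heq : ((homeo ξ).toOpenPartialHomeomorph.trans e).symm.trans
        ((homeo ξ).toOpenPartialHomeomorph.trans e') = e.symm.trans e' := by
      refine OpenPartialHomeomorph.ext _ _ (fun x => ?_) (fun x => ?_) ?_
      · simp
      · simp
      · ext x
        simp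
    exact heq ▸ h

lemma contMDiff_homeo :
    ContMDiff (𝓘(ℝ, ℝ).prod 𝓘(ℝ, E)) (𝓘(ℝ, ℝ).prod 𝓘(ℝ, E)) ∞ (homeo ξ) := by
  intro p
  have h := contMDiffAt_iff.1 (contMDiffAt_id (I := 𝓘(ℝ, ℝ).prod 𝓘(ℝ, E)) (n := ∞)
    (x := homeo ξ p))
  refine contMDiffAt_iff.2 ⟨(homeo ξ).continuous.continuousAt, ?_⟩
  refine (h.2.congr_of_eventuallyEq (Filter.Eventually.of_forall fun y => ?_) ?_)
  · exact congrArg (extChartAt (𝓘(ℝ, ℝ).prod 𝓘(ℝ, E)) (homeo ξ p))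
      ((homeo ξ).apply_symm_apply _)
  · exact congrArg (extChartAt (𝓘(ℝ, ℝ).prod 𝓘(ℝ, E)) (homeo ξ p))
      ((homeo ξ).apply_symm_apply _)

lemma contMDiff_homeo_symm :
    ContMDiff (𝓘(ℝ, ℝ).prod 𝓘(ℝ, E)) (𝓘(ℝ, ℝ).prod 𝓘(ℝ, E)) ∞ (homeo ξ).symm := by
  intro q
  obtain ⟨p, rfl⟩ := (homeo ξ).surjective q
  have h := contMDiffAt_iff.1 (contMDiffAt_id (I := 𝓘(ℝ, ℝ).prod 𝓘(ℝ, E)) (n := ∞)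
    (x := homeo ξ p))
  refine contMDiffAt_iff.2 ⟨(homeo ξ).symm.continuous.continuousAt, ?_⟩
  rw [(homeo ξ).symm_apply_apply]
  refine (h.2.congr_of_eventuallyEq (Filter.Eventually.of_forall fun y => ?_) ?_)
  · exact congrArg (extChartAt (𝓘(ℝ, ℝ).prod 𝓘(ℝ, E)) (homeo ξ p))
      ((homeo ξ).apply_symm_apply _)
  · exact congrArg (extChartAt (𝓘(ℝ, ℝ).prod 𝓘(ℝ, E)) (homeo ξ p))
      ((homeo ξ).apply_symm_apply _)

lemma contMDiff_incl :
    ContMDiff (𝓘(ℝ, ℝ).prod 𝓘(ℝ, E)) (𝓘(ℝ, E).prod 𝓘(ℝ, E →L[ℝ] ℝ)) ∞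
      (incl (ξ := ξ)) := by
  have h := (contMDiff_incl_ofProd (ξ := ξ)).comp (contMDiff_homeo (ξ := ξ))
  exact h.congr fun p => by
    simp only [Function.comp]
    exact congrArg incl (ofProd_toProd p).symm

lemma contMDiff_of_incl_comp {f : N → ξ.Symplectization}
    (hf : ContMDiff J (𝓘(ℝ, E).prod 𝓘(ℝ, E →L[ℝ] ℝ)) ∞ (fun y => incl (f y))) :
    ContMDiff J (𝓘(ℝ, ℝ).prod 𝓘(ℝ, E)) ∞ f := by
  have h := (contMDiff_homeo_symm (ξ := ξ)).comp (contMDiff_toProd_comp hf)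
  exact h.congr fun y => (ofProd_toProd (f y)).symm

end Smooth

/-! ### The Liouville form and the symplectic form of `Sξ` -/

variable (ξ) in
/-- The canonical Liouville form `λ` of `Sξ`, given by `λ_p = p ∘ dπ`. -/
def liouville (p : ξ.Symplectization) :
    TangentSpace (𝓘(ℝ, ℝ).prod 𝓘(ℝ, E)) p →L[ℝ] ℝ :=
  ContinuousLinearMap.comp (M₂ := TangentSpace 𝓘(ℝ, E) p.1.proj) p.1.snd
    (mfderiv (𝓘(ℝ, ℝ).prod 𝓘(ℝ, E)) 𝓘(ℝ, E) (proj (ξ := ξ)) p)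

variable (ξ) in
/-- The symplectic form `ω = dλ` of `Sξ`. -/
def omega (p : ξ.Symplectization)
    (v w : TangentSpace (𝓘(ℝ, ℝ).prod 𝓘(ℝ, E)) p) : ℝ :=
  extDerivOneForm (𝓘(ℝ, ℝ).prod 𝓘(ℝ, E)) (liouville ξ) p v w

/-- `U` is a neighborhood of the positive end `S_{+∞}ξ`: it contains an open set which is invariant
under `τ_s` for all `s ≥ 0` and meets every fiber of `Sξ → M`. -/
def IsNhdPosEnd (U : Set ξ.Symplectization) : Prop :=
  ∃ V ⊆ U, IsOpen V ∧ (∀ s : ℝ, 0 ≤ s → ∀ p ∈ V, translate s p ∈ V) ∧ ∀ x : M, ∃ p ∈ V, proj p = x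

/-- `U` is a neighborhood of the negative end `S_{-∞}ξ`: it contains an open set which is invariant
under `τ_s` for all `s ≤ 0` and meets every fiber of `Sξ → M`. -/
def IsNhdNegEnd (U : Set ξ.Symplectization) : Prop :=
  ∃ V ⊆ U, IsOpen V ∧ (∀ s : ℝ, s ≤ 0 → ∀ p ∈ V, translate s p ∈ V) ∧ ∀ x : M, ∃ p ∈ V, proj p = x

end Symplectization

open Symplectization

/-- The diffeomorphisms of `Sξ`. -/
abbrev SymplectizationDiffeo : Type _ :=
  ξ.Symplectization ≃ₘ^∞⟮𝓘(ℝ, ℝ).prod 𝓘(ℝ, E), 𝓘(ℝ, ℝ).prod 𝓘(ℝ, E)⟯ ξ.Symplectization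

variable {ξ} in
/-- `F` preserves `ω`, that is `F^* ω = ω`. -/
def IsSymplectomorphism (F : ξ.SymplectizationDiffeo) : Prop :=
  ∀ (p : ξ.Symplectization) (v w : TangentSpace (𝓘(ℝ, ℝ).prod 𝓘(ℝ, E)) p),
    omega ξ (F p) (mfderiv (𝓘(ℝ, ℝ).prod 𝓘(ℝ, E)) (𝓘(ℝ, ℝ).prod 𝓘(ℝ, E)) F p v)
      (mfderiv (𝓘(ℝ, ℝ).prod 𝓘(ℝ, E)) (𝓘(ℝ, ℝ).prod 𝓘(ℝ, E)) F p w) = omega ξ p v w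

variable {ξ} in
/-- `F` preserves the Liouville form on `U`, that is `F^* λ = λ` at every point of `U`. -/
def PreservesLiouvilleOn (F : ξ.SymplectizationDiffeo) (U : Set ξ.Symplectization) : Prop :=
  ∀ p ∈ U, ∀ v : TangentSpace (𝓘(ℝ, ℝ).prod 𝓘(ℝ, E)) p,
    liouville ξ (F p) (mfderiv (𝓘(ℝ, ℝ).prod 𝓘(ℝ, E)) (𝓘(ℝ, ℝ).prod 𝓘(ℝ, E)) F p v) =
      liouville ξ p v

variable {ξ} in
/-- A symplectic pseudo-isotopy of `(M, ξ)`: a symplectomorphism of `Sξ` which is the identity on a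
neighborhood of the negative end and preserves `λ` on a neighborhood of the positive end. -/
structure IsSymplecticPseudoIsotopy (F : ξ.SymplectizationDiffeo) : Prop where
  symplectic : IsSymplectomorphism F
  eq_id : ∃ U, IsNhdNegEnd U ∧ ∀ p ∈ U, F p = p
  preserves_liouville : ∃ U, IsNhdPosEnd U ∧ PreservesLiouvilleOn F U

/-! ### Contactomorphisms -/

/-- The contactomorphisms of `(M, ξ)`: the diffeomorphisms of `M` whose differential preserves `ξ`
and its coorientation. -/
structure Diff where
  toDiffeo : M ≃ₘ^∞⟮𝓘(ℝ, E), 𝓘(ℝ, E)⟯ M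
  map_plane : ∀ (x : M) (v : TangentSpace 𝓘(ℝ, E) x),
    mfderiv 𝓘(ℝ, E) 𝓘(ℝ, E) toDiffeo x v ∈ ξ.plane (toDiffeo x) ↔ v ∈ ξ.plane x
  map_pos : ∀ (x : M) (v : TangentSpace 𝓘(ℝ, E) x),
    mfderiv 𝓘(ℝ, E) 𝓘(ℝ, E) toDiffeo x v ∈ ξ.pos (toDiffeo x) ↔ v ∈ ξ.pos x

namespace Diff

variable {ξ}

instance : CoeFun ξ.Diff (fun _ => M → M) := ⟨fun φ => φ.toDiffeo⟩

lemma ext_apply {φ ψ : ξ.Diff} (h : ∀ x, φ x = ψ x) : φ = ψ := by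
  obtain ⟨f, hf, hf'⟩ := φ
  obtain ⟨g, hg, hg'⟩ := ψ
  obtain rfl : f = g := Diffeomorph.ext h
  rfl

instance : One ξ.Diff where
  one :=
    { toDiffeo := Diffeomorph.refl 𝓘(ℝ, E) M ∞
      map_plane := fun x v => by
        rw [Diffeomorph.coe_refl, mfderiv_id]; rfl
      map_pos := fun x v => by
        rw [Diffeomorph.coe_refl, mfderiv_id]; rfl }

set_option linter.unusedSectionVars false in
lemma mfderiv_trans (f g : M ≃ₘ^∞⟮𝓘(ℝ, E), 𝓘(ℝ, E)⟯ M) (x : M) (v : TangentSpace 𝓘(ℝ, E) x) :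
    mfderiv 𝓘(ℝ, E) 𝓘(ℝ, E) (g.trans f) x v =
      mfderiv 𝓘(ℝ, E) 𝓘(ℝ, E) f (g x) (mfderiv 𝓘(ℝ, E) 𝓘(ℝ, E) g x v) := by
  rw [Diffeomorph.coe_trans, mfderiv_comp x (f.mdifferentiable (by simp) _)
    (g.mdifferentiable (by simp) _)]
  rfl

set_option linter.unusedSectionVars false in
lemma mfderiv_symm (f : M ≃ₘ^∞⟮𝓘(ℝ, E), 𝓘(ℝ, E)⟯ M) (x : M) (v : TangentSpace 𝓘(ℝ, E) x) :
    mfderiv 𝓘(ℝ, E) 𝓘(ℝ, E) f (f.symm x) (mfderiv 𝓘(ℝ, E) 𝓘(ℝ, E) f.symm x v) = v := by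
  rw [← mfderiv_trans f f.symm x v, Diffeomorph.symm_trans_self, Diffeomorph.coe_refl, mfderiv_id]
  rfl

/-- Composition of contactomorphisms. -/
instance : Mul ξ.Diff where
  mul φ ψ :=
    { toDiffeo := ψ.toDiffeo.trans φ.toDiffeo
      map_plane := fun x v => by
        rw [mfderiv_trans]
        exact (φ.map_plane _ _).trans (ψ.map_plane x v)
      map_pos := fun x v => by
        rw [mfderiv_trans]
        exact (φ.map_pos _ _).trans (ψ.map_pos x v) }

/-- Inverse of a contactomorphism. -/
instance : Inv ξ.Diff where
  inv φ :=
    { toDiffeo := φ.toDiffeo.symm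
      map_plane := fun x v => by
        rw [← φ.map_plane, mfderiv_symm, φ.toDiffeo.apply_symm_apply]
      map_pos := fun x v => by
        rw [← φ.map_pos, mfderiv_symm, φ.toDiffeo.apply_symm_apply] }

instance : Group ξ.Diff where
  mul_assoc _ _ _ := ext_apply fun _ => rfl
  one_mul _ := ext_apply fun _ => rfl
  mul_one _ := ext_apply fun _ => rfl
  inv_mul_cancel φ := ext_apply fun x => φ.toDiffeo.symm_apply_apply x

lemma one_apply (x : M) : (1 : ξ.Diff) x = x := rfl

lemma mul_apply (φ ψ : ξ.Diff) (x : M) : (φ * ψ) x = φ (ψ x) := rfl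

/-- `φ_s`, `s ∈ [0, 1]`, is a contact isotopy: a family of contactomorphisms which is smooth
on `[0, 1] × M` and starts at the identity. Values at `s ∉ [0, 1]` play no role. -/
structure IsContactIsotopy (φ : ℝ → ξ.Diff) : Prop where
  smooth : ContMDiffOn (𝓘(ℝ, ℝ).prod 𝓘(ℝ, E)) 𝓘(ℝ, E) ∞
    (fun q : ℝ × M => φ q.1 q.2) (Icc (0 : ℝ) 1 ×ˢ univ)
  zero : φ 0 = 1

/-- `φ` is contact isotopic to the identity. -/
def IsContactIsotopicToId (φ : ξ.Diff) : Prop :=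
  ∃ Φ : ℝ → ξ.Diff, IsContactIsotopy Φ ∧ Φ 1 = φ

variable (ξ) in
/-- The identity component of `Diff(M, ξ)`: the group of contactomorphisms which are contact
isotopic to the identity. -/
def identityComponent : Subgroup ξ.Diff where
  carrier := {φ | IsContactIsotopicToId φ}
  one_mem' := ⟨fun _ => 1, ⟨contMDiff_snd.contMDiffOn, rfl⟩, rfl⟩
  mul_mem' := by
    rintro _ _ ⟨Φ, hΦ, rfl⟩ ⟨Ψ, hΨ, rfl⟩
    refine ⟨fun s => Φ s * Ψ s, ⟨?_, ?_⟩, rfl⟩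
    · exact hΦ.smooth.comp (contMDiff_fst.contMDiffOn.prodMk hΨ.smooth)
        (fun q hq => ⟨hq.1, mem_univ _⟩)
    · rw [hΦ.zero, hΨ.zero, one_mul]
  inv_mem' := by
    rintro _ ⟨Φ, hΦ, rfl⟩
    refine ⟨fun s => Φ (1 - s) * (Φ 1)⁻¹, ⟨?_, ?_⟩, ?_⟩
    · have h1 : ContMDiff (𝓘(ℝ, ℝ).prod 𝓘(ℝ, E)) (𝓘(ℝ, ℝ).prod 𝓘(ℝ, E)) ∞
          (fun q : ℝ × M => (1 - q.1, (Φ 1).toDiffeo.symm q.2)) :=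
        (((contDiff_const.sub contDiff_id).contMDiff (n := ∞)).comp contMDiff_fst).prodMk
          ((Φ 1).toDiffeo.symm.contMDiff.comp contMDiff_snd)
      refine hΦ.smooth.comp h1.contMDiffOn (fun q hq => ⟨?_, mem_univ _⟩)
      have h2 : q.1 ∈ Icc (0 : ℝ) 1 := hq.1
      exact ⟨by linarith [h2.2], by linarith [h2.1]⟩
    · rw [sub_zero, mul_inv_cancel]
    · change Φ (1 - 1) * (Φ 1)⁻¹ = _
      rw [sub_self, hΦ.zero, one_mul]

/-- The symplectic pseudo-isotopy `F` induces `φ`: on a neighborhood `U` of the positive end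
on which `F` preserves `λ`, one has `π (F p) = φ (π p)`. -/
def IsInducedBy (φ : ξ.Diff) (F : ξ.SymplectizationDiffeo) : Prop :=
  ∃ U, IsNhdPosEnd U ∧ PreservesLiouvilleOn F U ∧ ∀ p ∈ U, φ p.proj = (F p).proj

/-- `φ` is symplectically pseudo-isotopic to the identity. -/
def IsSymplecticallyPseudoIsotopicToId (φ : ξ.Diff) : Prop :=
  ∃ F : ξ.SymplectizationDiffeo, IsSymplecticPseudoIsotopy F ∧ φ.IsInducedBy F

end Diff

end ContactStructure

end ContactGeometry

end

/-!
A contact form `α` for `ξ` identifies `Sξ` with `ℝ × M` in such a way that the Liouville form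
becomes `e^t α` and the action of `ℝ` becomes translation of the first factor. Pseudo-isotopies are
studied in these coordinates (`isSymplecticallyPseudoIsotopicToId_iff`).

*The subgroup.* The vector field `∂_t` is the dual of `e^t α` with respect to the symplectic form
`d (e^t α)`. A symplectic map that preserves `e^t α` on a neighborhood of the positive end therefore
preserves `∂_t` there, and commutes with positive translations (`apply_translate_eq`). So it maps
the positive end to the positive end, and pseudo-isotopies can be composed and inverted
(`IsCylinderPseudoIsotopy.comp`, `IsCylinderPseudoIsotopy.symm`).

*The identity component.* A contact isotopy `Φ_s` with `Φ_s^* α = g_s α` lifts to the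
diffeomorphisms `P_s (t, x) = (t - log g_s x, Φ_s x)`, which preserve `e^t α` and whose Hamiltonian,
pulled back by `P_s`, has the form `e^t h_s (x)`. The inverses of the `P_s` are generated by the
Hamiltonian `- e^t h_s`, in the sense that the integral curves `p_s` of its field are those for which `P_s (p_s)` is constant
(`mfderiv_liftMap_eq_zero`). Multiplying this Hamiltonian by a cutoff function that is `1` near the
negative end and `0` near the positive end, one obtains a flow whose time-one map `G` is the inverse
of `P_1` near the negative end and the identity near the positive end. Then `P_1 ∘ G` is a
symplectic pseudo-isotopy that induces `Φ_1` (`exists_isCylinderPseudoIsotopy`).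

What has to be proved is that the cut-off flow is complete when `M` is not compact. The height `t`
moves with bounded speed over compact subsets of `M`, so it is enough to confine the projections of
integral curves to compact sets. To this end `M` is exhausted by compact sets whose boundaries serve
as walls. Every wall is contained, together with the points that the isotopy moves to or from it, in
an annulus, and the annuli are disjoint. The cutoff function passes from `1` to `0` at the heights
`0 ≤ t ≤ 1` near the points that can be moved to a wall, and at the heights `-T ≤ t ≤ 1 - T` at the
boundary of the annuli, where `T` is large. An integral curve that passes over a wall either remains
where the cutoff function is `1`, and then it only visits points that the isotopy relates to the
wall; or it passes over the annulus at a height `t ≥ 0`, and then it would have to descend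
nearly to the depth `T` before it could leave the annulus, for which the time is too short as the
total descent is bounded by a constant that depends on the annulus only
(`IsCutoffField.mem_openAnnulus_of_nonneg`). In both cases it does not leave the annulus, so
integral curves are trapped (`IsCutoffField.mem_exhaustion`).

The tools from analysis are the smooth dependence of solutions of differential equations on their
initial values, which is deduced from the implicit function theorem in a Banach space of curves
(`exists_smooth_solution`, `IsSmoothVectorField.exists_flow`), the naturality of the exterior
derivative of one-forms (`extDerivOneForm_pullbackForm`), and the fact that Hamiltonian flows are
symplectic (`exists_symplectic_time_one`).
-/

set_option linter.unusedSectionVars false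

open ContactGeometry

/-! ### Smooth dependence of solutions on a parameter -/

section SmoothDependence

open Filter Topology MeasureTheory

universe u

variable {V : Type u} [NormedAddCommGroup V] [NormedSpace ℝ V]

/-- The bounded bilinear map between spaces of continuous functions that a bounded bilinear map
induces pointwise. -/
noncomputable def pointwiseBilinear (X : Type*) [TopologicalSpace X] [CompactSpace X]
    {Z V W : Type*} [NormedAddCommGroup Z] [NormedSpace ℝ Z]
    [NormedAddCommGroup V] [NormedSpace ℝ V] [NormedAddCommGroup W] [NormedSpace ℝ W]
    (B : Z →L[ℝ] V →L[ℝ] W) : C(X, Z) →L[ℝ] C(X, V) →L[ℝ] C(X, W) :=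
  LinearMap.mkContinuous₂
    (LinearMap.mk₂ ℝ
      (fun (A : C(X, Z)) (h : C(X, V)) =>
        (⟨fun x => B (A x) (h x),
          (B.continuous.comp A.continuous).clm_apply h.continuous⟩ : C(X, W)))
      (fun _ _ _ => by ext; simp) (fun _ _ _ => by ext; simp)
      (fun _ _ _ => by ext; simp) (fun _ _ _ => by ext; simp)) ‖B‖
    fun A h => (ContinuousMap.norm_le _ (by positivity)).2 fun x => by
      refine (B.le_opNorm₂ (A x) (h x)).trans ?_
      have h1 := A.norm_coe_le_norm x
      have h2 := h.norm_coe_le_norm x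
      gcongr

set_option synthInstance.maxHeartbeats 200000 in
/-- The superposition operator `γ ↦ f ∘ γ` on continuous functions is as smooth as `f`: its
derivative is given by the superposition operator of `fderiv ℝ f`. The target `W` is arbitrary so
that it can be replaced by `V →L[ℝ] W` in the induction. The support of `f` is compact so that
`fderiv ℝ f` is Lipschitz, which bounds the remainder uniformly. -/
lemma contDiff_postcomp_nat {X : Type*} [TopologicalSpace X] [CompactSpace X] (n : ℕ) :
    ∀ {W : Type u} [NormedAddCommGroup W] [NormedSpace ℝ W] (f : C(V, W)),
      ContDiff ℝ ∞ f → HasCompactSupport f →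
      ContDiff ℝ n (fun γ : C(X, V) => f.comp γ) := by
  induction n with
  | zero =>
    intro W _ _ f _ _
    exact contDiff_zero.2 (ContinuousMap.continuous_postcomp f)
  | succ n ih =>
    intro W _ _ f hf hc
    have hfd : ContDiff ℝ ∞ (fderiv ℝ f) := hf.fderiv_right le_rfl
    have hcd : HasCompactSupport (fderiv ℝ f) := hc.fderiv ℝ
    have hlip : ∃ C, LipschitzWith C (fderiv ℝ f) :=
      (hfd.of_le (by simp)).lipschitzWith_of_hasCompactSupport hcd (n := 1) (by simp)
    obtain ⟨C, hC⟩ := hlip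
    let f' : C(V, V →L[ℝ] W) := ⟨fderiv ℝ f, hfd.continuous⟩
    refine contDiff_succ_iff_hasFDerivAt.2
      ⟨fun γ => pointwiseBilinear X (ContinuousLinearMap.id ℝ (V →L[ℝ] W)) (f'.comp γ),
        (pointwiseBilinear X (ContinuousLinearMap.id ℝ (V →L[ℝ] W))).contDiff.comp
          (ih f' hfd hcd), fun γ => ?_⟩
    rw [hasFDerivAt_iff_isLittleO_nhds_zero]
    -- the Lipschitz bound on `fderiv ℝ f` makes the remainder at most `C ‖h‖ ^ 2`
    refine Asymptotics.IsBigO.trans_isLittleO (g := fun h : C(X, V) => ‖h‖ ^ 2) ?_ ?_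
    · refine Asymptotics.IsBigO.of_bound C (Eventually.of_forall fun h => ?_)
      rw [ContinuousMap.norm_le _ (by positivity)]
      intro x
      have h1 : ‖f (γ x + h x) - f (γ x) - fderiv ℝ f (γ x) (γ x + h x - γ x)‖
          ≤ (C * ‖h‖) * ‖γ x + h x - γ x‖ := by
        refine (convex_closedBall (γ x) ‖h‖).norm_image_sub_le_of_norm_fderiv_le' (𝕜 := ℝ)
          (fun z _ => (hf.differentiable (by simp)) z) (fun z hz => ?_) ?_ ?_
        · refine (hC.norm_sub_le _ _).trans ?_
          rw [Metric.mem_closedBall, dist_eq_norm] at hz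
          gcongr
        · exact Metric.mem_closedBall_self (norm_nonneg _)
        · simpa using h.norm_coe_le_norm x
      rw [add_sub_cancel_left] at h1
      change ‖f (γ x + h x) - f (γ x) - fderiv ℝ f (γ x) (h x)‖ ≤ _
      refine h1.trans ?_
      rw [norm_pow, norm_norm, pow_two, mul_assoc]
      have := h.norm_coe_le_norm x
      gcongr
    · exact Asymptotics.isLittleO_norm_pow_id one_lt_two

lemma contDiff_postcomp {X : Type*} [TopologicalSpace X] [CompactSpace X]
    {f : C(V, V)} (hf : ContDiff ℝ ∞ f) (hc : HasCompactSupport f) :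
    ContDiff ℝ ∞ (fun γ : C(X, V) => f.comp γ) :=
  contDiff_infty.2 fun n => contDiff_postcomp_nat n f hf hc

/-- The operator sending `γ` to its primitive `u ↦ ∫ r in 0..u, γ r` on `[0, 1]`. -/
noncomputable def primitiveCLM (V : Type*) [NormedAddCommGroup V] [NormedSpace ℝ V] :
    C(Icc (0 : ℝ) 1, V) →L[ℝ] C(Icc (0 : ℝ) 1, V) :=
  have hint : ∀ (γ : C(Icc (0 : ℝ) 1, V)) (a b : ℝ),
      IntervalIntegrable (IccExtend zero_le_one γ) volume a b :=
    fun γ a b => (γ.continuous.Icc_extend').intervalIntegrable a b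
  LinearMap.mkContinuous
    { toFun := fun γ => ⟨fun u => ∫ r in (0 : ℝ)..u, IccExtend zero_le_one γ r,
        (intervalIntegral.continuous_primitive (hint γ) 0).comp continuous_subtype_val⟩
      map_add' := fun γ δ => by
        ext u
        exact intervalIntegral.integral_add (hint γ 0 u) (hint δ 0 u)
      map_smul' := fun c γ => by
        ext u
        exact intervalIntegral.integral_smul c _ } 1
    (fun γ => by
      rw [one_mul, ContinuousMap.norm_le _ (norm_nonneg _)]
      intro u
      have h : ‖∫ r in (0 : ℝ)..u, IccExtend zero_le_one γ r‖ ≤ ‖γ‖ * |(u : ℝ) - 0| :=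
        intervalIntegral.norm_integral_le_of_norm_le_const fun r _ => γ.norm_coe_le_norm _
      refine h.trans ?_
      rw [sub_zero, abs_of_nonneg u.2.1]
      exact mul_le_of_le_one_right (norm_nonneg _) u.2.2)

lemma primitiveCLM_apply (γ : C(Icc (0 : ℝ) 1, V)) (u : Icc (0 : ℝ) 1) :
    primitiveCLM V γ u = ∫ r in (0 : ℝ)..u, IccExtend zero_le_one γ r := rfl

/-- For a smooth vector field `f` with compact support, the solution on `[0, 1]` of
`γ' = τ f (γ)`, `γ 0 = x`, depends smoothly on `(τ, x)` near `τ = 0`, as an element of the space of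
continuous curves. It is the zero of the map `γ ↦ γ - x - τ ∫ f (γ)`, to which the implicit function
theorem applies since at `τ = 0` this map is the identity up to a constant. -/
lemma exists_smooth_solution [CompleteSpace V] {f : V → V} (hf : ContDiff ℝ ∞ f)
    (hc : HasCompactSupport f) (x₀ : V) :
    ∃ Γ : ℝ × V → C(Icc (0 : ℝ) 1, V), ContDiffAt ℝ ∞ Γ (0, x₀) ∧
      ∀ᶠ q in 𝓝 ((0 : ℝ), x₀), ∀ u : Icc (0 : ℝ) 1,
        Γ q u = q.2 + q.1 • ∫ r in (0 : ℝ)..u, f (IccExtend zero_le_one (Γ q) r) := by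
  let fc : C(V, V) := ⟨f, hf.continuous⟩
  let c : V →L[ℝ] C(Icc (0 : ℝ) 1, V) := ContinuousLinearMap.const ℝ (Icc (0 : ℝ) 1)
  let 𝓕 : (ℝ × V) × C(Icc (0 : ℝ) 1, V) → C(Icc (0 : ℝ) 1, V) := fun z =>
    z.2 - c z.1.2 - z.1.1 • primitiveCLM V (fc.comp z.2)
  have hN : ContDiff ℝ ∞ (fun γ : C(Icc (0 : ℝ) 1, V) => fc.comp γ) := contDiff_postcomp hf hc
  have h𝓕 : ContDiff ℝ ∞ 𝓕 := by
    refine (contDiff_snd.sub (c.contDiff.comp (contDiff_snd.comp contDiff_fst))).sub ?_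
    exact (contDiff_fst.comp contDiff_fst).smul
      ((primitiveCLM V).contDiff.comp (hN.comp contDiff_snd))
  let u₀ : (ℝ × V) × C(Icc (0 : ℝ) 1, V) := ((0, x₀), c x₀)
  have hderiv : fderiv ℝ 𝓕 u₀ ∘L .inr ℝ (ℝ × V) (C(Icc (0 : ℝ) 1, V)) =
      ContinuousLinearMap.id ℝ _ := by
    have h1 : HasFDerivAt (fun γ : C(Icc (0 : ℝ) 1, V) => 𝓕 ((0, x₀), γ))
        (fderiv ℝ 𝓕 u₀ ∘L .inr ℝ (ℝ × V) (C(Icc (0 : ℝ) 1, V))) (c x₀) :=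
      HasFDerivAt.comp (c x₀) ((h𝓕.differentiable (by simp)) u₀).hasFDerivAt
        (hasFDerivAt_prodMk_right (0, x₀) (c x₀))
    have h2 : HasFDerivAt (fun γ : C(Icc (0 : ℝ) 1, V) => 𝓕 ((0, x₀), γ))
        (ContinuousLinearMap.id ℝ _) (c x₀) := by
      have : (fun γ : C(Icc (0 : ℝ) 1, V) => 𝓕 ((0, x₀), γ)) = fun γ => γ - c x₀ := by
        ext γ
        simp [𝓕]
      rw [this]
      exact (hasFDerivAt_id _).sub_const _
    exact h1.unique h2
  have hinv : (fderiv ℝ 𝓕 u₀ ∘L .inr ℝ (ℝ × V) (C(Icc (0 : ℝ) 1, V))).IsInvertible := by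
    rw [hderiv]
    exact ⟨ContinuousLinearEquiv.refl ℝ _, rfl⟩
  have hne : (∞ : WithTop ℕ∞) ≠ 0 := by simp
  refine ⟨h𝓕.contDiffAt.implicitFunction hne hinv,
    h𝓕.contDiffAt.contDiffAt_implicitFunction hne hinv, ?_⟩
  filter_upwards [h𝓕.contDiffAt.eventually_apply_implicitFunction hne hinv] with q hq u
  have h0 : 𝓕 u₀ = 0 := by simp [𝓕, u₀]
  rw [h0] at hq
  have h1 := DFunLike.congr_fun hq u
  simp only [𝓕, ContinuousMap.sub_apply, ContinuousMap.smul_apply, primitiveCLM_apply,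
    ContinuousMap.zero_apply] at h1
  have h2 := sub_eq_zero.1 h1
  rw [sub_eq_iff_eq_add'] at h2
  exact h2

end SmoothDependence

/-! ### Local flows in a vector space -/

section SmoothDependence

open Filter Topology MeasureTheory

/-- The local flow of a smooth vector field is `C^n` jointly in time and initial value, for every
finite `n`. The domain depends on `n`. -/
lemma exists_smooth_local_flow {V : Type*} [NormedAddCommGroup V] [NormedSpace ℝ V]
    [FiniteDimensional ℝ V] {f : V → V} {x₀ : V} {O : Set V} (hO : O ∈ 𝓝 x₀)
    (hf : ∀ x ∈ O, ContDiffAt ℝ ∞ f x) (n : ℕ) :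
    ∃ Ψ : ℝ × V → V, ∃ ε > 0, ∃ U ∈ 𝓝 x₀, ContDiffOn ℝ n Ψ (Ioo (-ε) ε ×ˢ U) ∧
      ∀ x ∈ U, Ψ (0, x) = x ∧ ∀ t ∈ Ioo (-ε) ε, Ψ (t, x) ∈ O ∧
        HasDerivAt (fun t => Ψ (t, x)) (f (Ψ (t, x))) t := by
  have : CompleteSpace V := FiniteDimensional.complete ℝ V
  obtain ⟨r, hr, hrO⟩ := Metric.mem_nhds_iff.1 hO
  -- the field is multiplied by a bump function, to be defined everywhere with compact support
  let b : ContDiffBump x₀ := ⟨r / 3, r / 2, by positivity, by linarith⟩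
  let g : V → V := fun x => b x • f x
  have hbr : Metric.closedBall x₀ (r / 2) ⊆ Metric.ball x₀ r :=
    Metric.closedBall_subset_ball (by linarith)
  have hg : ContDiff ℝ ∞ g := by
    rw [contDiff_iff_contDiffAt]
    intro x
    by_cases hx : x ∈ Metric.closedBall x₀ (r / 2)
    · exact b.contDiffAt.smul (hf x (hrO (hbr hx)))
    · have h1 : ∀ᶠ y in 𝓝 x, g y = 0 := by
        filter_upwards [Metric.isClosed_closedBall.isOpen_compl.mem_nhds hx] with y hy
        have : b y = 0 := b.zero_of_le_dist (not_le.1 fun h => hy (by simpa using h)).le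
        simp [g, this]
      exact (contDiffAt_const (c := (0 : V))).congr_of_eventuallyEq h1
  have hgc : HasCompactSupport g := b.hasCompactSupport.smul_right
  have hgf : ∀ x ∈ Metric.ball x₀ (r / 3), g x = f x := fun x hx => by
    have : b x = 1 := b.one_of_mem_closedBall (Metric.ball_subset_closedBall hx)
    simp [g, this]
  obtain ⟨K, hK⟩ := (hg.of_le (m := 1) (by simp)).lipschitzWith_of_hasCompactSupport hgc (by simp)
  obtain ⟨α, hα⟩ := (hg.of_le (m := 1) (by simp)).contDiffAt.exists_eventually_eq_hasDerivAt
    (x₀ := x₀) 0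
  obtain ⟨Γ, hΓ, hΓeq⟩ := exists_smooth_solution hg hgc x₀
  obtain ⟨U₁, hU₁, I₁, hI₁, hα'⟩ := mem_prod_iff.1 hα
  obtain ⟨ε₁, hε₁, hI₁'⟩ := Metric.mem_nhds_iff.1 hI₁
  let ev : C(Icc (0 : ℝ) 1, V) →L[ℝ] V := ContinuousMap.evalCLM ℝ (⟨1, by simp⟩ : Icc (0 : ℝ) 1)
  -- the flow for the time `τ` of `g` is the flow for the time `1` of `τ g`, because
  -- `u ↦ α x (τ u)` solves `γ' = τ g (γ)`
  have hkey : ∀ᶠ q in 𝓝 ((0 : ℝ), x₀), α q.2 q.1 = ev (Γ q) := by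
    filter_upwards [hΓeq, prod_mem_nhds (Metric.ball_mem_nhds (0 : ℝ) hε₁) hU₁] with q hq hqm
    obtain ⟨τ, x⟩ := q
    have hτ : |τ| < ε₁ := by simpa using hqm.1
    have hαx : ∀ t, |t| < ε₁ → α x 0 = x ∧ HasDerivAt (α x) (g (α x t)) t := fun t ht =>
      hα' (mk_mem_prod hqm.2 (hI₁' (by simpa using ht)))
    set G : ℝ → V := fun u => x + τ • ∫ s in (0 : ℝ)..u, g (IccExtend zero_le_one (Γ (τ, x)) s)
    have hGd : ∀ u, HasDerivAt G (τ • g (IccExtend zero_le_one (Γ (τ, x)) u)) u := fun u => by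
      have hc : Continuous fun s => g (IccExtend zero_le_one (Γ (τ, x)) s) :=
        hg.continuous.comp (Γ (τ, x)).continuous.Icc_extend'
      exact ((intervalIntegral.integral_hasDerivAt_right (hc.intervalIntegrable _ _)
        hc.stronglyMeasurable.stronglyMeasurableAtFilter hc.continuousAt).const_smul τ).const_add x
    have hGeq : ∀ u : Icc (0 : ℝ) 1, Γ (τ, x) u = G u := hq
    have hbd : ∀ u ∈ Icc (0 : ℝ) 1, |τ * u| < ε₁ := fun u hu => by
      rw [abs_mul, abs_of_nonneg hu.1]
      exact (mul_le_of_le_one_right (abs_nonneg _) hu.2).trans_lt hτ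
    have hβd : ∀ u ∈ Icc (0 : ℝ) 1,
        HasDerivAt (fun u => α x (τ * u)) (τ • g (α x (τ * u))) u := fun u hu => by
      have h1 := (hαx _ (hbd u hu)).2
      have h2 : HasDerivAt (fun u : ℝ => τ * u) τ u := by
        simpa using (hasDerivAt_id u).const_mul τ
      exact h1.scomp u h2
    have huniq : EqOn (fun u => α x (τ * u)) G (Icc 0 1) := by
      refine ODE_solution_unique (v := fun _ y => τ • g y) (K := ‖τ‖₊ * K)
        (fun _ => (lipschitzWith_smul τ).comp hK)
        (fun u hu => (hβd u hu).continuousAt.continuousWithinAt)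
        (fun u hu => (hβd u (Ico_subset_Icc_self hu)).hasDerivWithinAt)
        (fun u _ => (hGd u).continuousAt.continuousWithinAt)
        (fun u hu => ?_) ?_
      · have h1 : IccExtend zero_le_one (Γ (τ, x)) u = G u := by
          rw [IccExtend_of_mem _ _ (Ico_subset_Icc_self hu)]
          exact hGeq _
        have h2 := (hGd u).hasDerivWithinAt (s := Ici u)
        rwa [h1] at h2
      · simp [G, (hαx 0 (by simpa using hε₁)).1]
    have h1 := huniq (right_mem_Icc.2 zero_le_one)
    simp only [mul_one] at h1
    exact h1.trans (hGeq ⟨1, by simp⟩).symm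
  -- `α` is smooth near `(0, x₀)` because it coincides there with the implicit function
  have hsm : ContDiffAt ℝ n (fun q : ℝ × V => α q.2 q.1) (0, x₀) :=
    ((ev.contDiff.contDiffAt.comp _ hΓ).congr_of_eventuallyEq hkey).of_le (by exact_mod_cast le_top)
  obtain ⟨w, hw, hsmw⟩ := hsm.contDiffOn' le_rfl (by simp)
  have hα0 : α x₀ 0 = x₀ :=
    (hα' (mk_mem_prod (mem_of_mem_nhds hU₁) (mem_of_mem_nhds hI₁))).1
  have hball : ∀ᶠ q in 𝓝 ((0 : ℝ), x₀), α q.2 q.1 ∈ Metric.ball x₀ (r / 3) :=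
    hsm.continuousAt.eventually (by
      change _ ∈ 𝓝 (α x₀ 0)
      rw [hα0]
      exact Metric.ball_mem_nhds x₀ (by positivity : 0 < r / 3))
  have hall : ∀ᶠ q in 𝓝 ((0 : ℝ), x₀), q ∈ w ∧ α q.2 q.1 ∈ Metric.ball x₀ (r / 3) ∧
      α q.2 0 = q.2 ∧ HasDerivAt (α q.2) (g (α q.2 q.1)) q.1 := by
    have h1 : ∀ᶠ q in 𝓝 ((0 : ℝ), x₀), q ∈ w := hw.mem_nhds hsmw.1
    have h2 : ∀ᶠ q in 𝓝 ((0 : ℝ), x₀), α q.2 0 = q.2 ∧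
        HasDerivAt (α q.2) (g (α q.2 q.1)) q.1 := by
      filter_upwards [prod_mem_nhds hI₁ hU₁] with q hq
      exact hα' (mk_mem_prod hq.2 hq.1)
    filter_upwards [h1, hball, h2] with q a b c using ⟨a, b, c⟩
  obtain ⟨I₂, hI₂, U₂, hU₂, h2⟩ := mem_nhds_prod_iff.1 hall
  obtain ⟨ε, hε, hI₂'⟩ := Metric.mem_nhds_iff.1 hI₂
  rw [Real.ball_eq_Ioo, zero_sub, zero_add] at hI₂'
  refine ⟨fun q => α q.2 q.1, ε, hε, U₂, hU₂, hsmw.2.mono fun q hq => ?_, fun x hx => ?_⟩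
  · exact ⟨mem_insert_of_mem _ (mem_univ _), (h2 (mk_mem_prod (hI₂' hq.1) hq.2)).1⟩
  · refine ⟨(h2 (mk_mem_prod (hI₂' (by simp [hε])) hx)).2.2.1, fun t ht => ?_⟩
    have h3 := (h2 (mk_mem_prod (hI₂' ht) hx)).2
    refine ⟨hrO (Metric.ball_subset_ball (by linarith) h3.1), ?_⟩
    rw [← hgf _ h3.1]
    exact h3.2.2

end SmoothDependence

/-! ### Vector fields in charts -/

section Charts

open Filter Topology

variable {E H : Type*} [NormedAddCommGroup E] [NormedSpace ℝ E] [TopologicalSpace H]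
  {I : ModelWithCorners ℝ E H} {N : Type*} [TopologicalSpace N] [ChartedSpace H N]
  [I.Boundaryless] [IsManifold I ∞ N]

lemma contMDiffAt_extChartAt_symm_of_mem {x : N} {y : E} (hy : y ∈ (extChartAt I x).target) :
    ContMDiffAt 𝓘(ℝ, E) I ∞ (extChartAt I x).symm y :=
  (contMDiffOn_extChartAt_symm x).contMDiffAt ((isOpen_extChartAt_target x).mem_nhds hy)

lemma contMDiffAt_extChartAt_of_mem {x x' : N} (hx' : x' ∈ (extChartAt I x).source) :
    ContMDiffAt I 𝓘(ℝ, E) ∞ (extChartAt I x) x' :=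
  contMDiffAt_extChartAt' (by rwa [extChartAt_source] at hx')

lemma mdifferentiableAt_extChartAt_symm_of_mem {x : N} {y : E}
    (hy : y ∈ (extChartAt I x).target) :
    MDifferentiableAt 𝓘(ℝ, E) I (extChartAt I x).symm y :=
  (contMDiffAt_extChartAt_symm_of_mem hy).mdifferentiableAt (by simp)

lemma mfderiv_extChartAt_symm_apply_extChartAt {x : N} {y : E} (hy : y ∈ (extChartAt I x).target)
    (w : TangentSpace I ((extChartAt I x).symm y)) :
    mfderiv 𝓘(ℝ, E) I (extChartAt I x).symm y
      (mfderiv I 𝓘(ℝ, E) (extChartAt I x) ((extChartAt I x).symm y) w) = w := by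
  have h := mfderivWithin_extChartAt_symm_comp_mfderiv_extChartAt hy
  rw [I.range_eq_univ, mfderivWithin_univ] at h
  exact DFunLike.congr_fun h w

lemma mfderiv_extChartAt_apply_extChartAt_symm {x : N} {y : E} (hy : y ∈ (extChartAt I x).target)
    (w : E) :
    mfderiv I 𝓘(ℝ, E) (extChartAt I x) ((extChartAt I x).symm y)
      (mfderiv 𝓘(ℝ, E) I (extChartAt I x).symm y w) = w := by
  have h := mfderiv_extChartAt_comp_mfderivWithin_extChartAt_symm hy
  rw [I.range_eq_univ, mfderivWithin_univ] at h
  exact DFunLike.congr_fun h w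

variable (I) in
/-- The expression of a vector field in the preferred chart at `x`. -/
noncomputable def vectorFieldInChart (v : ∀ x : N, TangentSpace I x) (x : N) (y : E) : E :=
  mfderiv I 𝓘(ℝ, E) (extChartAt I x) ((extChartAt I x).symm y) (v ((extChartAt I x).symm y))

variable (I) in
/-- Smoothness of a vector field, expressed in charts. -/
def IsSmoothVectorField (v : ∀ x : N, TangentSpace I x) : Prop :=
  ∀ (x : N), ∀ y ∈ (extChartAt I x).target, ContDiffAt ℝ ∞ (vectorFieldInChart I v x) y

lemma IsSmoothVectorField.contMDiff {v : ∀ x : N, TangentSpace I x}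
    (hv : IsSmoothVectorField I v) :
    ContMDiff I (I.prod 𝓘(ℝ, E)) ∞ (fun x => (⟨x, v x⟩ : TangentBundle I N)) := by
  intro x
  refine (contMDiffAt_section x).2 ?_
  have h1 : ContMDiffAt I 𝓘(ℝ, E) ∞ (fun z => vectorFieldInChart I v x (extChartAt I x z)) x :=
    (hv x _ (mem_extChartAt_target x)).contMDiffAt.comp x
      (contMDiffAt_extChartAt_of_mem (mem_extChartAt_source x))
  refine h1.congr_of_eventuallyEq ?_
  filter_upwards [extChartAt_source_mem_nhds (I := I) x] with z hz
  have hz' : z ∈ (chartAt H x).source := by rwa [extChartAt_source] at hz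
  have h2 := DFunLike.congr_fun (TangentBundle.continuousLinearMapAt_trivializationAt
    (I := I) hz') (v z)
  rw [Trivialization.continuousLinearMapAt_apply, Trivialization.linearMapAt_apply,
    if_pos (by simpa using hz')] at h2
  rw [h2, vectorFieldInChart, (extChartAt I x).left_inv hz]
  rfl

/-- In a chart, an integral curve of the expression of a vector field gives an integral curve. -/
lemma hasMFDerivAt_extChartAt_symm_comp {v : ∀ x : N, TangentSpace I x} {x : N} {c : ℝ → E} {t : ℝ}
    (hct : c t ∈ (extChartAt I x).target)
    (hc : HasDerivAt c (vectorFieldInChart I v x (c t)) t) :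
    HasMFDerivAt 𝓘(ℝ, ℝ) I (fun t => (extChartAt I x).symm (c t)) t
      ((1 : ℝ →L[ℝ] ℝ).smulRight (v ((extChartAt I x).symm (c t)))) := by
  have h1 := (mdifferentiableAt_extChartAt_symm_of_mem hct).hasMFDerivAt.comp t
    hc.hasFDerivAt.hasMFDerivAt
  refine h1.congr_mfderiv ?_
  ext
  change mfderiv 𝓘(ℝ, E) I (extChartAt I x).symm (c t)
    ((1 : ℝ) • vectorFieldInChart I v x (c t)) = (1 : ℝ) • v ((extChartAt I x).symm (c t))
  rw [one_smul, one_smul]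
  exact mfderiv_extChartAt_symm_apply_extChartAt hct _

/-- The local flow of a smooth vector field on a manifold without boundary. -/
lemma IsSmoothVectorField.exists_local_flow [FiniteDimensional ℝ E]
    {v : ∀ x : N, TangentSpace I x} (hv : IsSmoothVectorField I v) (x₀ : N) (n : ℕ) :
    ∃ Ψ : ℝ × N → N, ∃ ε > 0, ∃ U ∈ 𝓝 x₀,
      (∀ t ∈ Ioo (-ε) ε, ∀ x ∈ U, ContMDiffAt (𝓘(ℝ, ℝ).prod I) I n Ψ (t, x)) ∧
      ∀ x ∈ U, Ψ (0, x) = x ∧ IsMIntegralCurveOn (fun t => Ψ (t, x)) v (Ioo (-ε) ε) := by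
  obtain ⟨ψ, ε, hε, U, hU, hψ, hψ'⟩ := exists_smooth_local_flow
    (extChartAt_target_mem_nhds (I := I) x₀) (hv x₀) n
  obtain ⟨U', hU'U, hU'o, hxU'⟩ := mem_nhds_iff.1 hU
  let φ := extChartAt I x₀
  let U'' : Set N := φ.source ∩ φ ⁻¹' U'
  have hU''o : IsOpen U'' := isOpen_extChartAt_preimage' x₀ hU'o
  refine ⟨fun q => φ.symm (ψ (q.1, φ q.2)), ε, hε, U'',
    hU''o.mem_nhds ⟨mem_extChartAt_source x₀, hxU'⟩, fun t ht x hx => ?_, fun x hx => ⟨?_, ?_⟩⟩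
  · have h1 : ContMDiffAt (𝓘(ℝ, ℝ).prod I) 𝓘(ℝ, ℝ × E) n (fun q : ℝ × N => (q.1, φ q.2))
        (t, x) :=
      contMDiffAt_fst.prodMk_space
        (((contMDiffAt_extChartAt_of_mem hx.1).of_le (by exact_mod_cast le_top)).comp (t, x)
          contMDiffAt_snd)
    have h2 : ContDiffAt ℝ n ψ (t, φ x) :=
      hψ.contDiffAt (prod_mem_nhds (Ioo_mem_nhds ht.1 ht.2)
        (mem_of_superset (hU'o.mem_nhds hx.2) hU'U))
    have h3 : ContMDiffAt 𝓘(ℝ, E) I n φ.symm (ψ (t, φ x)) :=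
      (contMDiffAt_extChartAt_symm_of_mem ((hψ' _ (hU'U hx.2)).2 t ht).1).of_le
        (by exact_mod_cast le_top)
    exact ContMDiffAt.comp (t, x) h3 (h2.contMDiffAt.comp (t, x) h1)
  · simp only [(hψ' _ (hU'U hx.2)).1]
    exact φ.left_inv hx.1
  · intro t ht
    exact (hasMFDerivAt_extChartAt_symm_comp ((hψ' _ (hU'U hx.2)).2 t ht).1
      ((hψ' _ (hU'U hx.2)).2 t ht).2).hasMFDerivWithinAt

end Charts

/-! ### Global flows -/

section GlobalFlow

open Filter Topology

variable {E H : Type*} [NormedAddCommGroup E] [NormedSpace ℝ E] [TopologicalSpace H]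
  {I : ModelWithCorners ℝ E H} {N : Type*} [TopologicalSpace N] [ChartedSpace H N]
  [I.Boundaryless] [IsManifold I ∞ N] [FiniteDimensional ℝ E] [T2Space N]
  {v : ∀ x : N, TangentSpace I x}

/-- If the integral curves through each point remain in a compact set for bounded times, the vector
field is complete. -/
lemma IsSmoothVectorField.exists_isMIntegralCurve (hv : IsSmoothVectorField I v)
    (htrap : ∀ (x : N) (a : ℝ), ∃ K : Set N, IsCompact K ∧ ∀ (γ : ℝ → N) (b : ℝ), b ≤ a → γ 0 = x →
      IsMIntegralCurveOn γ v (Ioo (-b) b) → ∀ t ∈ Ioo (-b) b, γ t ∈ K) (x : N) :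
    ∃ γ : ℝ → N, γ 0 = x ∧ IsMIntegralCurve γ v := by
  have hv1 : ContMDiff I (I.prod 𝓘(ℝ, E)) 1 (fun x => (⟨x, v x⟩ : TangentBundle I N)) :=
    hv.contMDiff.of_le (by simp)
  rw [exists_isMIntegralCurve_iff_exists_isMIntegralCurveOn_Ioo hv1]
  intro a
  obtain ⟨K₀, hK₀, htr₀⟩ := htrap x a
  set K := insert x K₀
  have hK : IsCompact K := hK₀.insert x
  -- a time of existence that is uniform on `K`
  obtain ⟨ε, hε, huni⟩ : ∃ ε > 0, ∀ y ∈ K, ∃ γ : ℝ → N, γ 0 = y ∧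
      IsMIntegralCurveOn γ v (Ioo (-ε) ε) := by
    refine hK.induction_on (p := fun s => ∃ ε > 0, ∀ y ∈ s, ∃ γ : ℝ → N, γ 0 = y ∧
      IsMIntegralCurveOn γ v (Ioo (-ε) ε)) ⟨1, one_pos, by simp⟩ ?_ ?_ ?_
    · rintro s t hst ⟨ε, hε, h⟩
      exact ⟨ε, hε, fun y hy => h y (hst hy)⟩
    · rintro s t ⟨ε, hε, h⟩ ⟨δ, hδ, h'⟩
      refine ⟨min ε δ, lt_min hε hδ, ?_⟩
      rintro y (hy | hy)
      · obtain ⟨γ, h1, h2⟩ := h y hy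
        exact ⟨γ, h1, h2.mono (Ioo_subset_Ioo (neg_le_neg (min_le_left _ _)) (min_le_left _ _))⟩
      · obtain ⟨γ, h1, h2⟩ := h' y hy
        exact ⟨γ, h1, h2.mono (Ioo_subset_Ioo (neg_le_neg (min_le_right _ _)) (min_le_right _ _))⟩
    · intro y _
      obtain ⟨Ψ, ε, hε, U, hU, -, h⟩ := hv.exists_local_flow y 0
      exact ⟨U, mem_nhdsWithin_of_mem_nhds hU, ε, hε, fun z hz => ⟨fun t => Ψ (t, z), h z hz⟩⟩
  -- the interval of existence is extended by `ε / 2` at both ends as long as it is shorter than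
  -- `(-a, a)`, by integral curves through the points at the distance `ε / 2` from its ends
  have hind : ∀ n : ℕ, ∃ γ : ℝ → N, γ 0 = x ∧
      IsMIntegralCurveOn γ v (Ioo (-(min a (ε + n * (ε / 2)))) (min a (ε + n * (ε / 2)))) := by
    intro n
    induction n with
    | zero =>
      obtain ⟨γ, h1, h2⟩ := huni x (mem_insert _ _)
      have : min a (ε + (0 : ℕ) * (ε / 2)) ≤ ε := by simp
      exact ⟨γ, h1, h2.mono (Ioo_subset_Ioo (neg_le_neg this) this)⟩
    | succ n ih =>
      obtain ⟨γ, h0, hγ⟩ := ih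
      rcases le_or_gt a (ε + n * (ε / 2)) with hle | hlt
      · rw [min_eq_left hle] at hγ
        have : min a (ε + (n + 1 : ℕ) * (ε / 2)) ≤ a := min_le_left _ _
        exact ⟨γ, h0, hγ.mono (Ioo_subset_Ioo (neg_le_neg this) this)⟩
      rw [min_eq_right hlt.le] at hγ
      set b := ε + n * (ε / 2) with hb
      have hbε : ε ≤ b := le_add_of_nonneg_right (by positivity)
      have hmem : ∀ t ∈ Ioo (-b) b, γ t ∈ K := fun t ht =>
        mem_insert_of_mem _ (htr₀ γ b hlt.le h0 hγ t ht)
      obtain ⟨γ1_aux, h1_aux, hγ1⟩ := huni _ (hmem (-(b - ε / 2)) ⟨by linarith, by linarith⟩)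
      rw [← isMIntegralCurveOn_comp_add (dt := b - ε / 2)] at hγ1
      set γ1 := γ1_aux ∘ (· + (b - ε / 2)) with γ1_def
      have heq1 : γ1 (-(b - ε / 2)) = γ (-(b - ε / 2)) := by simp [γ1_def, h1_aux]
      obtain ⟨γ2_aux, h2_aux, hγ2⟩ := huni _ (hmem (b - ε / 2) ⟨by linarith, by linarith⟩)
      rw [← isMIntegralCurveOn_comp_sub (dt := b - ε / 2)] at hγ2
      set γ2 := γ2_aux ∘ (· - (b - ε / 2)) with γ2_def
      have heq2 : γ2 (b - ε / 2) = γ (b - ε / 2) := by simp [γ2_def, h2_aux]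
      simp_rw [Set.mem_Ioo, ← sub_lt_iff_lt_add, ← lt_sub_iff_add_lt, ← Set.mem_Ioo] at hγ1
      simp_rw [Set.mem_Ioo, lt_sub_iff_add_lt, sub_lt_iff_lt_add, ← Set.mem_Ioo] at hγ2
      set γ_ext : ℝ → N := piecewise (Ioo (-(b + ε / 2)) b)
        (piecewise (Ioo (-b) b) γ γ1) γ2 with γ_ext_def
      have heq_ext : γ_ext 0 = x := by
        rw [γ_ext_def, piecewise, if_pos ⟨by linarith, by linarith⟩, piecewise,
          if_pos ⟨by linarith, by linarith⟩, h0]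
      have hext : IsMIntegralCurveOn γ_ext v (Ioo (-(b + ε / 2)) (b + ε / 2)) := by
        apply (isMIntegralCurveOn_piecewise (t₀ := b - ε / 2) hv1 _ hγ2
          ⟨⟨by linarith, by linarith⟩, ⟨by linarith, by linarith⟩⟩
          (by rw [piecewise, if_pos ⟨by linarith, by linarith⟩, ← heq2])).mono
          (Ioo_subset_Ioo_union_Ioo le_rfl (by linarith) (by linarith))
        exact (isMIntegralCurveOn_piecewise (t₀ := -(b - ε / 2)) hv1 hγ hγ1
          ⟨⟨by linarith, by linarith⟩, ⟨by linarith, by linarith⟩⟩ heq1.symm).mono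
          (union_comm _ _ ▸ Ioo_subset_Ioo_union_Ioo (by linarith) (by linarith) le_rfl)
      have : min a (ε + (n + 1 : ℕ) * (ε / 2)) ≤ b + ε / 2 :=
        (min_le_right _ _).trans (by rw [hb]; push_cast; linarith)
      exact ⟨γ_ext, heq_ext, hext.mono (Ioo_subset_Ioo (neg_le_neg this) this)⟩
  obtain ⟨n, hn⟩ := exists_nat_ge (a / (ε / 2))
  have hn' : a ≤ ε + n * (ε / 2) := by
    rw [div_le_iff₀ (by positivity)] at hn
    linarith
  simpa [min_eq_left hn'] using hind n

/-- The flow of a complete smooth vector field is smooth. Smoothness at a point propagates along the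
integral curve, because the flow near a given time is the composition of the flow at an earlier time
with the smooth local flow. -/
lemma IsSmoothVectorField.exists_flow (hv : IsSmoothVectorField I v)
    (hc : ∀ x, ∃ γ : ℝ → N, γ 0 = x ∧ IsMIntegralCurve γ v) :
    ∃ Ψ : ℝ × N → N, ContMDiff (𝓘(ℝ, ℝ).prod I) I ∞ Ψ ∧ (∀ x, Ψ (0, x) = x) ∧
      (∀ x, IsMIntegralCurve (fun t => Ψ (t, x)) v) ∧
      ∀ s t x, Ψ (s, Ψ (t, x)) = Ψ (s + t, x) := by
  have hv1 : ContMDiff I (I.prod 𝓘(ℝ, E)) 1 (fun x => (⟨x, v x⟩ : TangentBundle I N)) :=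
    hv.contMDiff.of_le (by simp)
  choose γ hγ0 hγ using hc
  have hadd : ∀ s t x, γ (γ x t) s = γ x (s + t) := fun s t x =>
    congrFun (isMIntegralCurve_Ioo_eq_of_contMDiff_boundaryless (t₀ := 0) hv1 (hγ (γ x t))
      ((hγ x).comp_add t) (by simp [hγ0])) s
  refine ⟨fun q => γ q.2 q.1, ?_, hγ0, hγ, hadd⟩
  refine contMDiff_infty.2 fun n => ?_
  -- near time `0` the flow agrees with the local flow
  have hloc : ∀ y : N, ∃ ε > 0, ∃ U ∈ 𝓝 y, ∀ t ∈ Ioo (-ε) ε, ∀ x ∈ U,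
      ContMDiffAt (𝓘(ℝ, ℝ).prod I) I n (fun q : ℝ × N => γ q.2 q.1) (t, x) := by
    intro y
    obtain ⟨Ψ, ε, hε, U, hU, h1, h2⟩ := hv.exists_local_flow y n
    obtain ⟨U', hU'U, hU'o, hyU'⟩ := mem_nhds_iff.1 hU
    refine ⟨ε, hε, U', hU'o.mem_nhds hyU', fun t ht x hx => ?_⟩
    refine (h1 t ht x (hU'U hx)).congr_of_eventuallyEq ?_
    filter_upwards [prod_mem_nhds (Ioo_mem_nhds ht.1 ht.2) (hU'o.mem_nhds hx)] with q hq
    have h3 := h2 q.2 (hU'U hq.2)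
    exact isMIntegralCurveOn_Ioo_eqOn_of_contMDiff_boundaryless (t₀ := 0) ⟨by linarith, hε⟩ hv1
      ((hγ q.2).isMIntegralCurveOn _) h3.2 (by rw [hγ0, h3.1]) hq.1
  -- the times at which the flow is smooth in the initial value form a clopen set
  have htime : ∀ x t, ContMDiffAt I I n (fun z => γ z t) x := by
    intro x
    have hcl : IsClopen {t | ContMDiffAt I I n (fun z => γ z t) x} := by
      have hstep : ∀ t, ∃ W ∈ 𝓝 t, ∀ s ∈ W, ∀ r ∈ W,
          ContMDiffAt I I n (fun z => γ z s) x → ContMDiffAt I I n (fun z => γ z r) x := by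
        intro t
        obtain ⟨ε, hε, U, hU, h⟩ := hloc (γ x t)
        refine ⟨Ioo (t - ε / 2) (t + ε / 2) ∩ γ x ⁻¹' U, inter_mem
          (Ioo_mem_nhds (by linarith) (by linarith))
          ((hγ x).continuous.continuousAt.preimage_mem_nhds hU), fun s hs r hr hsm => ?_⟩
        have h1 : (fun z => γ z r) = fun z => (fun q : ℝ × N => γ q.2 q.1) (r - s, γ z s) := by
          ext z
          simp only [hadd, sub_add_cancel]
        rw [h1]
        have h2 := h (r - s) ⟨by linarith [hr.1.1, hs.1.2], by linarith [hr.1.2, hs.1.1]⟩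
          (γ x s) hs.2
        exact ContMDiffAt.comp x h2 (contMDiffAt_const.prodMk hsm)
      constructor
      · rw [← isOpen_compl_iff, isOpen_iff_mem_nhds]
        intro t ht
        obtain ⟨W, hW, h⟩ := hstep t
        exact mem_of_superset hW fun s hs hsm => ht (h s hs t (mem_of_mem_nhds hW) hsm)
      · rw [isOpen_iff_mem_nhds]
        intro t ht
        obtain ⟨W, hW, h⟩ := hstep t
        exact mem_of_superset hW fun s hs => h t (mem_of_mem_nhds hW) s hs ht
    have h0 : (0 : ℝ) ∈ {t | ContMDiffAt I I n (fun z => γ z t) x} := by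
      have : (fun z => γ z 0) = id := funext hγ0
      change ContMDiffAt I I n (fun z => γ z 0) x
      rw [this]
      exact contMDiffAt_id
    have := hcl.eq_univ ⟨0, h0⟩
    exact fun t => this.ge (mem_univ t)
  rintro ⟨t, x⟩
  obtain ⟨ε, hε, U, hU, h⟩ := hloc (γ x t)
  have h1 : (fun q : ℝ × N => γ q.2 q.1) =
      fun q => (fun q : ℝ × N => γ q.2 q.1) (q.1 - t, γ q.2 t) := by
    ext q
    simp only [hadd, sub_add_cancel]
  rw [h1]
  have h2 := h 0 ⟨by linarith, hε⟩ (γ x t) (mem_of_mem_nhds hU)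
  rw [← sub_self t] at h2
  have h3 : ContMDiff (𝓘(ℝ, ℝ).prod I) 𝓘(ℝ, ℝ) n (fun q : ℝ × N => q.1 - t) :=
    ((contDiff_id.sub contDiff_const).contMDiff (n := n)).comp contMDiff_fst
  exact ContMDiffAt.comp (t, x) h2
    (h3.contMDiffAt.prodMk ((htime x t).comp (t, x) contMDiffAt_snd))

end GlobalFlow

/-! ### Pull-backs and exterior derivatives of one-forms -/

section Forms

open Filter Topology

section Flat

variable {V W : Type*} [NormedAddCommGroup V] [NormedSpace ℝ V]
  [NormedAddCommGroup W] [NormedSpace ℝ W]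

/-- Naturality of the exterior derivative of one-forms on vector spaces. -/
lemma fderiv_pullback_sub_swap {θ : W → W →L[ℝ] ℝ} {F : V → W} {z : V}
    (hF : ContDiffAt ℝ 2 F z) (hθ : DifferentiableAt ℝ θ (F z)) (a b : V) :
    fderiv ℝ (fun y => (θ (F y)).comp (fderiv ℝ F y)) z a b -
      fderiv ℝ (fun y => (θ (F y)).comp (fderiv ℝ F y)) z b a =
    fderiv ℝ θ (F z) (fderiv ℝ F z a) (fderiv ℝ F z b) -
      fderiv ℝ θ (F z) (fderiv ℝ F z b) (fderiv ℝ F z a) := by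
  have h1 : HasFDerivAt F (fderiv ℝ F z) z := (hF.differentiableAt (by simp)).hasFDerivAt
  have h2 : HasFDerivAt (fderiv ℝ F) (fderiv ℝ (fderiv ℝ F) z) z :=
    ((hF.fderiv_right (m := 1) (by norm_num)).differentiableAt (by simp)).hasFDerivAt
  have h3 := (hθ.hasFDerivAt.comp z h1).clm_comp h2
  have hsymm : fderiv ℝ (fderiv ℝ F) z a b = fderiv ℝ (fderiv ℝ F) z b a :=
    (hF.isSymmSndFDerivAt (by simp)) a b
  have h4 : fderiv ℝ (fun y => (θ (F y)).comp (fderiv ℝ F y)) z = _ := h3.fderiv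
  rw [h4]
  simp [hsymm]

end Flat

variable {E H : Type*} [NormedAddCommGroup E] [NormedSpace ℝ E] [TopologicalSpace H]
  {I : ModelWithCorners ℝ E H} {N : Type*} [TopologicalSpace N] [ChartedSpace H N]
  [I.Boundaryless] [IsManifold I ∞ N]
  {E' H' : Type*} [NormedAddCommGroup E'] [NormedSpace ℝ E'] [TopologicalSpace H']
  {J : ModelWithCorners ℝ E' H'} {N' : Type*} [TopologicalSpace N'] [ChartedSpace H' N']
  [J.Boundaryless] [IsManifold J ∞ N']

variable (I) in
/-- Smoothness of a one-form, expressed in charts. -/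
def IsSmoothForm (η : ∀ x : N, TangentSpace I x →L[ℝ] ℝ) : Prop :=
  ∀ (x : N), ∀ y ∈ (extChartAt I x).target, ContDiffAt ℝ ∞ (oneFormInChart I η x) y

variable (I J) in
/-- The pull-back of a one-form. -/
noncomputable def pullbackForm (f : N → N') (η : ∀ x : N', TangentSpace J x →L[ℝ] ℝ) (x : N) :
    TangentSpace I x →L[ℝ] ℝ :=
  (η (f x)).comp (mfderiv I J f x)

variable (I) in
/-- The coordinates of tangent vectors at `p` in the preferred chart at `x`. -/
noncomputable def tangentCoord (x p : N) : TangentSpace I p →L[ℝ] E :=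
  mfderiv I 𝓘(ℝ, E) (extChartAt I x) p

variable (I) in
/-- The tangent vector at a point of the preferred chart at `x` with given coordinates. -/
noncomputable def tangentCoordSymm (x : N) (z : E) :
    E →L[ℝ] TangentSpace I ((extChartAt I x).symm z) :=
  mfderiv 𝓘(ℝ, E) I (extChartAt I x).symm z

lemma tangentCoordSymm_tangentCoord {x : N} {z : E} (hz : z ∈ (extChartAt I x).target)
    (w : TangentSpace I ((extChartAt I x).symm z)) :
    tangentCoordSymm I x z (tangentCoord I x ((extChartAt I x).symm z) w) = w :=
  mfderiv_extChartAt_symm_apply_extChartAt hz w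

lemma tangentCoord_tangentCoordSymm {x : N} {z : E} (hz : z ∈ (extChartAt I x).target) (w : E) :
    tangentCoord I x ((extChartAt I x).symm z) (tangentCoordSymm I x z w) = w :=
  mfderiv_extChartAt_apply_extChartAt_symm hz w

/-- At the center of the chart, the coordinates of a tangent vector are the vector itself, since the
tangent space at `x` is defined through the preferred chart at `x`. -/
lemma tangentCoord_self (x : N) (u : TangentSpace I x) : tangentCoord I x x u = (u : E) := by
  unfold tangentCoord
  rw [mfderiv_extChartAt_self]
  rfl

lemma oneFormInChart_apply (η : ∀ x : N, TangentSpace I x →L[ℝ] ℝ) (x : N) (z w : E) :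
    oneFormInChart I η x z w = η ((extChartAt I x).symm z) (tangentCoordSymm I x z w) := rfl

lemma oneFormInChart_apply_tangentCoord (η : ∀ x : N, TangentSpace I x →L[ℝ] ℝ) {x p : N}
    (hp : p ∈ (extChartAt I x).source) (u : TangentSpace I p) :
    oneFormInChart I η x (extChartAt I x p) (tangentCoord I x p u) = η p u := by
  obtain ⟨y, hy, rfl⟩ : ∃ y ∈ (extChartAt I x).target, (extChartAt I x).symm y = p :=
    ⟨_, (extChartAt I x).map_source hp, (extChartAt I x).left_inv hp⟩
  rw [(extChartAt I x).right_inv hy, oneFormInChart_apply, tangentCoordSymm_tangentCoord hy]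

lemma fderiv_writtenInCharts {f : N → N'} (hf : ContMDiff I J ∞ f) {x₁ : N} {x₂ : N'} {z : E}
    (hz : z ∈ (extChartAt I x₁).target)
    (hz' : f ((extChartAt I x₁).symm z) ∈ (extChartAt J x₂).source) (w : E) :
    fderiv ℝ (fun y => extChartAt J x₂ (f ((extChartAt I x₁).symm y))) z w =
      tangentCoord J x₂ (f ((extChartAt I x₁).symm z))
        (mfderiv I J f ((extChartAt I x₁).symm z) (tangentCoordSymm I x₁ z w)) := by
  have h1 := (mdifferentiableAt_extChartAt_symm_of_mem hz).hasMFDerivAt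
  have h2 := ((hf.mdifferentiable (by simp)) ((extChartAt I x₁).symm z)).hasMFDerivAt
  have h3 := ((contMDiffAt_extChartAt_of_mem (I := J) hz').mdifferentiableAt
    (by simp)).hasMFDerivAt
  have h4 := (h3.comp z (h2.comp z h1)).mfderiv
  rw [← mfderiv_eq_fderiv]
  exact DFunLike.congr_fun h4 w

lemma contDiffAt_writtenInCharts {f : N → N'} (hf : ContMDiff I J ∞ f) {x₁ : N} {x₂ : N'} {z : E}
    (hz : z ∈ (extChartAt I x₁).target)
    (hz' : f ((extChartAt I x₁).symm z) ∈ (extChartAt J x₂).source) :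
    ContDiffAt ℝ ∞ (fun y => extChartAt J x₂ (f ((extChartAt I x₁).symm y))) z :=
  (ContMDiffAt.comp z (contMDiffAt_extChartAt_of_mem (I := J) hz')
    ((hf _).comp z (contMDiffAt_extChartAt_symm_of_mem hz))).contDiffAt

/-- In charts, the pull-back by `f` is the pull-back by the coordinate expression of `f`. -/
lemma oneFormInChart_pullbackForm {f : N → N'} (hf : ContMDiff I J ∞ f)
    (η : ∀ x : N', TangentSpace J x →L[ℝ] ℝ) {x₁ : N} {x₂ : N'} {z : E}
    (hz : z ∈ (extChartAt I x₁).target)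
    (hz' : f ((extChartAt I x₁).symm z) ∈ (extChartAt J x₂).source) :
    oneFormInChart I (pullbackForm I J f η) x₁ z =
      (oneFormInChart J η x₂ (extChartAt J x₂ (f ((extChartAt I x₁).symm z)))).comp
        (fderiv ℝ (fun y => extChartAt J x₂ (f ((extChartAt I x₁).symm y))) z) := by
  ext w
  rw [ContinuousLinearMap.comp_apply, fderiv_writtenInCharts hf hz hz']
  exact (oneFormInChart_apply_tangentCoord η hz' _).symm

lemma eventually_mem_charts {f : N → N'} (hf : ContMDiff I J ∞ f) {x₁ : N} {x₂ : N'} {z : E}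
    (hz : z ∈ (extChartAt I x₁).target)
    (hz' : f ((extChartAt I x₁).symm z) ∈ (extChartAt J x₂).source) :
    ∀ᶠ y in 𝓝 z, y ∈ (extChartAt I x₁).target ∧
      f ((extChartAt I x₁).symm y) ∈ (extChartAt J x₂).source := by
  have h1 : ContinuousAt (fun y => f ((extChartAt I x₁).symm y)) z :=
    hf.continuous.continuousAt.comp (contMDiffAt_extChartAt_symm_of_mem hz).continuousAt
  filter_upwards [(isOpen_extChartAt_target x₁).mem_nhds hz,
    h1.preimage_mem_nhds ((isOpen_extChartAt_source x₂).mem_nhds hz')] with y a b using ⟨a, b⟩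

lemma IsSmoothForm.pullbackForm {η : ∀ x : N', TangentSpace J x →L[ℝ] ℝ} (hη : IsSmoothForm J η)
    {f : N → N'} (hf : ContMDiff I J ∞ f) : IsSmoothForm I (pullbackForm I J f η) := by
  intro x z hz
  set x₂ := f ((extChartAt I x).symm z)
  have hz' : f ((extChartAt I x).symm z) ∈ (extChartAt J x₂).source := mem_extChartAt_source x₂
  have hF := contDiffAt_writtenInCharts hf hz hz'
  have h1 : ContDiffAt ℝ ∞ (fun y =>
      (oneFormInChart J η x₂ (extChartAt J x₂ (f ((extChartAt I x).symm y)))).comp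
        (fderiv ℝ (fun y => extChartAt J x₂ (f ((extChartAt I x).symm y))) y)) z :=
    (ContDiffAt.comp z (hη x₂ _ ((extChartAt J x₂).map_source hz')) hF).clm_comp
      (hF.fderiv_right (by simp))
  refine h1.congr_of_eventuallyEq ?_
  filter_upwards [eventually_mem_charts hf hz hz'] with y hy
  exact oneFormInChart_pullbackForm hf η hy.1 hy.2

variable (I) in
/-- The exterior derivative at `x` of a one-form, computed in the preferred chart at `x₀`. -/
noncomputable def extDerivInChart (η : ∀ x : N, TangentSpace I x →L[ℝ] ℝ) (x₀ x : N)
    (v w : TangentSpace I x) : ℝ :=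
  fderiv ℝ (oneFormInChart I η x₀) (extChartAt I x₀ x) (tangentCoord I x₀ x v)
      (tangentCoord I x₀ x w) -
    fderiv ℝ (oneFormInChart I η x₀) (extChartAt I x₀ x) (tangentCoord I x₀ x w)
      (tangentCoord I x₀ x v)

/-- Naturality of the exterior derivative, for arbitrary charts in the source and in the target. The
independence of the chart is the case of the identity. -/
lemma extDerivInChart_pullbackForm {f : N → N'} (hf : ContMDiff I J ∞ f)
    {η : ∀ x : N', TangentSpace J x →L[ℝ] ℝ} (hη : IsSmoothForm J η) {x₁ x : N} {x₂ : N'}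
    (hx : x ∈ (extChartAt I x₁).source) (hx' : f x ∈ (extChartAt J x₂).source)
    (v w : TangentSpace I x) :
    extDerivInChart I (pullbackForm I J f η) x₁ x v w =
      extDerivInChart J η x₂ (f x) (mfderiv I J f x v) (mfderiv I J f x w) := by
  obtain ⟨z, hz, rfl⟩ : ∃ y ∈ (extChartAt I x₁).target, (extChartAt I x₁).symm y = x :=
    ⟨_, (extChartAt I x₁).map_source hx, (extChartAt I x₁).left_inv hx⟩
  have hF := contDiffAt_writtenInCharts hf hz hx'
  have h1 : oneFormInChart I (pullbackForm I J f η) x₁ =ᶠ[𝓝 z] fun y =>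
      (oneFormInChart J η x₂ (extChartAt J x₂ (f ((extChartAt I x₁).symm y)))).comp
        (fderiv ℝ (fun y => extChartAt J x₂ (f ((extChartAt I x₁).symm y))) y) := by
    filter_upwards [eventually_mem_charts hf hz hx'] with y hy
    exact oneFormInChart_pullbackForm hf η hy.1 hy.2
  have h2 : ∀ u : TangentSpace I ((extChartAt I x₁).symm z),
      fderiv ℝ (fun y => extChartAt J x₂ (f ((extChartAt I x₁).symm y))) z
        (tangentCoord I x₁ ((extChartAt I x₁).symm z) u) =
      tangentCoord J x₂ (f ((extChartAt I x₁).symm z))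
        (mfderiv I J f ((extChartAt I x₁).symm z) u) := fun u => by
    rw [fderiv_writtenInCharts hf hz hx', tangentCoordSymm_tangentCoord hz]
  unfold extDerivInChart
  rw [(extChartAt I x₁).right_inv hz, h1.fderiv_eq,
    fderiv_pullback_sub_swap (θ := oneFormInChart J η x₂)
    (hF.of_le ENat.LEInfty.out)
    ((hη x₂ _ ((extChartAt J x₂).map_source hx')).differentiableAt (by simp)), h2, h2]

lemma pullbackForm_id (η : ∀ x : N, TangentSpace I x →L[ℝ] ℝ) : pullbackForm I I id η = η := by
  ext x u
  change η x (mfderiv I I id x u) = _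
  rw [mfderiv_id]
  rfl

/-- The exterior derivative does not depend on the chart. -/
lemma extDerivInChart_eq {η : ∀ x : N, TangentSpace I x →L[ℝ] ℝ} (hη : IsSmoothForm I η)
    {x₁ x : N} (hx : x ∈ (extChartAt I x₁).source) (v w : TangentSpace I x) :
    extDerivInChart I η x₁ x v w = extDerivOneForm I η x v w := by
  have h := extDerivInChart_pullbackForm contMDiff_id hη hx (x₂ := x) (mem_extChartAt_source x) v w
  rw [pullbackForm_id, mfderiv_id] at h
  exact h

/-- Naturality of the exterior derivative. -/
lemma extDerivOneForm_pullbackForm {f : N → N'} (hf : ContMDiff I J ∞ f)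
    {η : ∀ x : N', TangentSpace J x →L[ℝ] ℝ} (hη : IsSmoothForm J η) (x : N)
    (v w : TangentSpace I x) :
    extDerivOneForm I (pullbackForm I J f η) x v w =
      extDerivOneForm J η (f x) (mfderiv I J f x v) (mfderiv I J f x w) :=
  extDerivInChart_pullbackForm hf hη (mem_extChartAt_source x) (mem_extChartAt_source (f x)) v w

end Forms

/-! ### One-forms on `ℝ × N` -/

section TimeProduct

open Filter Topology

section Flat

variable {V : Type*} [NormedAddCommGroup V] [NormedSpace ℝ V]

set_option synthInstance.maxHeartbeats 200000 in
/-- If the contraction of `dθ` with `e` agrees with `dh` on `b₁` and `b₂`, then the derivative of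
`dθ b₁ b₂` in the direction `e` vanishes; this is `L_e dθ = d (ι_e dθ) = ddh = 0`. -/
lemma fderiv_curl_eq_zero {θ : V → V →L[ℝ] ℝ} {h : V → ℝ} {z e b₁ b₂ : V}
    (hθ : ContDiffAt ℝ 2 θ z) (hh : ContDiffAt ℝ 2 h z)
    (h₁ : ∀ᶠ y in 𝓝 z, fderiv ℝ θ y e b₁ - fderiv ℝ θ y b₁ e = fderiv ℝ h y b₁)
    (h₂ : ∀ᶠ y in 𝓝 z, fderiv ℝ θ y e b₂ - fderiv ℝ θ y b₂ e = fderiv ℝ h y b₂) :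
    HasFDerivAt (fun y => fderiv ℝ θ y b₁ b₂ - fderiv ℝ θ y b₂ b₁)
      (fderiv ℝ (fun y => fderiv ℝ θ y b₁ b₂ - fderiv ℝ θ y b₂ b₁) z) z ∧
    fderiv ℝ (fun y => fderiv ℝ θ y b₁ b₂ - fderiv ℝ θ y b₂ b₁) z e = 0 := by
  set A := fderiv ℝ (fderiv ℝ θ) z with hA
  set B := fderiv ℝ (fderiv ℝ h) z with hB
  have hA' : HasFDerivAt (fderiv ℝ θ) A z :=
    ((hθ.fderiv_right (m := 1) (by norm_num)).differentiableAt (by simp)).hasFDerivAt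
  have hB' : HasFDerivAt (fderiv ℝ h) B z :=
    ((hh.fderiv_right (m := 1) (by norm_num)).differentiableAt (by simp)).hasFDerivAt
  have hAs : ∀ a b, A a b = A b a := fun a b => (hθ.isSymmSndFDerivAt (by simp)) a b
  have hBs : ∀ a b, B a b = B b a := fun a b => (hh.isSymmSndFDerivAt (by simp)) a b
  have hev : ∀ a b : V, ∃ L : V →L[ℝ] ℝ, HasFDerivAt (fun y => fderiv ℝ θ y a b) L z ∧
      ∀ c, L c = A c a b := fun a b =>
    ⟨_, (hA'.clm_apply (hasFDerivAt_const a z)).clm_apply (hasFDerivAt_const b z),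
      fun c => by simp⟩
  have hevB : ∀ a : V, ∃ L : V →L[ℝ] ℝ, HasFDerivAt (fun y => fderiv ℝ h y a) L z ∧
      ∀ c, L c = B c a := fun a =>
    ⟨_, hB'.clm_apply (hasFDerivAt_const a z), fun c => by simp⟩
  have hkey : ∀ b c : V, (∀ᶠ y in 𝓝 z, fderiv ℝ θ y e b - fderiv ℝ θ y b e = fderiv ℝ h y b) →
      A c e b - A c b e = B c b := by
    intro b c hb
    obtain ⟨L₁, h1, h1'⟩ := hev e b
    obtain ⟨L₂, h2, h2'⟩ := hev b e
    obtain ⟨L₃, h3, h3'⟩ := hevB b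
    rw [← h1', ← h2', ← h3', ← ((h1.sub h2).congr_of_eventuallyEq (EventuallyEq.symm hb)).unique h3]
    rfl
  obtain ⟨L₁, h1, h1'⟩ := hev b₁ b₂
  obtain ⟨L₂, h2, h2'⟩ := hev b₂ b₁
  have hd := h1.sub h2
  have hd' : fderiv ℝ (fun y => fderiv ℝ θ y b₁ b₂ - fderiv ℝ θ y b₂ b₁) z = L₁ - L₂ := hd.fderiv
  rw [hd']
  refine ⟨hd, ?_⟩
  have e₁ := hkey b₁ b₂ h₁
  have e₂ := hkey b₂ b₁ h₂
  have aux : ∀ a₁ a₂ a₃ a₄ a₅ a₆ c₁ c₂ : ℝ, a₁ = a₂ → a₃ = a₄ → a₅ = a₆ → c₁ = c₂ →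
      a₄ - a₅ = c₁ → a₂ - a₆ = c₂ → a₁ - a₃ = 0 := by
    clear * -
    intros
    linarith
  change L₁ e - L₂ e = 0
  rw [h1', h2']
  exact aux _ _ _ _ _ _ _ _ (DFunLike.congr_fun (hAs e b₁) b₂) (DFunLike.congr_fun (hAs e b₂) b₁)
    (DFunLike.congr_fun (hAs b₂ b₁) e) (hBs b₂ b₁) e₁ e₂

end Flat

variable {E H : Type*} [NormedAddCommGroup E] [NormedSpace ℝ E] [TopologicalSpace H]
  {I : ModelWithCorners ℝ E H} {N : Type*} [TopologicalSpace N] [ChartedSpace H N]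
  [I.Boundaryless] [IsManifold I ∞ N]
  {E' H' : Type*} [NormedAddCommGroup E'] [NormedSpace ℝ E'] [TopologicalSpace H']
  {J : ModelWithCorners ℝ E' H'} {N' : Type*} [TopologicalSpace N'] [ChartedSpace H' N']
  [J.Boundaryless] [IsManifold J ∞ N']

variable (I) in
/-- The tangent vector of `ℝ × N` with components `a` and `w`. The tangent space is a product only
by definitional unfolding; this constructor keeps the types of its elements apart from those of the
model space `ℝ × E`. -/
def tpair (q : ℝ × N) (a : ℝ) (w : TangentSpace I q.2) : TangentSpace (𝓘(ℝ, ℝ).prod I) q :=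
  ((a, w) : ℝ × E)

lemma exists_eq_tpair {q : ℝ × N} (u : TangentSpace (𝓘(ℝ, ℝ).prod I) q) :
    ∃ a w, u = tpair I q a w := ⟨(u : ℝ × E).1, (u : ℝ × E).2, rfl⟩

lemma tpair_add (q : ℝ × N) (a b : ℝ) (v w : TangentSpace I q.2) :
    tpair I q a v + tpair I q b w = tpair I q (a + b) (v + w) := rfl

lemma mfderiv_prodMk_eq_tpair {f : N' → ℝ} {g : N' → N} {x : N'}
    (hf : MDifferentiableAt J 𝓘(ℝ, ℝ) f x) (hg : MDifferentiableAt J I g x) (u : TangentSpace J x) :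
    mfderiv J (𝓘(ℝ, ℝ).prod I) (fun y => (f y, g y)) x u =
      tpair I (f x, g x) (mfderiv J 𝓘(ℝ, ℝ) f x u) (mfderiv J I g x u) := by
  rw [hf.mfderiv_prod hg]
  rfl

lemma mfderiv_fst_tpair (q : ℝ × N) (a : ℝ) (w : TangentSpace I q.2) :
    mfderiv (𝓘(ℝ, ℝ).prod I) 𝓘(ℝ, ℝ) (Prod.fst : ℝ × N → ℝ) q (tpair I q a w) = a := by
  rw [mfderiv_fst]
  rfl

lemma mfderiv_snd_tpair (q : ℝ × N) (a : ℝ) (w : TangentSpace I q.2) :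
    mfderiv (𝓘(ℝ, ℝ).prod I) I (Prod.snd : ℝ × N → N) q (tpair I q a w) = w := by
  rw [mfderiv_snd]
  rfl

/-- The derivative of a restriction to a slice `{s} × N`. -/
lemma mfderiv_slice_right {F : ℝ × N → N'} {q : ℝ × N}
    (hF : MDifferentiableAt (𝓘(ℝ, ℝ).prod I) J F q) (w : TangentSpace I q.2) :
    mfderiv I J (fun y => F (q.1, y)) q.2 w =
      mfderiv (𝓘(ℝ, ℝ).prod I) J F q (tpair I q 0 w) := by
  have h1 : HasMFDerivAt I (𝓘(ℝ, ℝ).prod I) (fun y : N => (q.1, y)) q.2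
      (ContinuousLinearMap.inr ℝ (TangentSpace 𝓘(ℝ, ℝ) q.1) (TangentSpace I q.2)) := by
    have := (mdifferentiableAt_const.prodMk mdifferentiableAt_id :
      MDifferentiableAt I (𝓘(ℝ, ℝ).prod I) (fun y : N => (q.1, y)) q.2).hasMFDerivAt
    rwa [mfderiv_prod_right] at this
  have h2 := (HasMFDerivAt.comp q.2 hF.hasMFDerivAt h1).mfderiv
  exact DFunLike.congr_fun h2 w

/-- The derivative of a restriction to a slice `ℝ × {x}`. -/
lemma hasMFDerivAt_slice_left {F : ℝ × N → N'} {q : ℝ × N}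
    (hF : MDifferentiableAt (𝓘(ℝ, ℝ).prod I) J F q) :
    HasMFDerivAt 𝓘(ℝ, ℝ) J (fun s => F (s, q.2)) q.1
      ((1 : ℝ →L[ℝ] ℝ).smulRight (mfderiv (𝓘(ℝ, ℝ).prod I) J F q (tpair I q 1 0))) := by
  have h1 : HasMFDerivAt 𝓘(ℝ, ℝ) (𝓘(ℝ, ℝ).prod I) (fun s : ℝ => (s, q.2)) q.1
      (ContinuousLinearMap.inl ℝ (TangentSpace 𝓘(ℝ, ℝ) q.1) (TangentSpace I q.2)) := by
    have h0 : MDifferentiableAt 𝓘(ℝ, ℝ) (𝓘(ℝ, ℝ).prod I) (fun s : ℝ => (s, q.2)) q.1 :=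
      mdifferentiableAt_id.prodMk mdifferentiableAt_const
    have := h0.hasMFDerivAt
    rwa [mfderiv_prod_left] at this
  refine (HasMFDerivAt.comp q.1 hF.hasMFDerivAt h1).congr_mfderiv ?_
  ext
  change mfderiv (𝓘(ℝ, ℝ).prod I) J F q (tpair I q 1 0) =
    (1 : ℝ) • mfderiv (𝓘(ℝ, ℝ).prod I) J F q (tpair I q 1 0)
  rw [one_smul]

lemma extChartAt_time_prod (q : ℝ × N) : extChartAt (𝓘(ℝ, ℝ).prod I) q =
    (PartialEquiv.refl ℝ).prod (extChartAt I q.2) := by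
  rw [extChartAt_prod, extChartAt_model_space_eq_id]

lemma extChartAt_time_prod_apply (q q' : ℝ × N) : extChartAt (𝓘(ℝ, ℝ).prod I) q q' =
    (q'.1, extChartAt I q.2 q'.2) := by
  rw [extChartAt_time_prod]; rfl

lemma extChartAt_time_prod_symm_apply (q : ℝ × N) (z : ℝ × E) :
    (extChartAt (𝓘(ℝ, ℝ).prod I) q).symm z = (z.1, (extChartAt I q.2).symm z.2) := by
  rw [extChartAt_time_prod]; rfl

lemma mem_extChartAt_time_prod_target {q : ℝ × N} {z : ℝ × E} :
    z ∈ (extChartAt (𝓘(ℝ, ℝ).prod I) q).target ↔ z.2 ∈ (extChartAt I q.2).target := by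
  rw [extChartAt_time_prod]; simp [PartialEquiv.prod_target]

lemma mem_extChartAt_time_prod_source {q q' : ℝ × N} :
    q' ∈ (extChartAt (𝓘(ℝ, ℝ).prod I) q).source ↔ q'.2 ∈ (extChartAt I q.2).source := by
  rw [extChartAt_time_prod]; simp [PartialEquiv.prod_source]

lemma tangentCoord_tpair {q q' : ℝ × N} (hq' : q'.2 ∈ (extChartAt I q.2).source)
    (a : ℝ) (w : TangentSpace I q'.2) :
    tangentCoord (𝓘(ℝ, ℝ).prod I) q q' (tpair I q' a w) = (a, tangentCoord I q.2 q'.2 w) := by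
  have h1 : (extChartAt (𝓘(ℝ, ℝ).prod I) q : ℝ × N → ℝ × E) =
      fun y => (y.1, extChartAt I q.2 y.2) := funext fun y => extChartAt_time_prod_apply q y
  have h2 : HasMFDerivAt (𝓘(ℝ, ℝ).prod I) 𝓘(ℝ, E) (fun y : ℝ × N => extChartAt I q.2 y.2) q'
      ((tangentCoord I q.2 q'.2).comp
        (ContinuousLinearMap.snd ℝ (TangentSpace 𝓘(ℝ, ℝ) q'.1) (TangentSpace I q'.2))) :=
    HasMFDerivAt.comp q' ((contMDiffAt_extChartAt_of_mem hq').mdifferentiableAt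
      (by simp)).hasMFDerivAt (hasMFDerivAt_snd _)
  have h3' : HasMFDerivAt (𝓘(ℝ, ℝ).prod I) 𝓘(ℝ, ℝ) (Prod.fst : ℝ × N → ℝ) q'
      (ContinuousLinearMap.fst ℝ (TangentSpace 𝓘(ℝ, ℝ) q'.1) (TangentSpace I q'.2)) :=
    hasMFDerivAt_fst q'
  have h3 : HasMFDerivAt (𝓘(ℝ, ℝ).prod I) 𝓘(ℝ, ℝ × E)
      (fun y : ℝ × N => (y.1, extChartAt I q.2 y.2)) q'
      ((ContinuousLinearMap.fst ℝ (TangentSpace 𝓘(ℝ, ℝ) q'.1) (TangentSpace I q'.2)).prod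
        ((tangentCoord I q.2 q'.2).comp
        (ContinuousLinearMap.snd ℝ (TangentSpace 𝓘(ℝ, ℝ) q'.1) (TangentSpace I q'.2)))) :=
    ⟨h3'.1.prodMk h2.1, h3'.2.prodMk h2.2⟩
  have h4 : tangentCoord (𝓘(ℝ, ℝ).prod I) q q' =
      mfderiv (𝓘(ℝ, ℝ).prod I) 𝓘(ℝ, ℝ × E) (fun y : ℝ × N => (y.1, extChartAt I q.2 y.2)) q' := by
    unfold tangentCoord
    rw [h1]
  rw [h4, h3.mfderiv]
  rfl

variable (I) in
/-- The differential of a function, as a one-form. -/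
noncomputable def differential (h : N → ℝ) (p : N) : TangentSpace I p →L[ℝ] ℝ :=
  mfderiv I 𝓘(ℝ, ℝ) h p

lemma fderiv_comp_extChartAt_symm {h : N → ℝ} {x p : N} (hp : p ∈ (extChartAt I x).source)
    (hh : MDifferentiableAt I 𝓘(ℝ, ℝ) h p) (u : TangentSpace I p) :
    fderiv ℝ (fun y => h ((extChartAt I x).symm y)) (extChartAt I x p) (tangentCoord I x p u) =
      differential I h p u := by
  obtain ⟨z, hz, rfl⟩ : ∃ y ∈ (extChartAt I x).target, (extChartAt I x).symm y = p :=
    ⟨_, (extChartAt I x).map_source hp, (extChartAt I x).left_inv hp⟩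
  have h1 := (mdifferentiableAt_extChartAt_symm_of_mem hz).hasMFDerivAt
  have h4 := (HasMFDerivAt.comp z hh.hasMFDerivAt h1).mfderiv
  rw [(extChartAt I x).right_inv hz, ← mfderiv_eq_fderiv]
  have h5 := DFunLike.congr_fun h4 (tangentCoord I x ((extChartAt I x).symm z) u)
  refine h5.trans ?_
  exact congrArg (mfderiv I 𝓘(ℝ, ℝ) h ((extChartAt I x).symm z))
    (tangentCoordSymm_tangentCoord hz u)

lemma contDiffAt_comp_extChartAt_symm {h : N → ℝ} (hh : ContMDiff I 𝓘(ℝ, ℝ) ∞ h) {x : N} {z : E}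
    (hz : z ∈ (extChartAt I x).target) :
    ContDiffAt ℝ ∞ (fun y => h ((extChartAt I x).symm y)) z :=
  ((hh _).comp z (contMDiffAt_extChartAt_symm_of_mem hz)).contDiffAt

/-- The exterior derivative of a one-form on `ℝ × N` in coordinates at another time. -/
lemma extDerivOneForm_tpair {Θ : ∀ q : ℝ × N, TangentSpace (𝓘(ℝ, ℝ).prod I) q →L[ℝ] ℝ}
    (hΘ : IsSmoothForm (𝓘(ℝ, ℝ).prod I) Θ) {q₀ q : ℝ × N} (hq : q.2 ∈ (extChartAt I q₀.2).source)
    (a b : ℝ) (v w : TangentSpace I q.2) :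
    extDerivOneForm (𝓘(ℝ, ℝ).prod I) Θ q (tpair I q a v) (tpair I q b w) =
      fderiv ℝ (oneFormInChart (𝓘(ℝ, ℝ).prod I) Θ q₀) (q.1, extChartAt I q₀.2 q.2)
        (a, tangentCoord I q₀.2 q.2 v) (b, tangentCoord I q₀.2 q.2 w) -
      fderiv ℝ (oneFormInChart (𝓘(ℝ, ℝ).prod I) Θ q₀) (q.1, extChartAt I q₀.2 q.2)
        (b, tangentCoord I q₀.2 q.2 w) (a, tangentCoord I q₀.2 q.2 v) := by
  rw [← extDerivInChart_eq hΘ (mem_extChartAt_time_prod_source.2 hq)]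
  unfold extDerivInChart
  rw [tangentCoord_tpair hq, tangentCoord_tpair hq, extChartAt_time_prod_apply]

/-- If `dΘ (∂_s, ·)` is the differential of a function along the slices `{s} × N`, then the
restriction of `dΘ` to the slices does not depend on `s`. -/
lemma extDerivOneForm_slice_eq {Θ : ∀ q : ℝ × N, TangentSpace (𝓘(ℝ, ℝ).prod I) q →L[ℝ] ℝ}
    (hΘ : IsSmoothForm (𝓘(ℝ, ℝ).prod I) Θ) {h : ℝ × N → ℝ}
    (hh : ContMDiff (𝓘(ℝ, ℝ).prod I) 𝓘(ℝ, ℝ) ∞ h)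
    (H : ∀ (q : ℝ × N) (w : TangentSpace I q.2),
      extDerivOneForm (𝓘(ℝ, ℝ).prod I) Θ q (tpair I q 1 0) (tpair I q 0 w) =
        differential (𝓘(ℝ, ℝ).prod I) h q (tpair I q 0 w))
    (s t : ℝ) (p : N) (w₁ w₂ : TangentSpace I p) :
    extDerivOneForm (𝓘(ℝ, ℝ).prod I) Θ (s, p) (tpair I (s, p) 0 w₁) (tpair I (s, p) 0 w₂) =
      extDerivOneForm (𝓘(ℝ, ℝ).prod I) Θ (t, p) (tpair I (t, p) 0 w₁) (tpair I (t, p) 0 w₂) := by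
  set q₀ : ℝ × N := (0, p) with hq₀
  set θ := oneFormInChart (𝓘(ℝ, ℝ).prod I) Θ q₀ with hθdef
  set g : ℝ × E → ℝ := fun z => h ((extChartAt (𝓘(ℝ, ℝ).prod I) q₀).symm z) with hg
  have hp := mem_extChartAt_source (I := I) p
  -- the hypothesis, read in the chart
  have key : ∀ (z : ℝ × E), z.2 ∈ (extChartAt I p).target → ∀ w : E,
      fderiv ℝ θ z (1, 0) (0, w) - fderiv ℝ θ z (0, w) (1, 0) = fderiv ℝ g z (0, w) := by
    rintro ⟨r, y⟩ hy w
    obtain ⟨x, hx, rfl⟩ : ∃ x ∈ (extChartAt I p).source, extChartAt I p x = y :=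
      ⟨_, (extChartAt I p).map_target hy, (extChartAt I p).right_inv hy⟩
    obtain ⟨u, rfl⟩ : ∃ u : TangentSpace I x, tangentCoord I p x u = w := by
      have := tangentCoord_tangentCoordSymm hy w
      rw [(extChartAt I p).left_inv hx] at this
      exact ⟨_, this⟩
    have h1 := H (r, x) u
    rw [extDerivOneForm_tpair hΘ (q₀ := q₀) (q := (r, x)) hx] at h1
    have h2 := fderiv_comp_extChartAt_symm (I := 𝓘(ℝ, ℝ).prod I) (x := q₀) (p := (r, x))
      (mem_extChartAt_time_prod_source.2 hx) (hh.mdifferentiable (by simp) _)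
      (tpair I (r, x) 0 u)
    rw [tangentCoord_tpair (q := q₀) (q' := (r, x)) hx, extChartAt_time_prod_apply] at h2
    rw [← h2, map_zero] at h1
    exact h1
  have hopen : ∀ r : ℝ, ∀ᶠ z in 𝓝 ((r, extChartAt I p p) : ℝ × E),
      z.2 ∈ (extChartAt I p).target := fun r =>
    continuous_snd.continuousAt.preimage_mem_nhds (extChartAt_target_mem_nhds p)
  have hflat := fun r : ℝ => fderiv_curl_eq_zero (θ := θ) (h := g) (z := (r, extChartAt I p p))
    (e := (1, 0)) (b₁ := (0, tangentCoord I p p w₁)) (b₂ := (0, tangentCoord I p p w₂))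
    ((hΘ q₀ _ (mem_extChartAt_time_prod_target.2 (mem_extChartAt_target p))).of_le
      ENat.LEInfty.out)
    ((contDiffAt_comp_extChartAt_symm hh (x := q₀)
      (mem_extChartAt_time_prod_target.2 (mem_extChartAt_target p))).of_le ENat.LEInfty.out)
    ((hopen r).mono fun z hz => key z hz _) ((hopen r).mono fun z hz => key z hz _)
  set f : ℝ × E → ℝ := fun y =>
    fderiv ℝ θ y (0, tangentCoord I p p w₁) (0, tangentCoord I p p w₂) -
      fderiv ℝ θ y (0, tangentCoord I p p w₂) (0, tangentCoord I p p w₁) with hf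
  have hder : ∀ r : ℝ, HasDerivAt (fun r => f (r, extChartAt I p p)) 0 r := fun r => by
    have h1 : HasDerivAt (fun r : ℝ => (r, extChartAt I p p)) (1, (0 : E)) r :=
      (hasDerivAt_id r).prodMk (hasDerivAt_const r _)
    have h2 := (hflat r).1.comp_hasDerivAt r h1
    rw [(hflat r).2] at h2
    exact h2
  rw [extDerivOneForm_tpair hΘ (q₀ := q₀) (q := (s, p)) hp,
    extDerivOneForm_tpair hΘ (q₀ := q₀) (q := (t, p)) hp]
  exact is_const_of_deriv_eq_zero (fun r => (hder r).differentiableAt)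
    (fun r => (hder r).deriv) s t

/-- If the restriction of `Θ` to the slices `{s} × N` does not depend on `s`, then
`dΘ (∂_s, ·)` is minus the differential of the function `Θ ∂_s` on the slices. -/
lemma extDerivOneForm_time_eq {Θ : ∀ q : ℝ × N, TangentSpace (𝓘(ℝ, ℝ).prod I) q →L[ℝ] ℝ}
    (hΘ : IsSmoothForm (𝓘(ℝ, ℝ).prod I) Θ) {μ : ∀ x : N, TangentSpace I x →L[ℝ] ℝ}
    (H : ∀ (q : ℝ × N) (w : TangentSpace I q.2), Θ q (tpair I q 0 w) = μ q.2 w)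
    (q : ℝ × N) (w : TangentSpace I q.2)
    (hd : MDifferentiableAt (𝓘(ℝ, ℝ).prod I) 𝓘(ℝ, ℝ) (fun q => Θ q (tpair I q 1 0)) q) :
    extDerivOneForm (𝓘(ℝ, ℝ).prod I) Θ q (tpair I q 1 0) (tpair I q 0 w) =
      - differential (𝓘(ℝ, ℝ).prod I) (fun q => Θ q (tpair I q 1 0)) q (tpair I q 0 w) := by
  set θ := oneFormInChart (𝓘(ℝ, ℝ).prod I) Θ q with hθdef
  have hp := mem_extChartAt_source (I := I) q.2
  set w' := tangentCoord I q.2 q.2 w with hw'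
  have hθ : DifferentiableAt ℝ θ (q.1, extChartAt I q.2 q.2) :=
    (hΘ q _ (mem_extChartAt_time_prod_target.2 (mem_extChartAt_target q.2))).differentiableAt
      (by simp)
  have hev : ∀ b : ℝ × E, HasFDerivAt (fun z => θ z b)
      ((ContinuousLinearMap.apply ℝ ℝ b).comp (fderiv ℝ θ (q.1, extChartAt I q.2 q.2)))
      (q.1, extChartAt I q.2 q.2) := fun b =>
    (ContinuousLinearMap.apply ℝ ℝ b).hasFDerivAt.comp _ hθ.hasFDerivAt
  -- `θ` in chart coordinates
  have hval : ∀ (r : ℝ) (x : N), x ∈ (extChartAt I q.2).source → ∀ (a : ℝ) (u : TangentSpace I x),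
      θ (r, extChartAt I q.2 x) (a, tangentCoord I q.2 x u) = Θ (r, x) (tpair I (r, x) a u) := by
    intro r x hx a u
    have := oneFormInChart_apply_tangentCoord Θ (x := q) (p := (r, x))
      (mem_extChartAt_time_prod_source.2 hx) (tpair I (r, x) a u)
    rw [tangentCoord_tpair (q := q) (q' := (r, x)) hx, extChartAt_time_prod_apply] at this
    exact this
  have h1 : fderiv ℝ θ (q.1, extChartAt I q.2 q.2) (1, 0) (0, w') = 0 := by
    have h2 : HasDerivAt (fun r : ℝ => (r, extChartAt I q.2 q.2)) (1, (0 : E)) q.1 :=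
      (hasDerivAt_id q.1).prodMk (hasDerivAt_const q.1 _)
    have h3 := (hev (0, w')).comp_hasDerivAt q.1 h2
    have h4 : (fun z : ℝ × E => θ z (0, w')) ∘ (fun r : ℝ => (r, extChartAt I q.2 q.2)) =
        fun _ => μ q.2 w := by
      ext r
      exact (hval r q.2 hp 0 w).trans (H (r, q.2) w)
    rw [h4] at h3
    exact h3.unique (hasDerivAt_const q.1 _)
  have h5 : fderiv ℝ θ (q.1, extChartAt I q.2 q.2) (0, w') (1, 0) =
      differential (𝓘(ℝ, ℝ).prod I) (fun q => Θ q (tpair I q 1 0)) q (tpair I q 0 w) := by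
    have h6 := fderiv_comp_extChartAt_symm (I := 𝓘(ℝ, ℝ).prod I) (x := q) (p := q)
      (mem_extChartAt_source q) hd (tpair I q 0 w)
    rw [tangentCoord_tpair (q := q) (q' := q) hp, extChartAt_time_prod_apply] at h6
    rw [← h6]
    have h7 : (fun z : ℝ × E => θ z (1, 0)) =ᶠ[𝓝 (q.1, extChartAt I q.2 q.2)]
        fun z => Θ ((extChartAt (𝓘(ℝ, ℝ).prod I) q).symm z)
          (tpair I ((extChartAt (𝓘(ℝ, ℝ).prod I) q).symm z) 1 0) := by
      filter_upwards [continuous_snd.continuousAt.preimage_mem_nhds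
        (extChartAt_target_mem_nhds (I := I) q.2)] with z hz
      have h8 := hval z.1 ((extChartAt I q.2).symm z.2) ((extChartAt I q.2).map_target hz) 1 0
      rw [(extChartAt I q.2).right_inv hz, map_zero] at h8
      rw [extChartAt_time_prod_symm_apply]
      exact h8
    rw [← h7.fderiv_eq, (hev (1, 0)).fderiv]
    rfl
  rw [extDerivOneForm_tpair hΘ (q₀ := q) (q := q) hp, map_zero, ← hθdef, ← hw', h1, h5, zero_sub]

end TimeProduct

/-! ### Hamiltonian vector fields and their flows -/

section Hamiltonian

open Filter Topology

variable {E H : Type*} [NormedAddCommGroup E] [NormedSpace ℝ E] [TopologicalSpace H]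
  {I : ModelWithCorners ℝ E H} {N : Type*} [TopologicalSpace N] [ChartedSpace H N]
  [I.Boundaryless] [IsManifold I ∞ N]
  {E' H' : Type*} [NormedAddCommGroup E'] [NormedSpace ℝ E'] [TopologicalSpace H']
  {J : ModelWithCorners ℝ E' H'} {N' : Type*} [TopologicalSpace N'] [ChartedSpace H' N']
  [J.Boundaryless] [IsManifold J ∞ N']

lemma IsSmoothForm.contMDiff_apply {Θ : ∀ p : N, TangentSpace I p →L[ℝ] ℝ}
    (hΘ : IsSmoothForm I Θ) {v : ∀ p : N, TangentSpace I p} (hv : IsSmoothVectorField I v) :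
    ContMDiff I 𝓘(ℝ, ℝ) ∞ (fun p => Θ p (v p)) := by
  intro x
  have h1 : ContDiffAt ℝ ∞ (fun y => oneFormInChart I Θ x y (vectorFieldInChart I v x y))
      (extChartAt I x x) :=
    (hΘ x _ (mem_extChartAt_target x)).clm_apply (hv x _ (mem_extChartAt_target x))
  refine (h1.contMDiffAt.comp x
    (contMDiffAt_extChartAt_of_mem (mem_extChartAt_source x))).congr_of_eventuallyEq ?_
  filter_upwards [extChartAt_source_mem_nhds (I := I) x] with z hz
  have h2 : vectorFieldInChart I v x (extChartAt I x z) = tangentCoord I x z (v z) := by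
    change tangentCoord I x ((extChartAt I x).symm (extChartAt I x z)) (v _) = _
    rw [(extChartAt I x).left_inv hz]
  change _ = oneFormInChart I Θ x (extChartAt I x z) (vectorFieldInChart I v x (extChartAt I x z))
  rw [h2, oneFormInChart_apply_tangentCoord Θ hz]

lemma isSmoothForm_differential {f : N → ℝ} (hf : ContMDiff I 𝓘(ℝ, ℝ) ∞ f) :
    IsSmoothForm I (differential I f) := by
  intro x y hy
  refine ((contDiffAt_comp_extChartAt_symm hf hy).fderiv_right (m := ∞)
    (by simp)).congr_of_eventuallyEq ?_
  filter_upwards [(isOpen_extChartAt_target x).mem_nhds hy] with z hz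
  ext w
  have h := fderiv_comp_extChartAt_symm ((extChartAt I x).map_target hz)
    (hf.mdifferentiable (by simp) _) (tangentCoordSymm I x z w)
  rw [(extChartAt I x).right_inv hz, tangentCoord_tangentCoordSymm hz] at h
  exact h.symm

lemma isSmoothVectorField_time :
    IsSmoothVectorField (𝓘(ℝ, ℝ).prod I) (fun q : ℝ × N => tpair I q 1 0) := by
  intro q z hz
  refine (contDiffAt_const (c := ((1, 0) : ℝ × E))).congr_of_eventuallyEq ?_
  filter_upwards [(isOpen_extChartAt_target q).mem_nhds hz] with z hz
  have hz' := mem_extChartAt_time_prod_source.1 ((extChartAt (𝓘(ℝ, ℝ).prod I) q).map_target hz)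
  have := tangentCoord_tpair hz' 1 0
  rw [map_zero] at this
  exact this

/-- The derivative of a map along an integral curve. -/
lemma IsMIntegralCurveOn.hasMFDerivAt_comp {v : ∀ p : N, TangentSpace I p} {γ : ℝ → N} {S : Set ℝ}
    (hγ : IsMIntegralCurveOn γ v S) {t : ℝ} (hS : S ∈ 𝓝 t) {f : N → N'}
    (hf : MDifferentiableAt I J f (γ t)) :
    HasMFDerivAt 𝓘(ℝ, ℝ) J (fun t => f (γ t)) t
      ((1 : ℝ →L[ℝ] ℝ).smulRight (mfderiv I J f (γ t) (v (γ t)))) := by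
  refine (HasMFDerivAt.comp t hf.hasMFDerivAt
    ((hγ t (mem_of_mem_nhds hS)).hasMFDerivAt hS)).congr_mfderiv ?_
  ext
  change mfderiv I J f (γ t) ((1 : ℝ) • v (γ t)) = (1 : ℝ) • mfderiv I J f (γ t) (v (γ t))
  rw [one_smul, one_smul]

lemma IsMIntegralCurveOn.hasDerivAt_comp {v : ∀ p : N, TangentSpace I p} {γ : ℝ → N} {S : Set ℝ}
    (hγ : IsMIntegralCurveOn γ v S) {t : ℝ} (hS : S ∈ 𝓝 t) {f : N → ℝ}
    (hf : MDifferentiableAt I 𝓘(ℝ, ℝ) f (γ t)) :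
    HasDerivAt (fun t => f (γ t)) (differential I f (γ t) (v (γ t))) t := by
  have h : HasFDerivAt (fun t => f (γ t))
      ((1 : ℝ →L[ℝ] ℝ).smulRight (differential I f (γ t) (v (γ t)))) t :=
    (hγ.hasMFDerivAt_comp hS hf).hasFDerivAt
  simpa using h.hasDerivAt

lemma extDerivOneForm_add_left (η : ∀ x : N, TangentSpace I x →L[ℝ] ℝ) (x : N)
    (u v w : TangentSpace I x) :
    extDerivOneForm I η x (u + v) w = extDerivOneForm I η x u w + extDerivOneForm I η x v w := by
  change extDerivInChart I η x x (u + v) w =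
    extDerivInChart I η x x u w + extDerivInChart I η x x v w
  unfold extDerivInChart
  rw [map_add, map_add, map_add, add_apply]
  ring

lemma extDerivOneForm_smul_left (η : ∀ x : N, TangentSpace I x →L[ℝ] ℝ) (x : N) (c : ℝ)
    (v w : TangentSpace I x) :
    extDerivOneForm I η x (c • v) w = c * extDerivOneForm I η x v w := by
  change extDerivInChart I η x x (c • v) w = c * extDerivInChart I η x x v w
  unfold extDerivInChart
  rw [map_smul, map_smul, map_smul, smul_apply, smul_eq_mul, smul_eq_mul]
  ring

lemma extDerivOneForm_zero_left (η : ∀ x : N, TangentSpace I x →L[ℝ] ℝ) (x : N)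
    (w : TangentSpace I x) : extDerivOneForm I η x 0 w = 0 := by
  have h := extDerivOneForm_smul_left η x 0 0 w
  rwa [smul_zero, zero_mul] at h

lemma extDerivOneForm_swap (η : ∀ x : N, TangentSpace I x →L[ℝ] ℝ) (x : N)
    (v w : TangentSpace I x) :
    extDerivOneForm I η x v w = - extDerivOneForm I η x w v := by
  unfold extDerivOneForm
  simp

variable (I) in
/-- A one-form whose exterior derivative is nondegenerate. -/
def IsNondegenerateForm (η : ∀ x : N, TangentSpace I x →L[ℝ] ℝ) : Prop :=
  ∀ (x : N) (u : TangentSpace I x), (∀ w, extDerivOneForm I η x u w = 0) → u = 0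

lemma IsNondegenerateForm.eq_of_forall {η : ∀ x : N, TangentSpace I x →L[ℝ] ℝ}
    (hη : IsNondegenerateForm I η) {x : N} {u v : TangentSpace I x}
    (h : ∀ w, extDerivOneForm I η x u w = extDerivOneForm I η x v w) : u = v := by
  have h1 : u + (-1 : ℝ) • v = 0 := hη x _ fun w => by
    rw [extDerivOneForm_add_left, extDerivOneForm_smul_left, h w]
    ring
  rwa [neg_one_smul, ← sub_eq_add_neg, sub_eq_zero] at h1

/-- A nondegenerate bilinear form on a finite-dimensional space is an isomorphism to the dual. -/
lemma isInvertible_of_injective_dual [FiniteDimensional ℝ E] {C : E →L[ℝ] E →L[ℝ] ℝ}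
    (h : ∀ u, (∀ w, C u w = 0) → u = 0) : C.IsInvertible := by
  have hinj : Function.Injective (C : E →ₗ[ℝ] E →L[ℝ] ℝ) := by
    rw [← LinearMap.ker_eq_bot, LinearMap.ker_eq_bot']
    intro u hu
    exact h u fun w => DFunLike.congr_fun hu w
  have hfin : Module.finrank ℝ E = Module.finrank ℝ (E →L[ℝ] ℝ) := by
    rw [← LinearEquiv.finrank_eq (LinearMap.toContinuousLinearMap (𝕜 := ℝ) (E := E) (F' := ℝ))]
    exact (Subspace.dual_finrank_eq (K := ℝ) (V := E)).symm
  refine ⟨(LinearEquiv.toContinuousLinearEquiv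
    (LinearMap.linearEquivOfInjective (C : E →ₗ[ℝ] E →L[ℝ] ℝ) hinj hfin)), ?_⟩
  ext u w
  rfl

set_option synthInstance.maxHeartbeats 400000 in
lemma contDiffAt_sub_flip {D : E → E →L[ℝ] E →L[ℝ] ℝ} {y : E} (hD : ContDiffAt ℝ ∞ D y) :
    ContDiffAt ℝ ∞ (fun y => D y - (D y).flip) y := by
  have h := ContDiffAt.continuousLinearMap_comp (F := E →L[ℝ] E →L[ℝ] ℝ)
    (G := E →L[ℝ] E →L[ℝ] ℝ)
    (ContinuousLinearMap.flipₗᵢ ℝ E E ℝ).toContinuousLinearEquiv.toContinuousLinearMap hD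
  exact hD.sub h

set_option synthInstance.maxHeartbeats 400000 in
set_option maxHeartbeats 1000000 in
/-- The time-dependent Hamiltonian vector field `Y` of `L`, characterized by
`dη (Y, ·) = - dL_s`. It is smooth since in charts it is obtained from `dL_s` by the inverse of the
matrix of `dη`. -/
lemma exists_hamiltonianField [FiniteDimensional ℝ E] {η : ∀ x : N, TangentSpace I x →L[ℝ] ℝ}
    (hη : IsSmoothForm I η) (hnd : IsNondegenerateForm I η) {L : ℝ × N → ℝ}
    (hL : ContMDiff (𝓘(ℝ, ℝ).prod I) 𝓘(ℝ, ℝ) ∞ L) :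
    ∃ Y : ∀ q : ℝ × N, TangentSpace I q.2,
      (∀ (q : ℝ × N) (w : TangentSpace I q.2), extDerivOneForm I η q.2 (Y q) w =
        - differential (𝓘(ℝ, ℝ).prod I) L q (tpair I q 0 w)) ∧
      IsSmoothVectorField (𝓘(ℝ, ℝ).prod I) (fun q => tpair I q 1 (Y q)) := by
  have : CompleteSpace E := FiniteDimensional.complete ℝ E
  -- the matrix of `dη` in the chart at `x`
  let C : N → E → E →L[ℝ] E →L[ℝ] ℝ := fun x y =>
    fderiv ℝ (oneFormInChart I η x) y - (fderiv ℝ (oneFormInChart I η x) y).flip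
  have hC : ∀ x p : N, p ∈ (extChartAt I x).source → ∀ v w : TangentSpace I p,
      extDerivOneForm I η p v w =
        C x (extChartAt I x p) (tangentCoord I x p v) (tangentCoord I x p w) := by
    intro x p hp v w
    rw [← extDerivInChart_eq hη hp]
    rfl
  have hCinv : ∀ x, ∀ y ∈ (extChartAt I x).target, (C x y).IsInvertible := by
    intro x y hy
    refine isInvertible_of_injective_dual fun u hu => ?_
    have h1 := hC x _ ((extChartAt I x).map_target hy)
    have h2 : tangentCoordSymm I x y u = 0 := hnd _ _ fun w => by
      rw [h1, (extChartAt I x).right_inv hy, tangentCoord_tangentCoordSymm hy]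
      exact hu _
    rw [← tangentCoord_tangentCoordSymm hy u, h2, map_zero]
  have hCsmooth : ∀ x, ∀ y ∈ (extChartAt I x).target, ContDiffAt ℝ ∞ (C x) y := by
    intro x y hy
    have h1 := (hη x y hy).fderiv_right (m := ∞) (by simp)
    exact contDiffAt_sub_flip h1
  have hex : ∀ q : ℝ × N, ∃ Y : TangentSpace I q.2, ∀ w, extDerivOneForm I η q.2 Y w =
      - differential (𝓘(ℝ, ℝ).prod I) L q (tpair I q 0 w) := by
    intro q
    obtain ⟨e, he⟩ := hCinv q.2 _ (mem_extChartAt_target q.2)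
    let D : ℝ × E →L[ℝ] ℝ := differential (𝓘(ℝ, ℝ).prod I) L q
    obtain ⟨u, hu⟩ : ∃ u : TangentSpace I q.2, tangentCoord I q.2 q.2 u =
        e.symm (-D.comp (ContinuousLinearMap.inr ℝ ℝ E)) := ⟨_, tangentCoord_self _ _⟩
    refine ⟨u, fun w => ?_⟩
    rw [hC q.2 q.2 (mem_extChartAt_source q.2), hu, tangentCoord_self, ← he]
    exact DFunLike.congr_fun (e.apply_symm_apply (-D.comp (ContinuousLinearMap.inr ℝ ℝ E))) w
  choose Y hY using hex
  refine ⟨Y, hY, fun q₀ z hz => ?_⟩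
  set g : ℝ × E → ℝ := fun z => L ((extChartAt (𝓘(ℝ, ℝ).prod I) q₀).symm z) with hg
  have hz2 := mem_extChartAt_time_prod_target.1 hz
  have hgz : ContDiffAt ℝ ∞ (fderiv ℝ g) z :=
    (contDiffAt_comp_extChartAt_symm hL hz).fderiv_right (m := ∞) (by simp)
  have hinv : ContDiffAt ℝ ∞ (fun z : ℝ × E => (C q₀.2 z.2).inverse) z :=
    ContDiffAt.comp (g := ContinuousLinearMap.inverse) z (hCinv q₀.2 _ hz2).contDiffAt_map_inverse
      ((hCsmooth q₀.2 _ hz2).comp z contDiffAt_snd)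
  have hY' : ContDiffAt ℝ ∞ (fun z : ℝ × E => ((1 : ℝ), (C q₀.2 z.2).inverse
      (-(fderiv ℝ g z).comp (ContinuousLinearMap.inr ℝ ℝ E)))) z :=
    contDiffAt_const.prodMk (hinv.clm_apply (hgz.clm_comp contDiffAt_const).neg)
  refine hY'.congr_of_eventuallyEq ?_
  filter_upwards [(isOpen_extChartAt_target q₀).mem_nhds hz] with z hz
  have hz2 := mem_extChartAt_time_prod_target.1 hz
  set q := (extChartAt (𝓘(ℝ, ℝ).prod I) q₀).symm z with hq
  have hqs := (extChartAt (𝓘(ℝ, ℝ).prod I) q₀).map_target hz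
  have hqs2 : q.2 ∈ (extChartAt I q₀.2).source := mem_extChartAt_time_prod_source.1 hqs
  have hzq : (q.1, extChartAt I q₀.2 q.2) = z := by
    rw [← extChartAt_time_prod_apply q₀ q]
    exact (extChartAt (𝓘(ℝ, ℝ).prod I) q₀).right_inv hz
  change tangentCoord (𝓘(ℝ, ℝ).prod I) q₀ q (tpair I q 1 (Y q)) = _
  rw [tangentCoord_tpair hqs2]
  congr 1
  obtain ⟨e, he⟩ := hCinv q₀.2 _ hz2
  rw [← he, ContinuousLinearMap.inverse_equiv]
  refine (e.symm_apply_eq.2 ?_).symm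
  ext w
  obtain ⟨u, rfl⟩ : ∃ u : TangentSpace I q.2, tangentCoord I q₀.2 q.2 u = w := by
    have h1 : (extChartAt I q₀.2).symm (extChartAt I q₀.2 q.2) = q.2 :=
      (extChartAt I q₀.2).left_inv hqs2
    have := tangentCoord_tangentCoordSymm ((extChartAt I q₀.2).map_source hqs2) w
    rw [h1] at this
    exact ⟨_, this⟩
  have h1 := hY q u
  have h2 := fderiv_comp_extChartAt_symm (I := 𝓘(ℝ, ℝ).prod I) (x := q₀) (p := q) hqs
    (hL.mdifferentiable (by simp) _) (tpair I q 0 u)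
  rw [extChartAt_time_prod_apply, tangentCoord_tpair hqs2, hzq] at h2
  have h3 : extChartAt I q₀.2 q.2 = z.2 := congrArg Prod.snd hzq
  rw [← h2, hC q₀.2 q.2 hqs2, h3, ← he] at h1
  exact h1.symm

lemma mfderiv_snd_tpair_comp {F : ℝ × N → N'} {q : ℝ × N}
    (hF : MDifferentiableAt (𝓘(ℝ, ℝ).prod I) J F q) (u : TangentSpace (𝓘(ℝ, ℝ).prod I) q) :
    mfderiv (𝓘(ℝ, ℝ).prod I) (𝓘(ℝ, ℝ).prod J) (fun q => (q.1, F q)) q u =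
      tpair J (q.1, F q) (differential (𝓘(ℝ, ℝ).prod I) Prod.fst q u)
        (mfderiv (𝓘(ℝ, ℝ).prod I) J F q u) :=
  mfderiv_prodMk_eq_tpair mdifferentiableAt_fst hF u

lemma differential_comp {f : N' → ℝ} {F : N → N'} {p : N}
    (hf : MDifferentiableAt J 𝓘(ℝ, ℝ) f (F p)) (hF : MDifferentiableAt I J F p)
    (u : TangentSpace I p) :
    differential I (fun p => f (F p)) p u = differential J f (F p) (mfderiv I J F p u) :=
  DFunLike.congr_fun (HasMFDerivAt.comp p hf.hasMFDerivAt hF.hasMFDerivAt).mfderiv u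

lemma differential_neg (f : N → ℝ) (p : N) (u : TangentSpace I p) :
    differential I (fun p => - f p) p u = - differential I f p u :=
  DFunLike.congr_fun (mfderiv_neg (f := f) (x := p)) u

/-- The velocity vector of a curve is unique. -/
lemma hasDerivAt_eq_of_hasMFDerivAt_smulRight {c : ℝ → N} {t : ℝ} {u v : TangentSpace I (c t)}
    (hu : HasMFDerivAt 𝓘(ℝ, ℝ) I c t ((1 : ℝ →L[ℝ] ℝ).smulRight u))
    (hv : HasMFDerivAt 𝓘(ℝ, ℝ) I c t ((1 : ℝ →L[ℝ] ℝ).smulRight v)) : u = v := by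
  have h := DFunLike.congr_fun (hasMFDerivAt_unique hu hv) (1 : ℝ)
  change (1 : ℝ) • u = (1 : ℝ) • v at h
  rwa [one_smul, one_smul] at h

/-- The time component of an integral curve of a field `∂_s + Y`. -/
lemma fst_eq_of_isMIntegralCurveOn {Y : ∀ q : ℝ × N, TangentSpace I q.2} {γ : ℝ → ℝ × N} {b : ℝ}
    (hγ : IsMIntegralCurveOn γ (fun q => tpair I q 1 (Y q)) (Ioo (-b) b)) {t : ℝ}
    (ht : t ∈ Ioo (-b) b) : (γ t).1 = (γ 0).1 + t := by
  have hd : ∀ r ∈ Ioo (-b) b, HasDerivAt (fun r => (γ r).1 - r) 0 r := fun r hr => by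
    have h := hγ.hasDerivAt_comp (Ioo_mem_nhds hr.1 hr.2) (f := Prod.fst)
      (mdifferentiableAt_fst)
    have h1 : differential (𝓘(ℝ, ℝ).prod I) (Prod.fst : ℝ × N → ℝ) (γ r)
        (tpair I (γ r) 1 (Y (γ r))) = 1 := mfderiv_fst_tpair _ _ _
    rw [h1] at h
    have h2 := h.sub (hasDerivAt_id' r)
    rw [sub_self] at h2
    exact h2
  have hb : (0 : ℝ) ∈ Ioo (-b) b := by
    have := ht.1.trans ht.2
    exact ⟨by linarith, by linarith⟩
  have h2 := isOpen_Ioo.is_const_of_deriv_eq_zero (isPreconnected_Ioo)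
    (fun r hr => (hd r hr).differentiableAt.differentiableWithinAt)
    (fun r hr => (hd r hr).deriv) ht hb
  change (γ t).1 - t = (γ 0).1 - 0 at h2
  linarith

/-- The time-one map of a complete Hamiltonian flow is a symplectic diffeomorphism.

Let `F (s, p)` be the position at time `s` of the point that starts at `p`, and let `Θ = F^* η`, a
one-form on `ℝ × N`. As the velocity of `F` is the Hamiltonian field, `dΘ (∂_s, ·)` is the
differential of a function along the slices `{s} × N`, so the restriction of `dΘ` to the slices does
not depend on `s` (`extDerivOneForm_slice_eq`). -/
lemma exists_symplectic_time_one [FiniteDimensional ℝ E] [T2Space N]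
    {η : ∀ x : N, TangentSpace I x →L[ℝ] ℝ}
    (hη : IsSmoothForm I η) {L : ℝ × N → ℝ} (hL : ContMDiff (𝓘(ℝ, ℝ).prod I) 𝓘(ℝ, ℝ) ∞ L)
    {Y : ∀ q : ℝ × N, TangentSpace I q.2}
    (hY : ∀ (q : ℝ × N) (w : TangentSpace I q.2), extDerivOneForm I η q.2 (Y q) w =
        - differential (𝓘(ℝ, ℝ).prod I) L q (tpair I q 0 w))
    (hYs : IsSmoothVectorField (𝓘(ℝ, ℝ).prod I) (fun q => tpair I q 1 (Y q)))
    (hc : ∀ q, ∃ γ : ℝ → ℝ × N, γ 0 = q ∧ IsMIntegralCurve γ (fun q => tpair I q 1 (Y q))) :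
    ∃ G : N ≃ₘ^∞⟮I, I⟯ N, (∀ (p : N) (v w : TangentSpace I p),
      extDerivOneForm I η (G p) (mfderiv I I G p v) (mfderiv I I G p w) =
        extDerivOneForm I η p v w) ∧
      ∀ p, ∃ γ : ℝ → ℝ × N, γ 0 = (0, p) ∧ (∀ s, (γ s).1 = s) ∧ (γ 1).2 = G p ∧
        IsMIntegralCurve γ (fun q => tpair I q 1 (Y q)) := by
  obtain ⟨Ψ, hΨ, hΨ0, hΨi, hΨadd⟩ := hYs.exists_flow hc
  -- `Ψ` is the flow of the autonomous field `∂_s + Y`, which moves time with unit speed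
  have hfst : ∀ s q, (Ψ (s, q)).1 = q.1 + s := fun s q => by
    have := fst_eq_of_isMIntegralCurveOn (b := |s| + 1) ((hΨi q).isMIntegralCurveOn _)
      (t := s) ⟨by linarith [neg_abs_le s], by linarith [le_abs_self s]⟩
    simpa [hΨ0] using this
  have hpair : ∀ s q, Ψ (s, q) = (q.1 + s, (Ψ (s, q)).2) := fun s q => by rw [← hfst]
  let F : ℝ × N → N := fun q => (Ψ (q.1, (0, q.2))).2
  have hF : ContMDiff (𝓘(ℝ, ℝ).prod I) I ∞ F :=
    contMDiff_snd.comp (hΨ.comp (contMDiff_fst.prodMk (contMDiff_const.prodMk contMDiff_snd)))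
  have hFd : MDifferentiable (𝓘(ℝ, ℝ).prod I) I F := hF.mdifferentiable (by simp)
  have hF0 : ∀ p, F (0, p) = p := fun p => by simp [F, hΨ0]
  -- the derivative of the flow in time
  have hFt : ∀ q, mfderiv (𝓘(ℝ, ℝ).prod I) I F q (tpair I q 1 0) = Y (q.1, F q) := by
    intro q
    have h1 := hasMFDerivAt_slice_left (hFd q)
    have h2 := ((hΨi (0, q.2)).isMIntegralCurveOn univ).hasMFDerivAt_comp (t := q.1) univ_mem
      (f := Prod.snd) mdifferentiableAt_snd
    have h3 := hasDerivAt_eq_of_hasMFDerivAt_smulRight h1 h2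
    have h4 : Ψ (q.1, (0, q.2)) = (q.1, F q) := by
      rw [hpair]
      simp [F]
    rw [h3, mfderiv_snd_tpair, h4]
  let Θ := pullbackForm (𝓘(ℝ, ℝ).prod I) I F η
  have hΘ : IsSmoothForm (𝓘(ℝ, ℝ).prod I) Θ := hη.pullbackForm hF
  let h : ℝ × N → ℝ := fun q => - L (q.1, F q)
  have hFp : ContMDiff (𝓘(ℝ, ℝ).prod I) (𝓘(ℝ, ℝ).prod I) ∞ (fun q => (q.1, F q)) :=
    contMDiff_fst.prodMk hF
  have hh : ContMDiff (𝓘(ℝ, ℝ).prod I) 𝓘(ℝ, ℝ) ∞ h :=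
    (hL.comp hFp).neg
  -- the defining equation of the Hamiltonian field, pulled back by `F`
  have key : ∀ (q : ℝ × N) (w : TangentSpace I q.2),
      extDerivOneForm (𝓘(ℝ, ℝ).prod I) Θ q (tpair I q 1 0) (tpair I q 0 w) =
        differential (𝓘(ℝ, ℝ).prod I) h q (tpair I q 0 w) := by
    intro q w
    have h1 : differential (𝓘(ℝ, ℝ).prod I) (Prod.fst : ℝ × N → ℝ) q (tpair I q 0 w) = 0 :=
      mfderiv_fst_tpair _ _ _
    have h2 : ∀ u, extDerivOneForm I η (F q) (Y (q.1, F q)) u =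
        - differential (𝓘(ℝ, ℝ).prod I) L (q.1, F q) (tpair I (q.1, F q) 0 u) :=
      hY (q.1, F q)
    rw [extDerivOneForm_pullbackForm hF hη, hFt, h2, differential_neg,
      differential_comp (F := fun q => (q.1, F q)) (hL.mdifferentiable (by simp) _)
        (hFp.mdifferentiable (by simp) _), mfderiv_snd_tpair_comp (hFd q), h1]
  -- the restriction of `dΘ` to a slice is the pull-back of `dη` by the flow at this time
  have hslice : ∀ (s : ℝ) (p : N) (v w : TangentSpace I p),
      extDerivOneForm (𝓘(ℝ, ℝ).prod I) Θ (s, p) (tpair I (s, p) 0 v) (tpair I (s, p) 0 w) =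
      extDerivOneForm I η (F (s, p)) (mfderiv I I (fun y => F (s, y)) p v)
        (mfderiv I I (fun y => F (s, y)) p w) := by
    intro s p v w
    rw [extDerivOneForm_pullbackForm hF hη, mfderiv_slice_right (q := (s, p)) (hFd (s, p)),
      mfderiv_slice_right (q := (s, p)) (hFd (s, p))]
  have hid : (fun y => F (0, y)) = id := funext hF0
  let G : N ≃ₘ^∞⟮I, I⟯ N :=
    { toFun := fun p => F (1, p)
      invFun := fun p => (Ψ (-1, (1, p))).2
      left_inv := fun p => by
        have h1 : ((1 : ℝ), F (1, p)) = Ψ (1, (0, p)) := by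
          rw [hpair 1 (0, p)]
          simp [F]
        simp only [h1, hΨadd]
        simp [hΨ0]
      right_inv := fun p => by
        have h1 : ((0 : ℝ), (Ψ (-1, (1, p))).2) = Ψ (-1, (1, p)) := by
          rw [hpair (-1) (1, p)]
          simp
        simp only [F, h1, hΨadd]
        simp [hΨ0]
      contMDiff_toFun := hF.comp (contMDiff_const.prodMk contMDiff_id)
      contMDiff_invFun := contMDiff_snd.comp
        (hΨ.comp (contMDiff_const.prodMk (contMDiff_const.prodMk contMDiff_id))) }
  refine ⟨G, fun p v w => ?_, fun p => ⟨fun s => Ψ (s, (0, p)), hΨ0 _, fun s => ?_, rfl,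
    hΨi (0, p)⟩⟩
  · have h1 := extDerivOneForm_slice_eq hΘ hh key 1 0 p v w
    rw [hslice, hslice] at h1
    have h2 : ∀ u : TangentSpace I p, mfderiv I I (fun y => F (0, y)) p u = (u : E) := fun u => by
      rw [hid, mfderiv_id]
      rfl
    have h3 : ∀ (p' : N) (v' w' : E), p' = p → extDerivOneForm I η p' v' w' =
        extDerivOneForm I η p v' w' := fun p' v' w' h => by rw [h]
    refine h1.trans ?_
    refine Eq.trans ?_ (h3 _ v w (hF0 p))
    exact congrArg₂ (fun a b : E => extDerivOneForm I η (F (0, p)) a b) (h2 v) (h2 w)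
  · simp [hfst]

end Hamiltonian

/-! ### The form `e^t α` on `ℝ × M` -/

section SmoothForms

open Filter Topology

variable {E H : Type*} [NormedAddCommGroup E] [NormedSpace ℝ E] [TopologicalSpace H]
  {I : ModelWithCorners ℝ E H} {N : Type*} [TopologicalSpace N] [ChartedSpace H N]
  [I.Boundaryless] [IsManifold I ∞ N]

lemma oneFormInChart_smul (f : N → ℝ) (η : ∀ x : N, TangentSpace I x →L[ℝ] ℝ) (x : N) :
    oneFormInChart I (fun p => f p • η p) x =
      fun z => f ((extChartAt I x).symm z) • oneFormInChart I η x z := rfl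

lemma IsSmoothForm.smul {f : N → ℝ} (hf : ContMDiff I 𝓘(ℝ, ℝ) ∞ f)
    {η : ∀ x : N, TangentSpace I x →L[ℝ] ℝ} (hη : IsSmoothForm I η) :
    IsSmoothForm I (fun p => f p • η p) := fun x y hy => by
  rw [oneFormInChart_smul]
  exact (contDiffAt_comp_extChartAt_symm hf hy).smul (hη x y hy)

/-- `d (f η) = df ∧ η + f dη`. -/
lemma extDerivOneForm_smul {f : N → ℝ} (hf : ContMDiff I 𝓘(ℝ, ℝ) ∞ f)
    {η : ∀ x : N, TangentSpace I x →L[ℝ] ℝ} (hη : IsSmoothForm I η) (p : N)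
    (u w : TangentSpace I p) :
    extDerivOneForm I (fun p => f p • η p) p u w =
      differential I f p u * η p w - differential I f p w * η p u +
        f p * extDerivOneForm I η p u w := by
  have hp := mem_extChartAt_source (I := I) p
  have h1 : HasFDerivAt (fun z => f ((extChartAt I p).symm z) • oneFormInChart I η p z) _
      (extChartAt I p p) :=
    ((contDiffAt_comp_extChartAt_symm hf (mem_extChartAt_target p)).differentiableAt
      (by simp)).hasFDerivAt.smul
      ((hη p _ (mem_extChartAt_target p)).differentiableAt (by simp)).hasFDerivAt
  change extDerivInChart I (fun p => f p • η p) p p u w = _ + f p * extDerivInChart I η p p u w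
  unfold extDerivInChart
  rw [oneFormInChart_smul, h1.fderiv]
  simp only [add_apply, smul_apply, ContinuousLinearMap.smulRight_apply,
    oneFormInChart_apply_tangentCoord η hp,
    fderiv_comp_extChartAt_symm hp (hf.mdifferentiable (by simp) p), smul_eq_mul]
  rw [(extChartAt I p).left_inv hp]
  ring

end SmoothForms

section Cylinder

open Filter Topology

variable {E : Type*} [NormedAddCommGroup E] [NormedSpace ℝ E]
  {M : Type*} [TopologicalSpace M] [ChartedSpace E M] [IsManifold 𝓘(ℝ, E) ∞ M]
  {α : ∀ x : M, TangentSpace 𝓘(ℝ, E) x →L[ℝ] ℝ}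

/-- A one-form that is smooth as a section of the cotangent bundle is smooth in charts, since the
trivialization of the bundle is given by the derivatives of the chart. -/
lemma ContactGeometry.IsSmoothOneForm.isSmoothForm (hα : IsSmoothOneForm α) :
    IsSmoothForm 𝓘(ℝ, E) α := by
  intro x y hy
  have hys := (extChartAt 𝓘(ℝ, E) x).map_target hy
  let e := trivializationAt (E →L[ℝ] ℝ) (fun x : M => TangentSpace 𝓘(ℝ, E) x →L[ℝ] ℝ) x
  have h1 : ContMDiffAt 𝓘(ℝ, E) 𝓘(ℝ, E →L[ℝ] ℝ) ∞ (fun p => (e ⟨p, α p⟩).2)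
      ((extChartAt 𝓘(ℝ, E) x).symm y) :=
    (e.contMDiffAt_section_iff (by simpa [e] using hys)).1 (hα _)
  have h2 := (h1.comp y (contMDiffAt_extChartAt_symm_of_mem hy)).contDiffAt
  refine h2.congr_of_eventuallyEq ?_
  filter_upwards [(isOpen_extChartAt_target x).mem_nhds hy] with z hz
  have hzs := (extChartAt 𝓘(ℝ, E) x).map_target hz
  have hzs' : (extChartAt 𝓘(ℝ, E) x).symm z ∈ (chartAt E x).source := by
    rwa [extChartAt_source] at hzs
  ext w
  have h3 := DFunLike.congr_fun (TangentBundle.symmL_trivializationAt (I := 𝓘(ℝ, E)) hzs') w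
  rw [(extChartAt 𝓘(ℝ, E) x).right_inv hz, ModelWithCorners.range_eq_univ,
    mfderivWithin_univ] at h3
  have h4 : (e ⟨(extChartAt 𝓘(ℝ, E) x).symm z, α ((extChartAt 𝓘(ℝ, E) x).symm z)⟩).2 w =
      α ((extChartAt 𝓘(ℝ, E) x).symm z)
        ((trivializationAt E (TangentSpace 𝓘(ℝ, E)) x).symmL ℝ
          ((extChartAt 𝓘(ℝ, E) x).symm z) w) := by
    exact DFunLike.congr_fun (Bundle.Trivial.continuousLinearMapAt_trivialization ℝ M ℝ
      ((extChartAt 𝓘(ℝ, E) x).symm z)) _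
  exact (h4.trans (congrArg _ h3)).symm

/-- The form `e^t α` on `ℝ × M`: the Liouville form of the symplectization, in the coordinates given
by the contact form `α`. -/
noncomputable def cylinderForm (α : ∀ x : M, TangentSpace 𝓘(ℝ, E) x →L[ℝ] ℝ) (q : ℝ × M) :
    TangentSpace (𝓘(ℝ, ℝ).prod 𝓘(ℝ, E)) q →L[ℝ] ℝ :=
  Real.exp q.1 • pullbackForm (𝓘(ℝ, ℝ).prod 𝓘(ℝ, E)) 𝓘(ℝ, E) Prod.snd α q

lemma cylinderForm_tpair (q : ℝ × M) (a : ℝ) (w : TangentSpace 𝓘(ℝ, E) q.2) :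
    cylinderForm α q (tpair 𝓘(ℝ, E) q a w) = Real.exp q.1 * α q.2 w := by
  change Real.exp q.1 * α q.2 (mfderiv _ _ _ _ (tpair 𝓘(ℝ, E) q a w)) = _
  rw [mfderiv_snd_tpair]

lemma contMDiff_exp_fst : ContMDiff (𝓘(ℝ, ℝ).prod 𝓘(ℝ, E)) 𝓘(ℝ, ℝ) ∞
    (fun q : ℝ × M => Real.exp q.1) :=
  (Real.contDiff_exp.contMDiff (n := ∞)).comp contMDiff_fst

lemma isSmoothForm_cylinderForm (hα : IsSmoothForm 𝓘(ℝ, E) α) :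
    IsSmoothForm (𝓘(ℝ, ℝ).prod 𝓘(ℝ, E)) (cylinderForm α) :=
  IsSmoothForm.smul contMDiff_exp_fst (hα.pullbackForm contMDiff_snd)

lemma differential_exp_fst (q : ℝ × M) (a : ℝ) (w : TangentSpace 𝓘(ℝ, E) q.2) :
    differential (𝓘(ℝ, ℝ).prod 𝓘(ℝ, E)) (fun q : ℝ × M => Real.exp q.1) q
      (tpair 𝓘(ℝ, E) q a w) = Real.exp q.1 * a := by
  have h1 : MDifferentiableAt 𝓘(ℝ, ℝ) 𝓘(ℝ, ℝ) Real.exp q.1 :=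
    Real.differentiableAt_exp.mdifferentiableAt
  rw [differential_comp (F := Prod.fst) h1 mdifferentiableAt_fst, mfderiv_fst_tpair]
  unfold differential
  rw [mfderiv_eq_fderiv, (Real.hasDerivAt_exp q.1).hasFDerivAt.fderiv]
  exact (smul_eq_mul a (Real.exp q.1)).trans (mul_comm _ _)

/-- `d (e^t α) = e^t (dt ∧ α + dα)`. -/
lemma extDerivOneForm_cylinderForm (hα : IsSmoothForm 𝓘(ℝ, E) α) (q : ℝ × M) (a b : ℝ)
    (v w : TangentSpace 𝓘(ℝ, E) q.2) :
    extDerivOneForm (𝓘(ℝ, ℝ).prod 𝓘(ℝ, E)) (cylinderForm α) q (tpair 𝓘(ℝ, E) q a v)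
      (tpair 𝓘(ℝ, E) q b w) =
    Real.exp q.1 * (a * α q.2 w - b * α q.2 v + extDerivOneForm 𝓘(ℝ, E) α q.2 v w) := by
  have h := extDerivOneForm_smul contMDiff_exp_fst
    (hα.pullbackForm (contMDiff_snd (I := 𝓘(ℝ, ℝ)) (M := ℝ))) q
    (tpair 𝓘(ℝ, E) q a v) (tpair 𝓘(ℝ, E) q b w)
  refine h.trans ?_
  rw [extDerivOneForm_pullbackForm contMDiff_snd hα, differential_exp_fst, differential_exp_fst,
    mfderiv_snd_tpair, mfderiv_snd_tpair]
  change Real.exp q.1 * a * α q.2 (mfderiv _ _ _ _ (tpair 𝓘(ℝ, E) q b w)) -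
    Real.exp q.1 * b * α q.2 (mfderiv _ _ _ _ (tpair 𝓘(ℝ, E) q a v)) + _ = _
  rw [mfderiv_snd_tpair, mfderiv_snd_tpair]
  ring

lemma tpair_zero (q : ℝ × M) : tpair 𝓘(ℝ, E) q 0 0 = 0 := rfl

/-- If `α` is a contact form, then `d (e^t α)` is a symplectic form. -/
lemma ContactGeometry.IsContactForm.isNondegenerateForm (hα : IsContactForm α) :
    IsNondegenerateForm (𝓘(ℝ, ℝ).prod 𝓘(ℝ, E)) (cylinderForm α) := by
  intro q u hu
  obtain ⟨a, v, rfl⟩ := exists_eq_tpair u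
  have h : ∀ (b : ℝ) (w : TangentSpace 𝓘(ℝ, E) q.2),
      a * α q.2 w - b * α q.2 v + extDerivOneForm 𝓘(ℝ, E) α q.2 v w = 0 := fun b w => by
    have := hu (tpair 𝓘(ℝ, E) q b w)
    rw [extDerivOneForm_cylinderForm hα.smooth.isSmoothForm] at this
    exact (mul_eq_zero.1 this).resolve_left (Real.exp_ne_zero _)
  have hv0 : α q.2 v = 0 := by
    have h1 := h 0 0
    have h2 := h 1 0
    linarith
  have hv : v = 0 := hα.nondegenerate q.2 v hv0 fun w hw => by
    have := h 0 w
    rw [hw] at this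
    simpa using this
  subst hv
  have ha : a = 0 := by
    by_contra ha
    refine hα.ne_zero q.2 ?_
    ext w
    have h1 := h 0 w
    rw [extDerivOneForm_zero_left] at h1
    have h3 : a * α q.2 w = 0 := by linarith
    exact (mul_eq_zero.1 h3).resolve_left ha
  rw [ha, tpair_zero]

end Cylinder

/-! ### Symplectic pseudo-isotopies of `ℝ × M` -/

section Diffeos

variable {E H : Type*} [NormedAddCommGroup E] [NormedSpace ℝ E] [TopologicalSpace H]
  {I : ModelWithCorners ℝ E H} {N : Type*} [TopologicalSpace N] [ChartedSpace H N]
  {E' H' : Type*} [NormedAddCommGroup E'] [NormedSpace ℝ E'] [TopologicalSpace H']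
  {J : ModelWithCorners ℝ E' H'} {N' : Type*} [TopologicalSpace N'] [ChartedSpace H' N']
  {E'' H'' : Type*} [NormedAddCommGroup E''] [NormedSpace ℝ E''] [TopologicalSpace H'']
  {J' : ModelWithCorners ℝ E'' H''} {N'' : Type*} [TopologicalSpace N''] [ChartedSpace H'' N'']

lemma mfderiv_comp_apply_of_contMDiff {f : N → N'} {g : N' → N''} (hg : ContMDiff J J' ∞ g)
    (hf : ContMDiff I J ∞ f) (p : N) (v : TangentSpace I p) :
    mfderiv I J' (fun x => g (f x)) p v = mfderiv J J' g (f p) (mfderiv I J f p v) :=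
  DFunLike.congr_fun (mfderiv_comp p (hg.mdifferentiable (by simp) _)
    (hf.mdifferentiable (by simp) _)) v

lemma pullbackForm_comp {f : N → N'} {g : N' → N''} (hg : ContMDiff J J' ∞ g)
    (hf : ContMDiff I J ∞ f) (η : ∀ x : N'', TangentSpace J' x →L[ℝ] ℝ) (p : N) :
    pullbackForm I J' (fun x => g (f x)) η p = pullbackForm I J f (pullbackForm J J' g η) p := by
  ext v
  exact congrArg (η (g (f p))) (mfderiv_comp_apply_of_contMDiff hg hf p v)

lemma mfderiv_symm_mfderiv (f : N ≃ₘ^∞⟮I, J⟯ N') (p : N) (v : TangentSpace I p) :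
    mfderiv J I f.symm (f p) (mfderiv I J f p v) = (v : E) := by
  have h := mfderiv_comp_apply_of_contMDiff f.symm.contMDiff f.contMDiff p v
  have h1 : (fun x => f.symm (f x)) = id := funext f.symm_apply_apply
  rw [h1, mfderiv_id] at h
  exact h.symm

lemma mfderiv_mfderiv_symm (f : N ≃ₘ^∞⟮I, J⟯ N') (p : N') (v : TangentSpace J p) :
    mfderiv I J f (f.symm p) (mfderiv J I f.symm p v) = (v : E') := by
  have h := mfderiv_comp_apply_of_contMDiff f.contMDiff f.symm.contMDiff p v
  have h1 : (fun x => f (f.symm x)) = id := funext f.apply_symm_apply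
  rw [h1, mfderiv_id] at h
  exact h.symm

lemma surjective_mfderiv (f : N ≃ₘ^∞⟮I, J⟯ N') (p : N) :
    Function.Surjective (mfderiv I J f p) := by
  obtain ⟨y, rfl⟩ : ∃ y, f.symm y = p := ⟨f p, f.symm_apply_apply p⟩
  have h : ∀ u : E', mfderiv I J f (f.symm y) (mfderiv J I f.symm y u) = u :=
    fun u => mfderiv_mfderiv_symm f y u
  exact fun w => ⟨_, h w⟩

end Diffeos

section CylinderEnds

open Filter Topology

variable {E : Type*} [NormedAddCommGroup E] [NormedSpace ℝ E]
  {M : Type*} [TopologicalSpace M] [ChartedSpace E M] [IsManifold 𝓘(ℝ, E) ∞ M]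
  {α : ∀ x : M, TangentSpace 𝓘(ℝ, E) x →L[ℝ] ℝ}

/-- An open subset of `ℝ × M` which meets every fiber of the projection to `M` and is invariant
under translations of the line in the positive direction. -/
structure IsPosEnd (V : Set (ℝ × M)) : Prop where
  isOpen : IsOpen V
  translate : ∀ s : ℝ, 0 ≤ s → ∀ q ∈ V, (q.1 + s, q.2) ∈ V
  meets : ∀ x, ∃ t, (t, x) ∈ V

/-- An open subset of `ℝ × M` which meets every fiber of the projection to `M` and is invariant
under translations of the line in the negative direction. -/
structure IsNegEnd (V : Set (ℝ × M)) : Prop where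
  isOpen : IsOpen V
  translate : ∀ s : ℝ, s ≤ 0 → ∀ q ∈ V, (q.1 + s, q.2) ∈ V
  meets : ∀ x, ∃ t, (t, x) ∈ V

/-- The diffeomorphism `f` of `ℝ × M` preserves the symplectic form `d (e^t α)`. -/
def IsCylinderSymplectic (α : ∀ x : M, TangentSpace 𝓘(ℝ, E) x →L[ℝ] ℝ)
    (f : (ℝ × M) ≃ₘ^∞⟮𝓘(ℝ, ℝ).prod 𝓘(ℝ, E), 𝓘(ℝ, ℝ).prod 𝓘(ℝ, E)⟯ (ℝ × M)) : Prop :=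
  ∀ (q : ℝ × M) (v w : TangentSpace (𝓘(ℝ, ℝ).prod 𝓘(ℝ, E)) q),
    extDerivOneForm (𝓘(ℝ, ℝ).prod 𝓘(ℝ, E)) (cylinderForm α) (f q) (mfderiv _ _ f q v)
      (mfderiv _ _ f q w) = extDerivOneForm (𝓘(ℝ, ℝ).prod 𝓘(ℝ, E)) (cylinderForm α) q v w

/-- A symplectic pseudo-isotopy from the identity to `φ`, read in the coordinates `ℝ × M` of the
symplectization given by the contact form `α`. -/
structure IsCylinderPseudoIsotopy (α : ∀ x : M, TangentSpace 𝓘(ℝ, E) x →L[ℝ] ℝ)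
    (f : (ℝ × M) ≃ₘ^∞⟮𝓘(ℝ, ℝ).prod 𝓘(ℝ, E), 𝓘(ℝ, ℝ).prod 𝓘(ℝ, E)⟯ (ℝ × M)) (φ : M → M) :
    Prop where
  symplectic : IsCylinderSymplectic α f
  neg_end : ∃ V, IsNegEnd V ∧ ∀ q ∈ V, f q = q
  pos_end : ∃ V, IsPosEnd V ∧ ∀ q ∈ V,
    pullbackForm (𝓘(ℝ, ℝ).prod 𝓘(ℝ, E)) (𝓘(ℝ, ℝ).prod 𝓘(ℝ, E)) f (cylinderForm α) q =
      cylinderForm α q ∧ (f q).2 = φ q.2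

variable {f g : (ℝ × M) ≃ₘ^∞⟮𝓘(ℝ, ℝ).prod 𝓘(ℝ, E), 𝓘(ℝ, ℝ).prod 𝓘(ℝ, E)⟯ (ℝ × M)}

lemma IsNegEnd.inter {V W : Set (ℝ × M)} (hV : IsNegEnd V) (hW : IsNegEnd W) :
    IsNegEnd (V ∩ W) := by
  refine ⟨hV.isOpen.inter hW.isOpen, fun s hs q hq =>
    ⟨hV.translate s hs q hq.1, hW.translate s hs q hq.2⟩, fun x => ?_⟩
  obtain ⟨t, ht⟩ := hV.meets x
  obtain ⟨r, hr⟩ := hW.meets x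
  refine ⟨min t r, ?_, ?_⟩
  · have := hV.translate (min t r - t) (by linarith [min_le_left t r]) _ ht
    simpa using this
  · have := hW.translate (min t r - r) (by linarith [min_le_right t r]) _ hr
    simpa using this

/-- The Liouville vector field `∂_t` is determined by `d (e^t α) (∂_t, ·) = e^t α`. A symplectic
map that preserves `e^t α` therefore preserves it. -/
lemma mfderiv_time_eq_of_pullbackForm_eq (hα : IsContactForm α) (hf : IsCylinderSymplectic α f)
    {q : ℝ × M}
    (hq : pullbackForm (𝓘(ℝ, ℝ).prod 𝓘(ℝ, E)) (𝓘(ℝ, ℝ).prod 𝓘(ℝ, E)) f (cylinderForm α) q =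
      cylinderForm α q) :
    mfderiv (𝓘(ℝ, ℝ).prod 𝓘(ℝ, E)) (𝓘(ℝ, ℝ).prod 𝓘(ℝ, E)) f q (tpair 𝓘(ℝ, E) q 1 0) =
      tpair 𝓘(ℝ, E) (f q) 1 0 := by
  have hL : ∀ (q : ℝ × M) (u : TangentSpace (𝓘(ℝ, ℝ).prod 𝓘(ℝ, E)) q),
      extDerivOneForm (𝓘(ℝ, ℝ).prod 𝓘(ℝ, E)) (cylinderForm α) q (tpair 𝓘(ℝ, E) q 1 0) u =
        cylinderForm α q u := by
    intro q u
    obtain ⟨b, w, rfl⟩ := exists_eq_tpair u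
    rw [extDerivOneForm_cylinderForm hα.smooth.isSmoothForm, cylinderForm_tpair,
      extDerivOneForm_zero_left, map_zero]
    ring
  -- both sides represent `e^t α` with respect to the symplectic form at `f q`
  refine hα.isNondegenerateForm.eq_of_forall fun w => ?_
  obtain ⟨u, rfl⟩ := surjective_mfderiv f q w
  rw [hf, hL, hL, ← hq]
  rfl

/-- On a neighborhood of the positive end on which it preserves `e^t α`, a symplectic map commutes
with translations of the line. -/
lemma apply_translate_eq [FiniteDimensional ℝ E] [T2Space M] (hα : IsContactForm α)
    (hf : IsCylinderSymplectic α f) {V : Set (ℝ × M)} (hV : IsPosEnd V)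
    (hfV : ∀ q ∈ V,
      pullbackForm (𝓘(ℝ, ℝ).prod 𝓘(ℝ, E)) (𝓘(ℝ, ℝ).prod 𝓘(ℝ, E)) f (cylinderForm α) q =
      cylinderForm α q) {q : ℝ × M} (hq : q ∈ V) {s : ℝ} (hs : 0 ≤ s) :
    f (q.1 + s, q.2) = ((f q).1 + s, (f q).2) := by
  have hv : ContMDiff (𝓘(ℝ, ℝ).prod 𝓘(ℝ, E)) (𝓘(ℝ, ℝ).prod 𝓘(ℝ, E)).tangent 1
      (fun q : ℝ × M => (⟨q, tpair 𝓘(ℝ, E) q 1 0⟩ : TangentBundle _ (ℝ × M))) :=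
    isSmoothVectorField_time.contMDiff.of_le (by simp)
  -- translations are the flow of `∂_t`
  have htr : ∀ q : ℝ × M, IsMIntegralCurve (fun r => (q.1 + r, q.2))
      (fun q : ℝ × M => tpair 𝓘(ℝ, E) q 1 0) := by
    intro q r
    have h1 : MDifferentiableAt 𝓘(ℝ, ℝ) 𝓘(ℝ, ℝ) (fun r => q.1 + r) r :=
      (differentiableAt_id.const_add _).mdifferentiableAt
    have h2 : MDifferentiableAt 𝓘(ℝ, ℝ) 𝓘(ℝ, E) (fun _ : ℝ => q.2) r := mdifferentiableAt_const
    refine (h1.prodMk h2).hasMFDerivAt.congr_mfderiv ?_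
    refine ContinuousLinearMap.ext_ring ?_
    refine (mfderiv_prodMk_eq_tpair h1 h2 _).trans ?_
    have h3 : mfderiv 𝓘(ℝ, ℝ) 𝓘(ℝ, ℝ) (fun r => q.1 + r) r (1 : ℝ) = (1 : ℝ) := by
      rw [mfderiv_eq_fderiv]
      have : HasFDerivAt (fun r => q.1 + r) (ContinuousLinearMap.id ℝ ℝ) r :=
        (hasFDerivAt_id r).const_add q.1
      rw [this.fderiv]
      rfl
    have h4 : mfderiv 𝓘(ℝ, ℝ) 𝓘(ℝ, E) (fun _ : ℝ => q.2) r (1 : ℝ) = (0 : E) := by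
      rw [mfderiv_const]
      rfl
    refine (congrArg₂ (fun (a : ℝ) (b : E) => ((a, b) : ℝ × E)) h3 h4).trans ?_
    change ((1, 0) : ℝ × E) = (1 : ℝ) • ((1, 0) : ℝ × E)
    rw [one_smul]
  obtain ⟨ε, hε, hεV⟩ : ∃ ε > 0, ∀ r ∈ Ioo (-ε) ε, (q.1 + r, q.2) ∈ V := by
    have hc : Continuous (fun r : ℝ => (q.1 + r, q.2)) := by fun_prop
    have h0 : ∀ᶠ r in 𝓝 (0 : ℝ), (q.1 + r, q.2) ∈ V :=
      hc.continuousAt.preimage_mem_nhds (hV.isOpen.mem_nhds (by simpa using hq))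
    obtain ⟨ε, hε, h⟩ := Metric.mem_nhds_iff.1 h0
    refine ⟨ε, hε, fun r hr => h ?_⟩
    rw [Real.ball_eq_Ioo]
    simpa using hr
  have hmem : ∀ r ∈ Ioo (-ε) (s + 1), (q.1 + r, q.2) ∈ V := fun r hr => by
    rcases le_or_gt 0 r with h | h
    · exact hV.translate r h q hq
    · exact hεV r ⟨hr.1, h.trans hε⟩
  have hcurve : IsMIntegralCurveOn (fun r => f (q.1 + r, q.2))
      (fun q : ℝ × M => tpair 𝓘(ℝ, E) q 1 0) (Ioo (-ε) (s + 1)) := by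
    intro r hr
    have h := ((htr q).isMIntegralCurveOn univ).hasMFDerivAt_comp (t := r) univ_mem
      (f.contMDiff.mdifferentiable (by simp) _)
    rw [mfderiv_time_eq_of_pullbackForm_eq hα hf (hfV _ (hmem r hr))] at h
    exact h.hasMFDerivWithinAt
  have := isMIntegralCurveOn_Ioo_eqOn_of_contMDiff_boundaryless (t₀ := 0)
    (⟨by linarith, by linarith⟩ : (0 : ℝ) ∈ Ioo (-ε) (s + 1)) hv hcurve
    ((htr (f q)).isMIntegralCurveOn _) (by simp)
  exact this ⟨by linarith, by linarith⟩

lemma IsCylinderPseudoIsotopy.refl (α : ∀ x : M, TangentSpace 𝓘(ℝ, E) x →L[ℝ] ℝ) :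
    IsCylinderPseudoIsotopy α (Diffeomorph.refl _ _ _) id := by
  refine ⟨fun q v w => ?_, ⟨univ, ⟨isOpen_univ, by simp, by simp⟩, fun _ _ => rfl⟩,
    ⟨univ, ⟨isOpen_univ, by simp, by simp⟩, fun q _ => ⟨?_, rfl⟩⟩⟩
  · rw [Diffeomorph.coe_refl, mfderiv_id]
    rfl
  · rw [Diffeomorph.coe_refl, pullbackForm_id]

/-- The composition is defined near the positive end as required because `g` commutes with
translations there, and hence maps the fiber over `x` into high parts of the fiber over `ψ x`. -/
lemma IsCylinderPseudoIsotopy.comp [FiniteDimensional ℝ E] [T2Space M] (hα : IsContactForm α)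
    {φ ψ : M → M} (hf : IsCylinderPseudoIsotopy α f φ) (hg : IsCylinderPseudoIsotopy α g ψ) :
    IsCylinderPseudoIsotopy α (g.trans f) (φ ∘ ψ) := by
  obtain ⟨Vf, hVf, hfV⟩ := hf.neg_end
  obtain ⟨Vg, hVg, hgV⟩ := hg.neg_end
  obtain ⟨Wf, hWf, hfW⟩ := hf.pos_end
  obtain ⟨Wg, hWg, hgW⟩ := hg.pos_end
  have hm : ∀ (q : ℝ × M) v, mfderiv (𝓘(ℝ, ℝ).prod 𝓘(ℝ, E)) (𝓘(ℝ, ℝ).prod 𝓘(ℝ, E))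
      (g.trans f) q v = mfderiv _ (𝓘(ℝ, ℝ).prod 𝓘(ℝ, E)) f (g q) (mfderiv _ _ g q v) :=
    fun q v => mfderiv_comp_apply_of_contMDiff f.contMDiff g.contMDiff q v
  refine ⟨fun q v w => ?_, ⟨Vf ∩ Vg, hVf.inter hVg, fun q hq => ?_⟩,
    ⟨Wg ∩ g ⁻¹' Wf, ⟨hWg.isOpen.inter (hWf.isOpen.preimage g.continuous), ?_, ?_⟩, ?_⟩⟩
  · rw [hm, hm]
    exact (hf.symplectic _ _ _).trans (hg.symplectic _ _ _)
  · change f (g q) = q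
    rw [hgV q hq.2, hfV q hq.1]
  · intro s hs q hq
    refine ⟨hWg.translate s hs q hq.1, ?_⟩
    rw [mem_preimage, apply_translate_eq hα hg.symplectic hWg (fun q h => (hgW q h).1) hq.1 hs]
    exact hWf.translate s hs _ hq.2
  · intro x
    obtain ⟨t, ht⟩ := hWg.meets x
    obtain ⟨r, hr⟩ := hWf.meets (ψ x)
    refine ⟨t + max 0 (r - (g (t, x)).1), hWg.translate _ (le_max_left _ _) _ ht, ?_⟩
    rw [mem_preimage, apply_translate_eq (q := (t, x)) hα hg.symplectic hWg
      (fun q h => (hgW q h).1) ht (le_max_left _ _), (hgW _ ht).2]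
    have := hWf.translate ((g (t, x)).1 + max 0 (r - (g (t, x)).1) - r)
      (by linarith [le_max_right 0 (r - (g (t, x)).1)]) _ hr
    simpa using this
  · intro q hq
    refine ⟨?_, ?_⟩
    · refine (pullbackForm_comp f.contMDiff g.contMDiff (cylinderForm α) q).trans ?_
      rw [← (hgW q hq.1).1]
      change (pullbackForm _ _ f (cylinderForm α) (g q)).comp _ = _
      rw [(hfW _ hq.2).1]
      rfl
    · exact (hfW _ hq.2).2.trans (congrArg φ (hgW q hq.1).2)

/-- A neighborhood of the positive end for the inverse is the image of one for `f`, which is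
invariant under positive translations because `f` commutes with them. -/
lemma IsCylinderPseudoIsotopy.symm [FiniteDimensional ℝ E] [T2Space M] (hα : IsContactForm α)
    {φ ψ : M → M} (hf : IsCylinderPseudoIsotopy α f φ) (hψ : Function.LeftInverse ψ φ)
    (hψ' : Function.RightInverse ψ φ) : IsCylinderPseudoIsotopy α f.symm ψ := by
  obtain ⟨V, hV, hfV⟩ := hf.neg_end
  obtain ⟨W, hW, hfW⟩ := hf.pos_end
  refine ⟨fun q v w => ?_, ⟨V, hV, fun q hq => ?_⟩,
    ⟨f '' W, ⟨f.toHomeomorph.isOpenMap _ hW.isOpen, ?_, ?_⟩, ?_⟩⟩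
  · obtain ⟨p, rfl⟩ : ∃ p, f p = q := ⟨f.symm q, f.apply_symm_apply q⟩
    obtain ⟨v, rfl⟩ := surjective_mfderiv f p v
    obtain ⟨w, rfl⟩ := surjective_mfderiv f p w
    rw [hf.symplectic, mfderiv_symm_mfderiv f p v, mfderiv_symm_mfderiv f p w]
    -- the tangent spaces at `f.symm (f p)` and `p` are different types
    have : ∀ p' : ℝ × M, p' = p → ∀ v w : ℝ × E,
        extDerivOneForm (𝓘(ℝ, ℝ).prod 𝓘(ℝ, E)) (cylinderForm α) p' v w =
        extDerivOneForm (𝓘(ℝ, ℝ).prod 𝓘(ℝ, E)) (cylinderForm α) p v w := by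
      rintro _ rfl _ _
      rfl
    exact this _ (f.symm_apply_apply p) v w
  · have h := congrArg f.symm (hfV q hq)
    rw [f.symm_apply_apply] at h
    exact h.symm
  · rintro s hs _ ⟨q, hq, rfl⟩
    rw [← apply_translate_eq hα hf.symplectic hW (fun q h => (hfW q h).1) hq hs]
    exact mem_image_of_mem _ (hW.translate s hs q hq)
  · intro x
    obtain ⟨t, ht⟩ := hW.meets (ψ x)
    refine ⟨(f (t, ψ x)).1, (t, ψ x), ht, ?_⟩
    have := (hfW _ ht).2
    rw [hψ' x] at this
    exact Prod.ext rfl this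
  · rintro _ ⟨q, hq, rfl⟩
    refine ⟨?_, ?_⟩
    · ext v
      obtain ⟨v, rfl⟩ := surjective_mfderiv f q v
      have h1 : cylinderForm α (f q) (mfderiv _ _ f q v) = cylinderForm α q v :=
        DFunLike.congr_fun (hfW q hq).1 v
      rw [h1]
      change cylinderForm α (f.symm (f q)) (mfderiv _ _ f.symm (f q) (mfderiv _ _ f q v)) = _
      rw [mfderiv_symm_mfderiv f q v]
      have : ∀ p' : ℝ × M, p' = q → ∀ v : ℝ × E,
          cylinderForm α p' v = cylinderForm α q v := by
        rintro _ rfl _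
        rfl
      exact this _ (f.symm_apply_apply q) v
    · rw [f.symm_apply_apply, (hfW q hq).2, hψ]

end CylinderEnds

/-! ### Passage to the symplectization -/

section Transfer

open ContactStructure ContactStructure.Symplectization

variable {E : Type*} [NormedAddCommGroup E] [NormedSpace ℝ E]
  {M : Type*} [TopologicalSpace M] [ChartedSpace E M] [IsManifold 𝓘(ℝ, E) ∞ M]
  {ξ : ContactStructure E M}

variable (ξ) in
/-- The diffeomorphism `Sξ ≃ ℝ × M` defined by a contact form. -/
noncomputable def symplectizationDiffeo :
    ξ.Symplectization ≃ₘ^∞⟮𝓘(ℝ, ℝ).prod 𝓘(ℝ, E), 𝓘(ℝ, ℝ).prod 𝓘(ℝ, E)⟯ (ℝ × M) where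
  toEquiv := (homeo ξ).toEquiv
  contMDiff_toFun := contMDiff_homeo
  contMDiff_invFun := contMDiff_homeo_symm

lemma symplectizationDiffeo_translate (s : ℝ) (p : ξ.Symplectization) :
    symplectizationDiffeo ξ (translate s p) =
      ((symplectizationDiffeo ξ p).1 + s, (symplectizationDiffeo ξ p).2) := by
  obtain ⟨q, rfl⟩ : ∃ q, ofProd q = p := ⟨toProd p, ofProd_toProd p⟩
  have h1 : translate s (ofProd (ξ := ξ) q) = ofProd (q.1 + s, q.2) := by
    refine Subtype.ext ?_
    change (⟨q.2, Real.exp s • Real.exp q.1 • ξ.form q.2⟩ : CotangentBundle E M) =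
      ⟨q.2, Real.exp (q.1 + s) • ξ.form q.2⟩
    rw [smul_smul, ← Real.exp_add, add_comm]
  rw [h1]
  change toProd (ofProd (ξ := ξ) (q.1 + s, q.2)) =
    ((toProd (ofProd (ξ := ξ) q)).1 + s, (toProd (ofProd (ξ := ξ) q)).2)
  rw [toProd_ofProd, toProd_ofProd]

/-- In the coordinates `ℝ × M` the Liouville form is `e^t α`. -/
lemma liouville_eq_pullbackForm : liouville ξ = pullbackForm (𝓘(ℝ, ℝ).prod 𝓘(ℝ, E))
    (𝓘(ℝ, ℝ).prod 𝓘(ℝ, E)) (symplectizationDiffeo ξ) (cylinderForm ξ.form) := by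
  funext p
  obtain ⟨v, hv⟩ := exists_pos_vector (ξ := ξ) p.proj
  obtain ⟨h1, h2⟩ := apply_eq_div_mul p hv
  have h3 : (symplectizationDiffeo ξ p).1 = Real.log (p.1.snd v / ξ.form p.proj v) :=
    congrArg Prod.fst (toProd_eq p hv)
  have h4 : p.1.snd = Real.exp (symplectizationDiffeo ξ p).1 • ξ.form p.proj := by
    rw [h3, Real.exp_log (div_pos h1 hv)]
    exact h2
  refine ContinuousLinearMap.ext fun u => ?_
  change p.1.snd (mfderiv _ _ (fun p => (symplectizationDiffeo ξ p).2) p u) = _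
  rw [mfderiv_comp_apply_of_contMDiff (g := Prod.snd) contMDiff_snd
    (symplectizationDiffeo ξ).contMDiff, h4]
  rfl

/-- In the coordinates `ℝ × M` the symplectic form is `d (e^t α)`. -/
lemma omega_eq (p : ξ.Symplectization) (v w : TangentSpace (𝓘(ℝ, ℝ).prod 𝓘(ℝ, E)) p) :
    omega ξ p v w = extDerivOneForm (𝓘(ℝ, ℝ).prod 𝓘(ℝ, E)) (cylinderForm ξ.form)
      (symplectizationDiffeo ξ p) (mfderiv _ _ (symplectizationDiffeo ξ) p v)
      (mfderiv _ _ (symplectizationDiffeo ξ) p w) := by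
  unfold omega
  rw [liouville_eq_pullbackForm]
  exact extDerivOneForm_pullbackForm (symplectizationDiffeo ξ).contMDiff
    (isSmoothForm_cylinderForm ξ.isContactForm_form.smooth.isSmoothForm) p v w

variable {F : ξ.SymplectizationDiffeo}
  {f : (ℝ × M) ≃ₘ^∞⟮𝓘(ℝ, ℝ).prod 𝓘(ℝ, E), 𝓘(ℝ, ℝ).prod 𝓘(ℝ, E)⟯ (ℝ × M)}

/-- The derivatives of `F` and of its expression `f` in the coordinates `ℝ × M` are conjugate. Both
sides are read in the model space `ℝ × E`, since their base points agree only by `hF`. -/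
lemma mfderiv_conj_apply
    (hF : ∀ p, symplectizationDiffeo ξ (F p) = f (symplectizationDiffeo ξ p))
    (p : ξ.Symplectization) (v : TangentSpace (𝓘(ℝ, ℝ).prod 𝓘(ℝ, E)) p) :
    (mfderiv (𝓘(ℝ, ℝ).prod 𝓘(ℝ, E)) (𝓘(ℝ, ℝ).prod 𝓘(ℝ, E)) (symplectizationDiffeo ξ) (F p)
      (mfderiv (𝓘(ℝ, ℝ).prod 𝓘(ℝ, E)) (𝓘(ℝ, ℝ).prod 𝓘(ℝ, E)) F p v) : ℝ × E) =
    mfderiv (𝓘(ℝ, ℝ).prod 𝓘(ℝ, E)) (𝓘(ℝ, ℝ).prod 𝓘(ℝ, E)) f (symplectizationDiffeo ξ p)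
      (mfderiv (𝓘(ℝ, ℝ).prod 𝓘(ℝ, E)) (𝓘(ℝ, ℝ).prod 𝓘(ℝ, E)) (symplectizationDiffeo ξ) p v) := by
  have h1 := mfderiv_comp_apply_of_contMDiff (symplectizationDiffeo ξ).contMDiff F.contMDiff p v
  have h2 := mfderiv_comp_apply_of_contMDiff f.contMDiff (symplectizationDiffeo ξ).contMDiff p v
  have h3 : (fun p => symplectizationDiffeo ξ (F p)) = fun p => f (symplectizationDiffeo ξ p) :=
    funext hF
  rw [h3] at h1
  exact h1.symm.trans h2

lemma isSymplectomorphism_iff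
    (hF : ∀ p, symplectizationDiffeo ξ (F p) = f (symplectizationDiffeo ξ p)) :
    IsSymplectomorphism F ↔ IsCylinderSymplectic ξ.form f := by
  have h1 : ∀ (p : ξ.Symplectization) (v w : TangentSpace (𝓘(ℝ, ℝ).prod 𝓘(ℝ, E)) p),
      omega ξ (F p) (mfderiv (𝓘(ℝ, ℝ).prod 𝓘(ℝ, E)) (𝓘(ℝ, ℝ).prod 𝓘(ℝ, E)) F p v)
        (mfderiv (𝓘(ℝ, ℝ).prod 𝓘(ℝ, E)) (𝓘(ℝ, ℝ).prod 𝓘(ℝ, E)) F p w) =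
      extDerivOneForm (𝓘(ℝ, ℝ).prod 𝓘(ℝ, E)) (cylinderForm ξ.form)
        (f (symplectizationDiffeo ξ p))
        (mfderiv (𝓘(ℝ, ℝ).prod 𝓘(ℝ, E)) (𝓘(ℝ, ℝ).prod 𝓘(ℝ, E)) f (symplectizationDiffeo ξ p)
          (mfderiv _ _ (symplectizationDiffeo ξ) p v))
        (mfderiv (𝓘(ℝ, ℝ).prod 𝓘(ℝ, E)) (𝓘(ℝ, ℝ).prod 𝓘(ℝ, E)) f (symplectizationDiffeo ξ p)
          (mfderiv _ _ (symplectizationDiffeo ξ) p w)) := by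
    intro p v w
    rw [omega_eq]
    have h : ∀ (q q' : ℝ × M), q = q' → ∀ a a' b b' : ℝ × E, a = a' → b = b' →
        extDerivOneForm (𝓘(ℝ, ℝ).prod 𝓘(ℝ, E)) (cylinderForm ξ.form) q a b =
        extDerivOneForm (𝓘(ℝ, ℝ).prod 𝓘(ℝ, E)) (cylinderForm ξ.form) q' a' b' := by
      rintro _ _ rfl _ _ _ _ rfl rfl
      rfl
    exact h _ _ (hF p) _ _ _ _ (mfderiv_conj_apply hF p v) (mfderiv_conj_apply hF p w)
  constructor
  · intro h q v w
    obtain ⟨p, rfl⟩ : ∃ p, symplectizationDiffeo ξ p = q :=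
      ⟨(symplectizationDiffeo ξ).symm q, (symplectizationDiffeo ξ).apply_symm_apply q⟩
    obtain ⟨v, rfl⟩ := surjective_mfderiv (symplectizationDiffeo ξ) p v
    obtain ⟨w, rfl⟩ := surjective_mfderiv (symplectizationDiffeo ξ) p w
    rw [← h1, h, omega_eq]
  · intro h p v w
    rw [h1, h, omega_eq]

lemma liouville_preserved_iff
    (hF : ∀ p, symplectizationDiffeo ξ (F p) = f (symplectizationDiffeo ξ p))
    (p : ξ.Symplectization) :
    (∀ v : TangentSpace (𝓘(ℝ, ℝ).prod 𝓘(ℝ, E)) p,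
      liouville ξ (F p) (mfderiv (𝓘(ℝ, ℝ).prod 𝓘(ℝ, E)) (𝓘(ℝ, ℝ).prod 𝓘(ℝ, E)) F p v) =
        liouville ξ p v) ↔
    pullbackForm (𝓘(ℝ, ℝ).prod 𝓘(ℝ, E)) (𝓘(ℝ, ℝ).prod 𝓘(ℝ, E)) f (cylinderForm ξ.form)
      (symplectizationDiffeo ξ p) = cylinderForm ξ.form (symplectizationDiffeo ξ p) := by
  have h1 : ∀ v : TangentSpace (𝓘(ℝ, ℝ).prod 𝓘(ℝ, E)) p,
      liouville ξ (F p) (mfderiv (𝓘(ℝ, ℝ).prod 𝓘(ℝ, E)) (𝓘(ℝ, ℝ).prod 𝓘(ℝ, E)) F p v) =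
      pullbackForm (𝓘(ℝ, ℝ).prod 𝓘(ℝ, E)) (𝓘(ℝ, ℝ).prod 𝓘(ℝ, E)) f (cylinderForm ξ.form)
        (symplectizationDiffeo ξ p) (mfderiv _ _ (symplectizationDiffeo ξ) p v) := by
    intro v
    rw [liouville_eq_pullbackForm]
    have h : ∀ (q q' : ℝ × M), q = q' → ∀ a a' : ℝ × E, a = a' →
        cylinderForm ξ.form q a = cylinderForm ξ.form q' a' := by
      rintro _ _ rfl _ _ rfl
      rfl
    exact h _ _ (hF p) _ _ (mfderiv_conj_apply hF p v)
  have h2 : ∀ v : TangentSpace (𝓘(ℝ, ℝ).prod 𝓘(ℝ, E)) p, liouville ξ p v =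
      cylinderForm ξ.form (symplectizationDiffeo ξ p)
        (mfderiv _ _ (symplectizationDiffeo ξ) p v) := fun v => by
    rw [liouville_eq_pullbackForm]
    rfl
  constructor
  · intro h
    ext v
    obtain ⟨v, rfl⟩ := surjective_mfderiv (symplectizationDiffeo ξ) p v
    rw [← h1, ← h2, h]
  · intro h v
    rw [h1, h2, h]

/-- The symplectic pseudo-isotopies of `Sξ`, in the coordinates given by a contact form. -/
lemma isSymplecticallyPseudoIsotopicToId_iff (φ : ξ.Diff) :
    φ.IsSymplecticallyPseudoIsotopicToId ↔
      ∃ f : (ℝ × M) ≃ₘ^∞⟮𝓘(ℝ, ℝ).prod 𝓘(ℝ, E), 𝓘(ℝ, ℝ).prod 𝓘(ℝ, E)⟯ (ℝ × M),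
        IsCylinderPseudoIsotopy ξ.form f φ := by
  let D := symplectizationDiffeo ξ
  have hDs : ∀ q, D (D.symm q) = q := D.apply_symm_apply
  have htr : ∀ (s : ℝ) (q : ℝ × M), D.symm (q.1 + s, q.2) = translate s (D.symm q) := by
    intro s q
    rw [← D.symm_apply_apply (translate s (D.symm q))]
    change _ = D.symm (symplectizationDiffeo ξ _)
    rw [symplectizationDiffeo_translate]
    change _ = D.symm ((D (D.symm q)).1 + s, (D (D.symm q)).2)
    rw [hDs]
  have hmeets : ∀ V : Set ξ.Symplectization, (∀ x : M, ∃ p ∈ V, proj p = x) →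
      ∀ x, ∃ t, (t, x) ∈ D.symm ⁻¹' V := by
    intro V hV x
    obtain ⟨p, hp, rfl⟩ := hV x
    refine ⟨(D p).1, ?_⟩
    change D.symm (D p) ∈ V
    rwa [D.symm_apply_apply]
  have hmeets' : ∀ V : Set (ℝ × M), (∀ x, ∃ t, (t, x) ∈ V) →
      ∀ x : M, ∃ p ∈ D ⁻¹' V, proj p = x := by
    intro V hV x
    obtain ⟨t, ht⟩ := hV x
    refine ⟨D.symm (t, x), ?_, ?_⟩
    · rwa [mem_preimage, hDs]
    · exact congrArg Prod.snd (hDs (t, x))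
  constructor
  · rintro ⟨F, hF, U, ⟨V, hVU, hVo, hVt, hVm⟩, hUl, hUφ⟩
    obtain ⟨U', ⟨V', hVU', hVo', hVt', hVm'⟩, hU'⟩ := hF.eq_id
    let f := (D.symm.trans F).trans D
    have hconj : ∀ p, D (F p) = f (D p) := fun p => by
      change _ = D (F (D.symm (D p)))
      rw [D.symm_apply_apply]
    refine ⟨f, (isSymplectomorphism_iff hconj).1 hF.symplectic,
      ⟨D.symm ⁻¹' V', ⟨hVo'.preimage D.symm.continuous, fun s hs q hq => ?_, hmeets V' hVm'⟩,
        fun q hq => ?_⟩,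
      ⟨D.symm ⁻¹' V, ⟨hVo.preimage D.symm.continuous, fun s hs q hq => ?_, hmeets V hVm⟩,
        fun q hq => ⟨?_, ?_⟩⟩⟩
    · rw [mem_preimage, htr]
      exact hVt' s hs _ hq
    · change D (F (D.symm q)) = q
      rw [hU' _ (hVU' hq), hDs]
    · rw [mem_preimage, htr]
      exact hVt s hs _ hq
    · have h := (liouville_preserved_iff hconj (D.symm q)).1 (hUl _ (hVU hq))
      have h' : symplectizationDiffeo ξ (D.symm q) = q := hDs q
      rwa [h'] at h
    · change (F (D.symm q)).proj = _
      exact (hUφ _ (hVU hq)).symm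
  · rintro ⟨f, hf⟩
    obtain ⟨V', hV', hfV'⟩ := hf.neg_end
    obtain ⟨V, hV, hfV⟩ := hf.pos_end
    let F : ξ.SymplectizationDiffeo := (D.trans f).trans D.symm
    have hconj : ∀ p, D (F p) = f (D p) := fun p => hDs (f (D p))
    have htr' : ∀ (s : ℝ) p, D (translate s p) = ((D p).1 + s, (D p).2) :=
      symplectizationDiffeo_translate
    have hpos : IsNhdPosEnd (D ⁻¹' V) := ⟨D ⁻¹' V, subset_rfl, hV.isOpen.preimage D.continuous,
      fun s hs p hp => by
        rw [mem_preimage, htr']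
        exact hV.translate s hs _ hp, hmeets' V hV.meets⟩
    have hneg : IsNhdNegEnd (D ⁻¹' V') := ⟨D ⁻¹' V', subset_rfl, hV'.isOpen.preimage D.continuous,
      fun s hs p hp => by
        rw [mem_preimage, htr']
        exact hV'.translate s hs _ hp, hmeets' V' hV'.meets⟩
    have hpl : PreservesLiouvilleOn F (D ⁻¹' V) := fun p hp =>
      (liouville_preserved_iff hconj p).2 (hfV _ hp).1
    refine ⟨F, ⟨(isSymplectomorphism_iff hconj).2 hf.symplectic, ⟨_, hneg, fun p hp => ?_⟩,
      ⟨_, hpos, hpl⟩⟩, ⟨_, hpos, hpl, fun p hp => ?_⟩⟩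
    · change D.symm (f (D p)) = p
      rw [hfV' _ hp, D.symm_apply_apply]
    · exact (congrArg Prod.snd (hconj p)).trans (hfV _ hp).2 |>.symm

/-- The contactomorphisms that are symplectically pseudo-isotopic to the identity form a
subgroup. -/
noncomputable def pseudoIsotopySubgroup [FiniteDimensional ℝ E] [T2Space M]
    (ξ : ContactStructure E M) : Subgroup ξ.Diff where
  carrier := {φ | φ.IsSymplecticallyPseudoIsotopicToId}
  one_mem' := (isSymplecticallyPseudoIsotopicToId_iff 1).2 ⟨_, IsCylinderPseudoIsotopy.refl _⟩
  mul_mem' := by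
    intro φ ψ hφ hψ
    obtain ⟨f, hf⟩ := (isSymplecticallyPseudoIsotopicToId_iff φ).1 hφ
    obtain ⟨g, hg⟩ := (isSymplecticallyPseudoIsotopicToId_iff ψ).1 hψ
    exact (isSymplecticallyPseudoIsotopicToId_iff _).2 ⟨_, hf.comp ξ.isContactForm_form hg⟩
  inv_mem' := by
    intro φ hφ
    obtain ⟨f, hf⟩ := (isSymplecticallyPseudoIsotopicToId_iff φ).1 hφ
    exact (isSymplecticallyPseudoIsotopicToId_iff _).2 ⟨_, hf.symm ξ.isContactForm_form
      φ.toDiffeo.symm_apply_apply φ.toDiffeo.apply_symm_apply⟩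

end Transfer

/-! ### The Reeb field -/

section Reeb

open Filter Topology

variable {E H : Type*} [NormedAddCommGroup E] [NormedSpace ℝ E] [TopologicalSpace H]
  {I : ModelWithCorners ℝ E H} {N : Type*} [TopologicalSpace N] [ChartedSpace H N]
  [I.Boundaryless] [IsManifold I ∞ N]

lemma IsSmoothVectorField.tpair_snd {v : ∀ p : N, TangentSpace I p}
    (hv : IsSmoothVectorField I v) :
    IsSmoothVectorField (𝓘(ℝ, ℝ).prod I) (fun q : ℝ × N => tpair I q 0 (v q.2)) := by
  intro q z hz
  have hz2 := mem_extChartAt_time_prod_target.1 hz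
  refine ((contDiffAt_const (c := (0 : ℝ))).prodMk
    ((hv q.2 _ hz2).comp z contDiffAt_snd)).congr_of_eventuallyEq ?_
  filter_upwards [(isOpen_extChartAt_target q).mem_nhds hz] with z hz
  have hz' := mem_extChartAt_time_prod_source.1 ((extChartAt (𝓘(ℝ, ℝ).prod I) q).map_target hz)
  refine (tangentCoord_tpair hz' 0 _).trans ?_
  rw [extChartAt_time_prod_symm_apply]
  rfl

variable {M : Type*} [TopologicalSpace M] [ChartedSpace E M] [IsManifold 𝓘(ℝ, E) ∞ M]
  {α : ∀ x : M, TangentSpace 𝓘(ℝ, E) x →L[ℝ] ℝ}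

/-- `R` is the Reeb vector field of the contact form `α`. -/
structure IsReebField (α : ∀ x : M, TangentSpace 𝓘(ℝ, E) x →L[ℝ] ℝ)
    (R : ∀ x : M, TangentSpace 𝓘(ℝ, E) x) : Prop where
  apply_eq_one : ∀ x, α x (R x) = 1
  extDeriv_eq_zero : ∀ (x : M) (w : TangentSpace 𝓘(ℝ, E) x),
    extDerivOneForm 𝓘(ℝ, E) α x w (R x) = 0
  smooth : IsSmoothVectorField 𝓘(ℝ, E) R

/-- The Reeb field is the restriction to `t = 0` of the Hamiltonian vector field of `t` on the
symplectization. -/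
lemma ContactGeometry.IsContactForm.exists_isReebField [FiniteDimensional ℝ E]
    (hα : IsContactForm α) : ∃ R : ∀ x : M, TangentSpace 𝓘(ℝ, E) x, IsReebField α R := by
  have hα' := hα.smooth.isSmoothForm
  have hL : ContMDiff (𝓘(ℝ, ℝ).prod (𝓘(ℝ, ℝ).prod 𝓘(ℝ, E))) 𝓘(ℝ, ℝ) ∞
      (fun q : ℝ × (ℝ × M) => q.2.1) := contMDiff_fst.comp contMDiff_snd
  obtain ⟨Y, hY, hYs⟩ := exists_hamiltonianField (isSmoothForm_cylinderForm hα')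
    hα.isNondegenerateForm hL
  have hd : ∀ (q : ℝ × (ℝ × M)) (b : ℝ) (w : TangentSpace 𝓘(ℝ, E) q.2.2),
      differential (𝓘(ℝ, ℝ).prod (𝓘(ℝ, ℝ).prod 𝓘(ℝ, E))) (fun q : ℝ × (ℝ × M) => q.2.1) q
        (tpair (𝓘(ℝ, ℝ).prod 𝓘(ℝ, E)) q 0 (tpair 𝓘(ℝ, E) q.2 b w)) = b := by
    intro q b w
    rw [differential_comp (F := Prod.snd) (f := Prod.fst) mdifferentiableAt_fst
      mdifferentiableAt_snd, mfderiv_snd_tpair]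
    exact mfderiv_fst_tpair _ _ _
  let q₀ : M → ℝ × (ℝ × M) := fun x => (0, (0, x))
  choose a v hav using fun x => exists_eq_tpair (Y (q₀ x))
  have hkey : ∀ (x : M) (b : ℝ) (w : TangentSpace 𝓘(ℝ, E) x),
      a x * α x w - b * α x (v x) + extDerivOneForm 𝓘(ℝ, E) α x (v x) w = - b := by
    intro x b w
    have h1 := hY (q₀ x) (tpair 𝓘(ℝ, E) (0, x) b w)
    rw [hav] at h1
    have h2 := extDerivOneForm_cylinderForm hα' (0, x) (a x) b (v x) w
    have h3 := h2.symm.trans (h1.trans (congrArg Neg.neg (hd (q₀ x) b w)))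
    simpa using h3
  have hR : ∀ x, α x (v x) = 1 := fun x => by
    have h1 := hkey x 0 0
    have h2 := hkey x 1 0
    linarith
  have ha : ∀ x, a x = 0 := fun x => by
    have h1 := hkey x 0 (v x)
    have h2 := extDerivOneForm_swap α x (v x) (v x)
    have h3 : extDerivOneForm 𝓘(ℝ, E) α x (v x) (v x) = 0 := by linarith
    rw [hR x, h3] at h1
    linarith
  refine ⟨v, hR, fun x w => ?_, fun x y hy => ?_⟩
  · have h1 := hkey x 0 w
    rw [ha x] at h1
    rw [extDerivOneForm_swap]
    linarith
  · have hz : ((0 : ℝ), ((0 : ℝ), y)) ∈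
        (extChartAt (𝓘(ℝ, ℝ).prod (𝓘(ℝ, ℝ).prod 𝓘(ℝ, E))) (q₀ x)).target :=
      mem_extChartAt_time_prod_target.2 (mem_extChartAt_time_prod_target.2 hy)
    have hj : ContDiffAt ℝ ∞ (fun y : E => ((0 : ℝ), ((0 : ℝ), y))) y :=
      contDiffAt_const.prodMk (contDiffAt_const.prodMk contDiffAt_id)
    have h1 := ((hYs (q₀ x) _ hz).comp y hj).snd.snd
    refine h1.congr_of_eventuallyEq ?_
    filter_upwards [(isOpen_extChartAt_target x).mem_nhds hy] with z hz
    have hzs := (extChartAt 𝓘(ℝ, E) x).map_target hz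
    have h2 : (extChartAt (𝓘(ℝ, ℝ).prod (𝓘(ℝ, ℝ).prod 𝓘(ℝ, E))) (q₀ x)).symm (0, (0, z)) =
        q₀ ((extChartAt 𝓘(ℝ, E) x).symm z) := by
      rw [extChartAt_time_prod_symm_apply]
      refine Prod.ext rfl ?_
      exact extChartAt_time_prod_symm_apply (0, x) (0, z)
    have h3 : ∀ q, q = q₀ ((extChartAt 𝓘(ℝ, E) x).symm z) →
        tangentCoord (𝓘(ℝ, ℝ).prod (𝓘(ℝ, ℝ).prod 𝓘(ℝ, E))) (q₀ x) q
          (tpair (𝓘(ℝ, ℝ).prod 𝓘(ℝ, E)) q 1 (Y q)) =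
        (1, (a ((extChartAt 𝓘(ℝ, E) x).symm z), tangentCoord 𝓘(ℝ, E) x
          ((extChartAt 𝓘(ℝ, E) x).symm z) (v ((extChartAt 𝓘(ℝ, E) x).symm z)))) := by
      rintro _ rfl
      rw [tangentCoord_tpair (q := q₀ x) (q' := q₀ ((extChartAt 𝓘(ℝ, E) x).symm z))
        (mem_extChartAt_time_prod_source.2 hzs), hav]
      refine Prod.ext rfl ?_
      exact tangentCoord_tpair (q := (0, x)) (q' := (0, (extChartAt 𝓘(ℝ, E) x).symm z)) hzs _ _
    exact (congrArg (fun z : ℝ × (ℝ × E) => z.2.2) (h3 _ h2)).symm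

end Reeb

/-! ### The lift of a path of contactomorphisms -/

section ContactPath

open Filter Topology

variable {E : Type*} [NormedAddCommGroup E] [NormedSpace ℝ E]
  {M : Type*} [TopologicalSpace M] [ChartedSpace E M] [IsManifold 𝓘(ℝ, E) ∞ M]
  {α : ∀ x : M, TangentSpace 𝓘(ℝ, E) x →L[ℝ] ℝ} {R : ∀ x : M, TangentSpace 𝓘(ℝ, E) x}

/-- A smooth path of diffeomorphisms preserving the cooriented contact structure `ker α`, which is
defined for all times and is constant for times outside `[0, 1]`, where it starts at the
identity. -/
structure IsContactPath (α : ∀ x : M, TangentSpace 𝓘(ℝ, E) x →L[ℝ] ℝ)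
    (Φ : ℝ → M ≃ₘ^∞⟮𝓘(ℝ, E), 𝓘(ℝ, E)⟯ M) : Prop where
  smooth : ContMDiff (𝓘(ℝ, ℝ).prod 𝓘(ℝ, E)) 𝓘(ℝ, E) ∞ (fun q : ℝ × M => Φ q.1 q.2)
  conformal : ∀ s x, ∃ c > 0, ∀ w, α (Φ s x) (mfderiv 𝓘(ℝ, E) 𝓘(ℝ, E) (Φ s) x w) = c * α x w
  eq_id : ∀ s ≤ 0, ∀ x, Φ s x = x
  eq_one : ∀ s, 1 ≤ s → Φ s = Φ 1

/-- The path, as a map on `ℝ × M`. -/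
noncomputable def pathMap (Φ : ℝ → M ≃ₘ^∞⟮𝓘(ℝ, E), 𝓘(ℝ, E)⟯ M) (q : ℝ × M) : M := Φ q.1 q.2

/-- The function `g` with `Φ_s^* α = g_s α`. -/
noncomputable def conformalFactor (α : ∀ x : M, TangentSpace 𝓘(ℝ, E) x →L[ℝ] ℝ)
    (R : ∀ x : M, TangentSpace 𝓘(ℝ, E) x) (Φ : ℝ → M ≃ₘ^∞⟮𝓘(ℝ, E), 𝓘(ℝ, E)⟯ M) (q : ℝ × M) : ℝ :=
  pullbackForm (𝓘(ℝ, ℝ).prod 𝓘(ℝ, E)) 𝓘(ℝ, E) (pathMap Φ) α q (tpair 𝓘(ℝ, E) q 0 (R q.2))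

variable {Φ : ℝ → M ≃ₘ^∞⟮𝓘(ℝ, E), 𝓘(ℝ, E)⟯ M}

lemma mfderiv_pathMap (hΦ : IsContactPath α Φ) (q : ℝ × M) (w : TangentSpace 𝓘(ℝ, E) q.2) :
    mfderiv (𝓘(ℝ, ℝ).prod 𝓘(ℝ, E)) 𝓘(ℝ, E) (pathMap Φ) q (tpair 𝓘(ℝ, E) q 0 w) =
      mfderiv 𝓘(ℝ, E) 𝓘(ℝ, E) (Φ q.1) q.2 w :=
  (mfderiv_slice_right (hΦ.smooth.mdifferentiable (by simp) q) w).symm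

/-- The conformal factor is recovered by evaluating `Φ_s^* α` on the Reeb field. This exhibits its
smooth dependence on `(s, x)`. -/
lemma conformalFactor_spec (hR : IsReebField α R) (hΦ : IsContactPath α Φ) (q : ℝ × M) :
    0 < conformalFactor α R Φ q ∧ ∀ w : TangentSpace 𝓘(ℝ, E) q.2,
      α (pathMap Φ q) (mfderiv (𝓘(ℝ, ℝ).prod 𝓘(ℝ, E)) 𝓘(ℝ, E) (pathMap Φ) q
        (tpair 𝓘(ℝ, E) q 0 w)) = conformalFactor α R Φ q * α q.2 w := by
  obtain ⟨c, hc, h⟩ := hΦ.conformal q.1 q.2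
  have h1 : conformalFactor α R Φ q = c := by
    unfold conformalFactor
    change α (pathMap Φ q) (mfderiv _ _ (pathMap Φ) q (tpair 𝓘(ℝ, E) q 0 (R q.2))) = c
    rw [mfderiv_pathMap hΦ]
    refine (h (R q.2)).trans ?_
    rw [hR.apply_eq_one, mul_one]
  refine ⟨h1 ▸ hc, fun w => ?_⟩
  rw [mfderiv_pathMap hΦ, h1]
  exact h w

lemma contMDiff_conformalFactor (hα : IsSmoothForm 𝓘(ℝ, E) α) (hR : IsReebField α R)
    (hΦ : IsContactPath α Φ) :
    ContMDiff (𝓘(ℝ, ℝ).prod 𝓘(ℝ, E)) 𝓘(ℝ, ℝ) ∞ (conformalFactor α R Φ) :=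
  (hα.pullbackForm hΦ.smooth).contMDiff_apply hR.smooth.tpair_snd

lemma contMDiff_log_conformalFactor (hα : IsSmoothForm 𝓘(ℝ, E) α) (hR : IsReebField α R)
    (hΦ : IsContactPath α Φ) :
    ContMDiff (𝓘(ℝ, ℝ).prod 𝓘(ℝ, E)) 𝓘(ℝ, ℝ) ∞
      (fun q => Real.log (conformalFactor α R Φ q)) := by
  intro q
  have h1 : ContMDiffAt 𝓘(ℝ, ℝ) 𝓘(ℝ, ℝ) ∞ Real.log (conformalFactor α R Φ q) :=
    (Real.contDiffAt_log.2 (conformalFactor_spec hR hΦ q).1.ne').contMDiffAt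
  exact h1.comp q (contMDiff_conformalFactor hα hR hΦ q)

/-- The contact Hamiltonian of the path, `h = α (∂_s Φ) / g`, in coordinates of the source. -/
noncomputable def contactHamiltonian (α : ∀ x : M, TangentSpace 𝓘(ℝ, E) x →L[ℝ] ℝ)
    (R : ∀ x : M, TangentSpace 𝓘(ℝ, E) x) (Φ : ℝ → M ≃ₘ^∞⟮𝓘(ℝ, E), 𝓘(ℝ, E)⟯ M) (q : ℝ × M) : ℝ :=
  pullbackForm (𝓘(ℝ, ℝ).prod 𝓘(ℝ, E)) 𝓘(ℝ, E) (pathMap Φ) α q (tpair 𝓘(ℝ, E) q 1 0) /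
    conformalFactor α R Φ q

lemma contMDiff_contactHamiltonian (hα : IsSmoothForm 𝓘(ℝ, E) α) (hR : IsReebField α R)
    (hΦ : IsContactPath α Φ) :
    ContMDiff (𝓘(ℝ, ℝ).prod 𝓘(ℝ, E)) 𝓘(ℝ, ℝ) ∞ (contactHamiltonian α R Φ) :=
  ((hα.pullbackForm hΦ.smooth).contMDiff_apply isSmoothVectorField_time).div₀
    (contMDiff_conformalFactor hα hR hΦ) fun q => (conformalFactor_spec hR hΦ q).1.ne'

/-- The Hamiltonian vanishes while the path is constant. -/
lemma contactHamiltonian_eq_zero (hΦ : IsContactPath α Φ) {q : ℝ × M}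
    (hq : q.1 < 0 ∨ 1 < q.1) : contactHamiltonian α R Φ q = 0 := by
  have h1 : ∃ y, (fun s => pathMap Φ (s, q.2)) =ᶠ[𝓝 q.1] fun _ => y := by
    rcases hq with h | h
    · exact ⟨q.2, (eventually_lt_nhds h).mono fun s hs => hΦ.eq_id s hs.le _⟩
    · refine ⟨Φ 1 q.2, (eventually_gt_nhds h).mono fun s hs => ?_⟩
      change Φ s q.2 = _
      rw [hΦ.eq_one s hs.le]
  obtain ⟨y, hy⟩ := h1
  have hd : MDifferentiableAt (𝓘(ℝ, ℝ).prod 𝓘(ℝ, E)) 𝓘(ℝ, E) (pathMap Φ) q :=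
    hΦ.smooth.mdifferentiable (by simp) q
  have h2 := (hasMFDerivAt_slice_left hd).mfderiv
  rw [hy.mfderiv_eq, mfderiv_const] at h2
  have h3 := DFunLike.congr_fun h2 (1 : ℝ)
  have h4 : mfderiv (𝓘(ℝ, ℝ).prod 𝓘(ℝ, E)) 𝓘(ℝ, E) (pathMap Φ) q (tpair 𝓘(ℝ, E) q 1 0) = 0 :=
    (one_smul ℝ (mfderiv (𝓘(ℝ, ℝ).prod 𝓘(ℝ, E)) 𝓘(ℝ, E) (pathMap Φ) q
      (tpair 𝓘(ℝ, E) q 1 0))).symm.trans h3.symm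
  change α (pathMap Φ q) (mfderiv _ _ (pathMap Φ) q (tpair 𝓘(ℝ, E) q 1 0)) / _ = 0
  rw [h4, map_zero, zero_div]

/-- The lift of the path to the symplectization, `(t, x) ↦ (t - log g_s x, Φ_s x)`. -/
noncomputable def liftMap (α : ∀ x : M, TangentSpace 𝓘(ℝ, E) x →L[ℝ] ℝ)
    (R : ∀ x : M, TangentSpace 𝓘(ℝ, E) x) (Φ : ℝ → M ≃ₘ^∞⟮𝓘(ℝ, E), 𝓘(ℝ, E)⟯ M)
    (q : ℝ × (ℝ × M)) : ℝ × M :=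
  (q.2.1 - Real.log (conformalFactor α R Φ (q.1, q.2.2)), pathMap Φ (q.1, q.2.2))

lemma contMDiff_forget_height : ContMDiff (𝓘(ℝ, ℝ).prod (𝓘(ℝ, ℝ).prod 𝓘(ℝ, E)))
    (𝓘(ℝ, ℝ).prod 𝓘(ℝ, E)) ∞ (fun q : ℝ × (ℝ × M) => (q.1, q.2.2)) :=
  contMDiff_fst.prodMk (contMDiff_snd.comp contMDiff_snd)

lemma mfderiv_forget_height (q : ℝ × (ℝ × M)) (a b : ℝ) (w : TangentSpace 𝓘(ℝ, E) q.2.2) :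
    mfderiv (𝓘(ℝ, ℝ).prod (𝓘(ℝ, ℝ).prod 𝓘(ℝ, E))) (𝓘(ℝ, ℝ).prod 𝓘(ℝ, E))
      (fun q : ℝ × (ℝ × M) => (q.1, q.2.2)) q
      (tpair (𝓘(ℝ, ℝ).prod 𝓘(ℝ, E)) q a (tpair 𝓘(ℝ, E) q.2 b w)) =
    tpair 𝓘(ℝ, E) (q.1, q.2.2) a w := by
  rw [mfderiv_prodMk_eq_tpair (g := fun q : ℝ × (ℝ × M) => q.2.2) mdifferentiableAt_fst
    (mdifferentiableAt_snd.comp q mdifferentiableAt_snd), mfderiv_fst_tpair,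
    mfderiv_comp_apply_of_contMDiff (f := Prod.snd) (g := Prod.snd) contMDiff_snd contMDiff_snd,
    mfderiv_snd_tpair, mfderiv_snd_tpair]

lemma contMDiff_liftMap (hα : IsSmoothForm 𝓘(ℝ, E) α) (hR : IsReebField α R)
    (hΦ : IsContactPath α Φ) :
    ContMDiff (𝓘(ℝ, ℝ).prod (𝓘(ℝ, ℝ).prod 𝓘(ℝ, E))) (𝓘(ℝ, ℝ).prod 𝓘(ℝ, E)) ∞
      (liftMap α R Φ) :=
  ((contMDiff_fst.comp contMDiff_snd).sub
    ((contMDiff_log_conformalFactor hα hR hΦ).comp contMDiff_forget_height)).prodMk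
    (hΦ.smooth.comp contMDiff_forget_height)

/-- The pull-back of `e^t α` by the lifts, as a form on `ℝ × (ℝ × M)`, is `e^t Φ^* α / g`. -/
lemma cylinderForm_mfderiv_liftMap (hα : IsSmoothForm 𝓘(ℝ, E) α) (hR : IsReebField α R)
    (hΦ : IsContactPath α Φ) (q : ℝ × (ℝ × M)) (a b : ℝ) (w : TangentSpace 𝓘(ℝ, E) q.2.2) :
    pullbackForm (𝓘(ℝ, ℝ).prod (𝓘(ℝ, ℝ).prod 𝓘(ℝ, E))) (𝓘(ℝ, ℝ).prod 𝓘(ℝ, E)) (liftMap α R Φ)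
      (cylinderForm α) q (tpair (𝓘(ℝ, ℝ).prod 𝓘(ℝ, E)) q a (tpair 𝓘(ℝ, E) q.2 b w)) =
    Real.exp q.2.1 * (α (pathMap Φ (q.1, q.2.2)) (mfderiv (𝓘(ℝ, ℝ).prod 𝓘(ℝ, E)) 𝓘(ℝ, E)
      (pathMap Φ) (q.1, q.2.2) (tpair 𝓘(ℝ, E) (q.1, q.2.2) a w)) /
        conformalFactor α R Φ (q.1, q.2.2)) := by
  have hg := (conformalFactor_spec hR hΦ (q.1, q.2.2)).1
  have h1 := mfderiv_comp_apply_of_contMDiff (g := Prod.snd) contMDiff_snd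
    (contMDiff_liftMap hα hR hΦ) q (tpair (𝓘(ℝ, ℝ).prod 𝓘(ℝ, E)) q a (tpair 𝓘(ℝ, E) q.2 b w))
  have h2 := mfderiv_comp_apply_of_contMDiff (g := pathMap Φ) hΦ.smooth
    contMDiff_forget_height q (tpair (𝓘(ℝ, ℝ).prod 𝓘(ℝ, E)) q a (tpair 𝓘(ℝ, E) q.2 b w))
  rw [mfderiv_forget_height] at h2
  have h3 := h1.symm.trans h2
  change Real.exp (liftMap α R Φ q).1 * α (liftMap α R Φ q).2 (mfderiv _ _ Prod.snd _
    (mfderiv _ _ (liftMap α R Φ) q _)) = _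
  refine (congrArg (fun u => Real.exp (liftMap α R Φ q).1 * α (liftMap α R Φ q).2 u) h3).trans ?_
  change Real.exp (q.2.1 - Real.log (conformalFactor α R Φ (q.1, q.2.2))) * _ = _
  rw [Real.exp_sub, Real.exp_log hg]
  change _ / _ * α (pathMap Φ (q.1, q.2.2)) _ = _
  ring

/-- The lifts preserve `e^t α`. -/
lemma pullbackForm_liftMap (hα : IsSmoothForm 𝓘(ℝ, E) α) (hR : IsReebField α R)
    (hΦ : IsContactPath α Φ) (q : ℝ × (ℝ × M)) (w : TangentSpace (𝓘(ℝ, ℝ).prod 𝓘(ℝ, E)) q.2) :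
    pullbackForm (𝓘(ℝ, ℝ).prod (𝓘(ℝ, ℝ).prod 𝓘(ℝ, E))) (𝓘(ℝ, ℝ).prod 𝓘(ℝ, E)) (liftMap α R Φ)
      (cylinderForm α) q (tpair (𝓘(ℝ, ℝ).prod 𝓘(ℝ, E)) q 0 w) = cylinderForm α q.2 w := by
  obtain ⟨b, w, rfl⟩ := exists_eq_tpair w
  have hg := (conformalFactor_spec hR hΦ (q.1, q.2.2))
  rw [cylinderForm_mfderiv_liftMap hα hR hΦ, cylinderForm_tpair, hg.2, mul_div_cancel_left₀]
  exact hg.1.ne'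

lemma pullbackForm_liftMap_slice (hα : IsSmoothForm 𝓘(ℝ, E) α) (hR : IsReebField α R)
    (hΦ : IsContactPath α Φ) (s : ℝ) :
    pullbackForm (𝓘(ℝ, ℝ).prod 𝓘(ℝ, E)) (𝓘(ℝ, ℝ).prod 𝓘(ℝ, E)) (fun p => liftMap α R Φ (s, p))
      (cylinderForm α) = cylinderForm α := by
  funext p
  ext w
  rw [← pullbackForm_liftMap hα hR hΦ (s, p) w]
  exact congrArg (cylinderForm α (liftMap α R Φ (s, p))) (mfderiv_slice_right (q := (s, p))
    ((contMDiff_liftMap hα hR hΦ).mdifferentiable (by simp) _) w)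

/-- The Hamiltonian of the path of lifts, pulled back by the lifts; it is `e^t h`. -/
noncomputable def liftHamiltonian (α : ∀ x : M, TangentSpace 𝓘(ℝ, E) x →L[ℝ] ℝ)
    (R : ∀ x : M, TangentSpace 𝓘(ℝ, E) x) (Φ : ℝ → M ≃ₘ^∞⟮𝓘(ℝ, E), 𝓘(ℝ, E)⟯ M)
    (q : ℝ × (ℝ × M)) : ℝ :=
  Real.exp q.2.1 * contactHamiltonian α R Φ (q.1, q.2.2)

lemma contMDiff_liftHamiltonian (hα : IsSmoothForm 𝓘(ℝ, E) α) (hR : IsReebField α R)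
    (hΦ : IsContactPath α Φ) :
    ContMDiff (𝓘(ℝ, ℝ).prod (𝓘(ℝ, ℝ).prod 𝓘(ℝ, E))) 𝓘(ℝ, ℝ) ∞ (liftHamiltonian α R Φ) :=
  (contMDiff_exp_fst.comp contMDiff_snd).mul
    ((contMDiff_contactHamiltonian hα hR hΦ).comp contMDiff_forget_height)

/-- If `Y` is the Hamiltonian field of minus the Hamiltonian of the lifts `P_s`, then the derivative
of `(s, p) ↦ P_s p` vanishes on `∂_s + Y`. In other words, `P_s` is constant along the curves moved
by `Y`, so that `Y` generates the inverses of the lifts. -/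
lemma mfderiv_liftMap_eq_zero [FiniteDimensional ℝ E] (hα : IsContactForm α)
    (hR : IsReebField α R) (hΦ : IsContactPath α Φ) (q : ℝ × (ℝ × M))
    {Y : TangentSpace (𝓘(ℝ, ℝ).prod 𝓘(ℝ, E)) q.2}
    (hY : ∀ w : TangentSpace (𝓘(ℝ, ℝ).prod 𝓘(ℝ, E)) q.2,
      extDerivOneForm (𝓘(ℝ, ℝ).prod 𝓘(ℝ, E)) (cylinderForm α) q.2 Y w =
        differential (𝓘(ℝ, ℝ).prod (𝓘(ℝ, ℝ).prod 𝓘(ℝ, E))) (liftHamiltonian α R Φ) q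
          (tpair (𝓘(ℝ, ℝ).prod 𝓘(ℝ, E)) q 0 w)) :
    mfderiv (𝓘(ℝ, ℝ).prod (𝓘(ℝ, ℝ).prod 𝓘(ℝ, E))) (𝓘(ℝ, ℝ).prod 𝓘(ℝ, E)) (liftMap α R Φ) q
      (tpair (𝓘(ℝ, ℝ).prod 𝓘(ℝ, E)) q 1 Y) = 0 := by
  have hα' := hα.smooth.isSmoothForm
  have hlam := isSmoothForm_cylinderForm hα'
  have hP := contMDiff_liftMap hα' hR hΦ
  have hPd := hP.mdifferentiable (by simp) q
  set D : TangentSpace (𝓘(ℝ, ℝ).prod (𝓘(ℝ, ℝ).prod 𝓘(ℝ, E))) q →L[ℝ]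
    TangentSpace (𝓘(ℝ, ℝ).prod 𝓘(ℝ, E)) (liftMap α R Φ q) := mfderiv _ _ (liftMap α R Φ) q with hD
  -- the lift at a fixed time is symplectic
  have hsymp : ∀ u w : TangentSpace (𝓘(ℝ, ℝ).prod 𝓘(ℝ, E)) q.2,
      extDerivOneForm (𝓘(ℝ, ℝ).prod 𝓘(ℝ, E)) (cylinderForm α) (liftMap α R Φ q)
        (D (tpair (𝓘(ℝ, ℝ).prod 𝓘(ℝ, E)) q 0 u)) (D (tpair (𝓘(ℝ, ℝ).prod 𝓘(ℝ, E)) q 0 w)) =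
      extDerivOneForm (𝓘(ℝ, ℝ).prod 𝓘(ℝ, E)) (cylinderForm α) q.2 u w := by
    intro u w
    have h1 := extDerivOneForm_pullbackForm (f := fun p => liftMap α R Φ (q.1, p))
      (hP.comp (contMDiff_const.prodMk contMDiff_id)) hlam q.2 u w
    rw [pullbackForm_liftMap_slice hα' hR hΦ, mfderiv_slice_right hPd,
      mfderiv_slice_right hPd] at h1
    exact h1.symm
  -- hence its derivative is bijective
  have hsurj : ∀ w : TangentSpace (𝓘(ℝ, ℝ).prod 𝓘(ℝ, E)) (liftMap α R Φ q),
      ∃ u, D (tpair (𝓘(ℝ, ℝ).prod 𝓘(ℝ, E)) q 0 u) = w := by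
    have hker : ∀ u : TangentSpace (𝓘(ℝ, ℝ).prod 𝓘(ℝ, E)) q.2,
        D (tpair (𝓘(ℝ, ℝ).prod 𝓘(ℝ, E)) q 0 u) = 0 → u = 0 := by
      intro u hu
      refine hα.isNondegenerateForm q.2 u fun w => ?_
      rw [← hsymp, hu, extDerivOneForm_zero_left]
    let D' : (ℝ × (ℝ × E)) →L[ℝ] (ℝ × E) := D
    let A : (ℝ × E) →ₗ[ℝ] (ℝ × E) := (D'.comp (ContinuousLinearMap.inr ℝ ℝ (ℝ × E)))
    have hinj : Function.Injective A := by
      rw [← LinearMap.ker_eq_bot, LinearMap.ker_eq_bot']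
      exact fun u hu => hker u hu
    exact LinearMap.injective_iff_surjective.1 hinj
  -- the Hamiltonian of the lifts is the contraction of `e^t α` with their velocity
  have hH : (fun q => pullbackForm (𝓘(ℝ, ℝ).prod (𝓘(ℝ, ℝ).prod 𝓘(ℝ, E))) (𝓘(ℝ, ℝ).prod 𝓘(ℝ, E))
      (liftMap α R Φ) (cylinderForm α) q (tpair (𝓘(ℝ, ℝ).prod 𝓘(ℝ, E)) q 1 0)) =
      liftHamiltonian α R Φ := funext fun q => cylinderForm_mfderiv_liftMap hα' hR hΦ q 1 0 0
  have htime : ∀ w : TangentSpace (𝓘(ℝ, ℝ).prod 𝓘(ℝ, E)) q.2,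
      extDerivOneForm (𝓘(ℝ, ℝ).prod 𝓘(ℝ, E)) (cylinderForm α) (liftMap α R Φ q)
        (D (tpair (𝓘(ℝ, ℝ).prod 𝓘(ℝ, E)) q 1 0)) (D (tpair (𝓘(ℝ, ℝ).prod 𝓘(ℝ, E)) q 0 w)) =
      - differential (𝓘(ℝ, ℝ).prod (𝓘(ℝ, ℝ).prod 𝓘(ℝ, E))) (liftHamiltonian α R Φ) q
          (tpair (𝓘(ℝ, ℝ).prod 𝓘(ℝ, E)) q 0 w) := by
    intro w
    have h1 := extDerivOneForm_time_eq (hlam.pullbackForm hP) (μ := cylinderForm α)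
      (pullbackForm_liftMap hα' hR hΦ) q w (by
        rw [hH]
        exact (contMDiff_liftHamiltonian hα' hR hΦ).mdifferentiable (by simp) q)
    rw [hH, extDerivOneForm_pullbackForm hP hlam] at h1
    exact h1
  have hsplit : tpair (𝓘(ℝ, ℝ).prod 𝓘(ℝ, E)) q 1 Y =
      tpair (𝓘(ℝ, ℝ).prod 𝓘(ℝ, E)) q 1 0 + tpair (𝓘(ℝ, ℝ).prod 𝓘(ℝ, E)) q 0 Y := by
    rw [tpair_add, add_zero, zero_add]
  refine hα.isNondegenerateForm _ _ fun w => ?_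
  obtain ⟨w, rfl⟩ := hsurj w
  change extDerivOneForm _ _ _ (D _) _ = 0
  rw [hsplit, map_add, extDerivOneForm_add_left, htime, hsymp, hY]
  ring

end ContactPath

/-! ### Compact exhaustions adapted to a path -/

section OpenMap

open Filter Topology

variable {E H : Type*} [NormedAddCommGroup E] [NormedSpace ℝ E] [TopologicalSpace H]
  {I : ModelWithCorners ℝ E H} {N : Type*} [TopologicalSpace N] [ChartedSpace H N]
  [I.Boundaryless] [IsManifold I ∞ N]
  {E' H' : Type*} [NormedAddCommGroup E'] [NormedSpace ℝ E'] [TopologicalSpace H']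
  {J : ModelWithCorners ℝ E' H'} {N' : Type*} [TopologicalSpace N'] [ChartedSpace H' N']
  [J.Boundaryless] [IsManifold J ∞ N']

lemma fderiv_writtenInCharts_self {f : N → N'} (hf : ContMDiff I J ∞ f) (x : N) (w : E) :
    fderiv ℝ (fun y => extChartAt J (f x) (f ((extChartAt I x).symm y))) (extChartAt I x x) w =
      mfderiv I J f x w := by
  have h := fderiv_writtenInCharts hf (mem_extChartAt_target x) (x₂ := f x)
    (by rw [extChartAt_to_inv]; exact mem_extChartAt_source (f x)) w
  refine h.trans ?_
  have h1 := (extChartAt_to_inv (I := I) x)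
  have h3 : ∀ p : N, p = x → ∀ u : TangentSpace I p, tangentCoord I x p u = w →
      tangentCoord J (f x) (f p) (mfderiv I J f p u) = mfderiv I J f x w := by
    rintro _ rfl u hu
    rw [tangentCoord_self] at hu
    rw [tangentCoord_self, ← hu]
  exact h3 _ h1 _ (tangentCoord_tangentCoordSymm (mem_extChartAt_target x) w)

/-- A smooth submersion is open. -/
lemma isOpenMap_of_surjective_mfderiv [CompleteSpace E] [CompleteSpace E'] {f : N → N'}
    (hf : ContMDiff I J ∞ f) (hs : ∀ x, Function.Surjective (mfderiv I J f x)) : IsOpenMap f := by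
  refine IsOpenMap.of_nhds_le fun x => ?_
  set g : E → E' := fun y => extChartAt J (f x) (f ((extChartAt I x).symm y)) with hg
  have hgs : HasStrictFDerivAt g (fderiv ℝ g (extChartAt I x x)) (extChartAt I x x) :=
    (contDiffAt_writtenInCharts hf (mem_extChartAt_target x)
      (by rw [extChartAt_to_inv]; exact mem_extChartAt_source (f x))).hasStrictFDerivAt (by simp)
  have hsurj : (fderiv ℝ g (extChartAt I x x)).range = ⊤ := by
    refine LinearMap.range_eq_top.2 fun w => ?_
    obtain ⟨u, hu⟩ := hs x w
    exact ⟨u, (fderiv_writtenInCharts_self hf x u).trans hu⟩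
  have h1 := hgs.map_nhds_eq_of_surj hsurj
  have hgx : g (extChartAt I x x) = extChartAt J (f x) (f x) := by
    simp only [hg, extChartAt_to_inv]
  rw [hgx, ← map_extChartAt_nhds_of_boundaryless x, map_map] at h1
  have h2 : (g ∘ extChartAt I x) =ᶠ[𝓝 x] fun y => extChartAt J (f x) (f y) := by
    filter_upwards [extChartAt_source_mem_nhds (I := I) x] with y hy
    simp only [hg, Function.comp, (extChartAt I x).left_inv hy]
  rw [map_congr h2] at h1
  have h3 : (extChartAt J (f x)).symm ∘ (fun y => extChartAt J (f x) (f y)) =ᶠ[𝓝 x] f := by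
    filter_upwards [hf.continuous.continuousAt.preimage_mem_nhds
      (extChartAt_source_mem_nhds (I := J) (f x))] with y hy
    exact (extChartAt J (f x)).left_inv hy
  have h4 := map_extChartAt_symm_nhdsWithin_range (I := J) (f x)
  rw [J.range_eq_univ, nhdsWithin_univ] at h4
  rw [← map_congr h3, ← map_map, h1, h4]

end OpenMap

section ContactPathTopology

open Filter Topology

variable {E : Type*} [NormedAddCommGroup E] [NormedSpace ℝ E] [FiniteDimensional ℝ E]
  {M : Type*} [TopologicalSpace M] [ChartedSpace E M] [IsManifold 𝓘(ℝ, E) ∞ M]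
  {α : ∀ x : M, TangentSpace 𝓘(ℝ, E) x →L[ℝ] ℝ} {R : ∀ x : M, TangentSpace 𝓘(ℝ, E) x}
  {Φ : ℝ → M ≃ₘ^∞⟮𝓘(ℝ, E), 𝓘(ℝ, E)⟯ M}

/-- The inverses of the diffeomorphisms of a smooth path depend continuously on the parameter: the
bijection `(s, x) ↦ (s, Φ_s x)` is a submersion, hence open. -/
lemma continuous_pathMap_symm (hΦ : IsContactPath α Φ) :
    Continuous (fun q : ℝ × M => (Φ q.1).symm q.2) := by
  have : CompleteSpace E := FiniteDimensional.complete ℝ E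
  let e : (ℝ × M) ≃ (ℝ × M) :=
    { toFun := fun q => (q.1, pathMap Φ q)
      invFun := fun q => (q.1, (Φ q.1).symm q.2)
      left_inv := fun q => Prod.ext rfl ((Φ q.1).symm_apply_apply q.2)
      right_inv := fun q => Prod.ext rfl ((Φ q.1).apply_symm_apply q.2) }
  have he : ContMDiff (𝓘(ℝ, ℝ).prod 𝓘(ℝ, E)) (𝓘(ℝ, ℝ).prod 𝓘(ℝ, E)) ∞ e :=
    contMDiff_fst.prodMk hΦ.smooth
  have hopen : IsOpenMap e := by
    refine isOpenMap_of_surjective_mfderiv he fun q u => ?_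
    obtain ⟨a, w, rfl⟩ := exists_eq_tpair u
    have hd : MDifferentiableAt (𝓘(ℝ, ℝ).prod 𝓘(ℝ, E)) 𝓘(ℝ, E) (pathMap Φ) q :=
      hΦ.smooth.mdifferentiable (by simp) q
    set D : TangentSpace (𝓘(ℝ, ℝ).prod 𝓘(ℝ, E)) q →L[ℝ] TangentSpace 𝓘(ℝ, E) (pathMap Φ q) :=
      mfderiv (𝓘(ℝ, ℝ).prod 𝓘(ℝ, E)) 𝓘(ℝ, E) (pathMap Φ) q with hD
    obtain ⟨v, hv⟩ := surjective_mfderiv (Φ q.1) q.2 (w - D (tpair 𝓘(ℝ, E) q a 0))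
    refine ⟨tpair 𝓘(ℝ, E) q a v, (mfderiv_snd_tpair_comp hd _).trans ?_⟩
    have h1 : differential (𝓘(ℝ, ℝ).prod 𝓘(ℝ, E)) (Prod.fst : ℝ × M → ℝ) q
        (tpair 𝓘(ℝ, E) q a v) = a := mfderiv_fst_tpair _ _ _
    have h2 : D (tpair 𝓘(ℝ, E) q a v) = w := by
      have h3 : tpair 𝓘(ℝ, E) q a v = tpair 𝓘(ℝ, E) q a 0 + tpair 𝓘(ℝ, E) q 0 v := by
        rw [tpair_add, add_zero, zero_add]
      have h4 : D (tpair 𝓘(ℝ, E) q 0 v) = w - D (tpair 𝓘(ℝ, E) q a 0) :=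
        (mfderiv_pathMap hΦ q v).trans hv
      rw [h3, map_add, h4, add_sub_cancel]
    rw [h1]
    exact congrArg (tpair 𝓘(ℝ, E) (e q) a) h2
  have hcont : Continuous e.symm :=
    continuous_def.2 fun s hs => by
      rw [← e.image_eq_preimage_symm]
      exact hopen s hs
  exact continuous_snd.comp hcont

/-- The inverse of the lift to the symplectization. -/
noncomputable def liftInv (α : ∀ x : M, TangentSpace 𝓘(ℝ, E) x →L[ℝ] ℝ)
    (R : ∀ x : M, TangentSpace 𝓘(ℝ, E) x) (Φ : ℝ → M ≃ₘ^∞⟮𝓘(ℝ, E), 𝓘(ℝ, E)⟯ M)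
    (q : ℝ × (ℝ × M)) : ℝ × M :=
  (q.2.1 + Real.log (conformalFactor α R Φ (q.1, (Φ q.1).symm q.2.2)), (Φ q.1).symm q.2.2)

lemma liftInv_liftMap (s : ℝ) (p : ℝ × M) : liftInv α R Φ (s, liftMap α R Φ (s, p)) = p := by
  have h : (Φ s).symm (pathMap Φ (s, p.2)) = p.2 := (Φ s).symm_apply_apply p.2
  unfold liftInv liftMap
  simp only [h, sub_add_cancel]

lemma liftMap_liftInv (s : ℝ) (p : ℝ × M) : liftMap α R Φ (s, liftInv α R Φ (s, p)) = p := by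
  have h : pathMap Φ (s, (Φ s).symm p.2) = p.2 := (Φ s).apply_symm_apply p.2
  unfold liftInv liftMap
  simp only [h, add_sub_cancel_right]

lemma continuous_liftInv (hα : IsSmoothForm 𝓘(ℝ, E) α) (hR : IsReebField α R)
    (hΦ : IsContactPath α Φ) : Continuous (liftInv α R Φ) := by
  have h1 : Continuous (fun q : ℝ × (ℝ × M) => (Φ q.1).symm q.2.2) :=
    (continuous_pathMap_symm hΦ).comp (by fun_prop : Continuous fun q : ℝ × (ℝ × M) => (q.1, q.2.2))
  exact ((continuous_fst.comp continuous_snd).add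
    ((contMDiff_log_conformalFactor hα hR hΦ).continuous.comp (continuous_fst.prodMk h1))).prodMk h1

/-- The lift of the diffeomorphism at time `s`. -/
noncomputable def liftDiffeo (hα : IsSmoothForm 𝓘(ℝ, E) α) (hR : IsReebField α R)
    (hΦ : IsContactPath α Φ) (s : ℝ) :
    (ℝ × M) ≃ₘ^∞⟮𝓘(ℝ, ℝ).prod 𝓘(ℝ, E), 𝓘(ℝ, ℝ).prod 𝓘(ℝ, E)⟯ (ℝ × M) where
  toFun p := liftMap α R Φ (s, p)
  invFun p := liftInv α R Φ (s, p)
  left_inv := liftInv_liftMap s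
  right_inv := liftMap_liftInv s
  contMDiff_toFun := (contMDiff_liftMap hα hR hΦ).comp (contMDiff_const.prodMk contMDiff_id)
  contMDiff_invFun := by
    have h1 : ContMDiff (𝓘(ℝ, ℝ).prod 𝓘(ℝ, E)) 𝓘(ℝ, E) ∞
        (fun p : ℝ × M => (Φ s).symm p.2) := (Φ s).symm.contMDiff.comp contMDiff_snd
    exact (contMDiff_fst.add ((contMDiff_log_conformalFactor hα hR hΦ).comp
      (contMDiff_const.prodMk h1))).prodMk h1

/-- The points whose orbits under the path meet the orbit of a point of `A`, possibly at different
times. An integral curve along which the lifts are constant stays over the trace of each point over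
which it passes. -/
def trace (Φ : ℝ → M ≃ₘ^∞⟮𝓘(ℝ, E), 𝓘(ℝ, E)⟯ M) (A : Set M) : Set M :=
  {y | ∃ s s' : ℝ, ∃ x ∈ A, Φ s y = Φ s' x}

lemma subset_trace (A : Set M) : A ⊆ trace Φ A := fun x hx => ⟨0, 0, x, hx, rfl⟩

/-- The path takes all its values at times in `[0, 1]`. -/
lemma exists_mem_Icc_eq (hΦ : IsContactPath α Φ) (s : ℝ) :
    ∃ r ∈ Icc (0 : ℝ) 1, ∀ x, Φ s x = Φ r x := by
  rcases le_total s 0 with h | h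
  · exact ⟨0, ⟨le_rfl, zero_le_one⟩, fun x => by rw [hΦ.eq_id s h, hΦ.eq_id 0 le_rfl]⟩
  rcases le_total s 1 with h' | h'
  · exact ⟨s, ⟨h, h'⟩, fun _ => rfl⟩
  · exact ⟨1, ⟨zero_le_one, le_rfl⟩, fun x => by rw [hΦ.eq_one s h']⟩

lemma isCompact_trace (hΦ : IsContactPath α Φ) {A : Set M} (hA : IsCompact A) :
    IsCompact (trace Φ A) := by
  have hc : Continuous (fun z : ℝ × (ℝ × M) => (Φ z.1).symm (pathMap Φ z.2)) :=
    (continuous_pathMap_symm hΦ).comp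
      (continuous_fst.prodMk (hΦ.smooth.continuous.comp continuous_snd))
  have h := ((isCompact_Icc (a := (0 : ℝ)) (b := 1)).prod
    ((isCompact_Icc (a := (0 : ℝ)) (b := 1)).prod hA)).image hc
  convert h using 1
  ext y
  constructor
  · rintro ⟨s, s', x, hx, e⟩
    obtain ⟨r, hr, hre⟩ := exists_mem_Icc_eq hΦ s
    obtain ⟨r', hr', hre'⟩ := exists_mem_Icc_eq hΦ s'
    refine ⟨(r, (r', x)), ⟨hr, hr', hx⟩, ?_⟩
    change (Φ r).symm (Φ r' x) = y
    rw [← hre', ← e, hre, (Φ r).symm_apply_apply]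
  · rintro ⟨⟨r, r', x⟩, ⟨-, -, hx⟩, rfl⟩
    exact ⟨r, r', x, hx, (Φ r).apply_symm_apply _⟩

/-- A compact exhaustion that is adapted to the path: the trace of each member lies in the interior
of the next one. -/
structure IsTraceExhaustion (Φ : ℝ → M ≃ₘ^∞⟮𝓘(ℝ, E), 𝓘(ℝ, E)⟯ M) (C : ℕ → Set M) : Prop where
  isCompact : ∀ n, IsCompact (C n)
  trace_subset : ∀ n, trace Φ (C n) ⊆ interior (C (n + 1))
  exists_mem : ∀ x, ∃ n, x ∈ C n

lemma exists_isTraceExhaustion [T2Space M] [SecondCountableTopology M] (hΦ : IsContactPath α Φ) :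
    ∃ C : ℕ → Set M, IsTraceExhaustion Φ C := by
  have : LocallyCompactSpace M := ChartedSpace.locallyCompactSpace E M
  let K := CompactExhaustion.choice M
  choose f hf using fun (n : ℕ) (A : TopologicalSpace.Compacts M) =>
    exists_compact_superset ((isCompact_trace hΦ A.isCompact).union (K.isCompact n))
  let C : ℕ → TopologicalSpace.Compacts M := fun n =>
    Nat.rec ⊥ (fun n A => ⟨f n A, (hf n A).1⟩) n
  let C' : ℕ → Set M := fun n => (C n).carrier
  have hC : ∀ n, C' (n + 1) = f n (C n) := fun n => rfl
  refine ⟨C', ⟨fun n => (C n).isCompact, fun n => ?_, fun x => ?_⟩⟩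
  · rw [hC]
    exact subset_union_left.trans (hf n (C n)).2
  · obtain ⟨n, hn⟩ := K.exists_mem x
    refine ⟨n + 1, ?_⟩
    rw [hC]
    exact interior_subset ((hf n (C n)).2 (Or.inr hn))

end ContactPathTopology

/-! ### Walls and annuli -/

section Walls

open Filter Topology

variable {E : Type*} [NormedAddCommGroup E] [NormedSpace ℝ E] [FiniteDimensional ℝ E]
  {M : Type*} [TopologicalSpace M] [ChartedSpace E M] [IsManifold 𝓘(ℝ, E) ∞ M]
  {α : ∀ x : M, TangentSpace 𝓘(ℝ, E) x →L[ℝ] ℝ}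
  {Φ : ℝ → M ≃ₘ^∞⟮𝓘(ℝ, E), 𝓘(ℝ, E)⟯ M} {C : ℕ → Set M}

namespace IsTraceExhaustion

lemma subset_interior (hC : IsTraceExhaustion Φ C) (n : ℕ) : C n ⊆ interior (C (n + 1)) :=
  (subset_trace _).trans (hC.trace_subset n)

lemma mono (hC : IsTraceExhaustion Φ C) : Monotone C :=
  monotone_nat_of_le_succ fun n => (hC.subset_interior n).trans interior_subset

end IsTraceExhaustion

/-- The walls, that surround larger and larger parts of `M`. Every fourth member of the exhaustion
is used, to leave room for disjoint annuli around the walls. -/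
def wall (C : ℕ → Set M) (j : ℕ) : Set M := frontier (C (4 * j + 2))

/-- The open annuli around the walls. -/
def openAnnulus (C : ℕ → Set M) (j : ℕ) : Set M := interior (C (4 * j + 3)) \ C (4 * j + 1)

/-- The closed annuli around the walls. -/
def closedAnnulus (C : ℕ → Set M) (j : ℕ) : Set M := C (4 * j + 3) \ interior (C (4 * j + 1))

lemma openAnnulus_subset_closedAnnulus (j : ℕ) : openAnnulus C j ⊆ closedAnnulus C j :=
  fun _ hx => ⟨interior_subset hx.1, fun h => hx.2 (interior_subset h)⟩

namespace IsTraceExhaustion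

variable [T2Space M]

lemma isOpen_openAnnulus (hC : IsTraceExhaustion Φ C) (j : ℕ) : IsOpen (openAnnulus C j) :=
  isOpen_interior.sdiff (hC.isCompact _).isClosed

lemma isClosed_closedAnnulus (hC : IsTraceExhaustion Φ C) (j : ℕ) : IsClosed (closedAnnulus C j) :=
  (hC.isCompact _).isClosed.sdiff isOpen_interior

lemma trace_wall_subset (hC : IsTraceExhaustion Φ C) (j : ℕ) :
    trace Φ (wall C j) ⊆ openAnnulus C j := by
  have hw : wall C j ⊆ C (4 * j + 2) := (hC.isCompact _).isClosed.frontier_subset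
  rintro y ⟨s, s', x, hx, e⟩
  refine ⟨hC.trace_subset _ ⟨s, s', x, hw hx, e⟩, fun hy => ?_⟩
  exact hx.2 (hC.trace_subset _ ⟨s', s, y, hy, e.symm⟩)

/-- A member of the exhaustion meets finitely many annuli only. -/
lemma le_of_mem_closedAnnulus (hC : IsTraceExhaustion Φ C) {n j : ℕ} {x : M}
    (hx : x ∈ interior (C (n + 1))) (hj : x ∈ closedAnnulus C j) : j ≤ n := by
  by_contra! h
  exact hj.2 (interior_mono (hC.mono (by omega)) hx)

lemma eq_of_mem_closedAnnulus (hC : IsTraceExhaustion Φ C) {i j : ℕ} {x : M}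
    (hi : x ∈ closedAnnulus C i) (hj : x ∈ closedAnnulus C j) : i = j := by
  have h : ∀ {i j : ℕ}, x ∈ closedAnnulus C i → x ∈ closedAnnulus C j → ¬ i < j :=
    fun {i j} hi hj hij => hj.2 (interior_mono (hC.mono (by omega)) (hC.subset_interior _ hi.1))
  exact le_antisymm (not_lt.1 (h hj hi)) (not_lt.1 (h hi hj))

variable [SecondCountableTopology M]

/-- A function that is `1` near the traces of the walls and `0` away from the annuli. -/
lemma exists_wall_function (hC : IsTraceExhaustion Φ C) (hΦ : IsContactPath α Φ) :
    ∃ σ : M → ℝ, ContMDiff 𝓘(ℝ, E) 𝓘(ℝ, ℝ) ∞ σ ∧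
      (∀ j, ∀ x ∈ trace Φ (wall C j), ∀ᶠ y in 𝓝 x, σ y = 1) ∧
      ∀ j, ∀ x ∈ closedAnnulus C j, x ∉ openAnnulus C j → ∀ᶠ y in 𝓝 x, σ y = 0 := by
  have : LocallyCompactSpace M := ChartedSpace.locallyCompactSpace E M
  have hclosed : ∀ j, IsClosed (trace Φ (wall C j)) := fun j =>
    (isCompact_trace hΦ ((hC.isCompact _).of_isClosed_subset isClosed_frontier
      (hC.isCompact _).isClosed.frontier_subset)).isClosed
  have hlf : LocallyFinite fun j => trace Φ (wall C j) := by
    intro x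
    obtain ⟨n, hn⟩ := hC.exists_mem x
    refine ⟨interior (C (n + 1)), isOpen_interior.mem_nhds (hC.subset_interior n hn), ?_⟩
    refine (finite_le_nat n).subset ?_
    rintro j ⟨y, hy, hy'⟩
    exact hC.le_of_mem_closedAnnulus hy'
      (openAnnulus_subset_closedAnnulus j (hC.trace_wall_subset j hy))
  have hs : IsClosed (⋃ j, openAnnulus C j)ᶜ :=
    (isOpen_iUnion fun j => hC.isOpen_openAnnulus j).isClosed_compl
  have hd : Disjoint (⋃ j, openAnnulus C j)ᶜ (⋃ j, trace Φ (wall C j)) :=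
    disjoint_compl_left_iff_subset.2 (iUnion_mono hC.trace_wall_subset)
  obtain ⟨σ, h0, h1, -⟩ := exists_contMDiffMap_zero_one_nhds_of_isClosed 𝓘(ℝ, E) (n := ⊤) hs
    (hlf.isClosed_iUnion hclosed) hd
  refine ⟨σ, σ.contMDiff, fun j x hx => ?_, fun j x hx hx' => ?_⟩
  · exact eventually_nhdsSet_iff_forall.1 h1 x (mem_iUnion.2 ⟨j, hx⟩)
  · refine eventually_nhdsSet_iff_forall.1 h0 x fun h => ?_
    obtain ⟨i, hi⟩ := mem_iUnion.1 h
    exact hx' (hC.eq_of_mem_closedAnnulus (openAnnulus_subset_closedAnnulus i hi) hx ▸ hi)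

/-- A function that is large on the annuli. -/
lemma exists_depth_function (hC : IsTraceExhaustion Φ C) (b : ℕ → ℝ) :
    ∃ T : M → ℝ, ContMDiff 𝓘(ℝ, E) 𝓘(ℝ, ℝ) ∞ T ∧ (∀ x, 1 ≤ T x) ∧
      ∀ j, ∀ x ∈ closedAnnulus C j, b j ≤ T x := by
  have : LocallyCompactSpace M := ChartedSpace.locallyCompactSpace E M
  obtain ⟨T, hT⟩ := exists_contMDiffMap_forall_mem_convex_of_local_const 𝓘(ℝ, E) (n := ⊤)
    (t := fun x : M => {r : ℝ | 1 ≤ r ∧ ∀ j, x ∈ closedAnnulus C j → b j ≤ r})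
    (fun x r hr r' hr' u v hu hv huv => ⟨convex_Ici (𝕜 := ℝ) (1 : ℝ) hr.1 hr'.1 hu hv huv,
      fun j hj => convex_Ici (𝕜 := ℝ) (b j) (hr.2 j hj) (hr'.2 j hj) hu hv huv⟩)
    (fun x => by
      obtain ⟨n, hn⟩ := hC.exists_mem x
      refine ⟨1 + ∑ j ∈ Finset.range (n + 1), |b j|, ?_⟩
      filter_upwards [isOpen_interior.mem_nhds (hC.subset_interior n hn)] with y hy
      refine ⟨le_add_of_nonneg_right (Finset.sum_nonneg fun j _ => abs_nonneg _), fun j hj => ?_⟩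
      have h1 : |b j| ≤ ∑ j ∈ Finset.range (n + 1), |b j| :=
        Finset.single_le_sum (fun j _ => abs_nonneg (b j)) (Finset.mem_range.2
          (Nat.lt_succ_of_le (hC.le_of_mem_closedAnnulus hy hj)))
      linarith [le_abs_self (b j)])
  exact ⟨T, T.contMDiff, fun x => (hT x).1, fun j x hx => (hT x).2 j hx⟩

end IsTraceExhaustion

end Walls

/-! ### Functions of a real variable -/

section RealLemmas

/-- If a property is open along an interval, and holds at a point of the interval when it holds
closer to the base point, then it spreads from the base point to the interval. -/
lemma forall_mem_of_open_of_closer {J : Set ℝ} [hJ : J.OrdConnected] {Q : ℝ → Prop} {s₁ : ℝ}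
    (h₁ : s₁ ∈ J) (hQ₁ : Q s₁) (hopen : ∀ s ∈ J, Q s → ∀ᶠ r in nhds s, Q r)
    (hstep : ∀ s ∈ J, (∀ r ∈ uIcc s₁ s, r ≠ s → Q r) → s ≠ s₁ → Q s) : ∀ s ∈ J, Q s := by
  intro b hb
  by_contra hQb
  have hsub : uIcc s₁ b ⊆ J := hJ.uIcc_subset h₁ hb
  set B : Set ℝ := {s ∈ uIcc s₁ b | ¬ Q s} with hB
  have hBc : IsCompact B := by
    refine isCompact_uIcc.of_isClosed_subset ?_ (fun s hs => hs.1)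
    refine isClosed_iff_frequently.2 fun s hs => ?_
    have hs' : s ∈ uIcc s₁ b :=
      isClosed_iff_frequently.1 isClosed_Icc s (hs.mono fun r hr => hr.1)
    refine ⟨hs', fun hQ => ?_⟩
    obtain ⟨r, hr, hr'⟩ := (hs.and_eventually (hopen s (hsub hs') hQ)).exists
    exact hr.2 hr'
  obtain ⟨s, hs, hmin⟩ := hBc.exists_isMinOn ⟨b, right_mem_uIcc, hQb⟩
    (f := fun r => |r - s₁|) (by fun_prop)
  refine hs.2 (hstep s (hsub hs.1) (fun r hr hrs => ?_) (fun h => hs.2 (h ▸ hQ₁)))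
  by_contra hQr
  have h1 : |s - s₁| ≤ |r - s₁| := hmin ⟨uIcc_subset_uIcc_left hs.1 hr, hQr⟩
  rcases le_total s₁ s with h | h
  · rw [uIcc_of_le h] at hr
    rw [abs_of_nonneg (sub_nonneg.2 h), abs_of_nonneg (sub_nonneg.2 hr.1)] at h1
    exact hrs (le_antisymm hr.2 (by linarith))
  · rw [uIcc_of_ge h] at hr
    rw [abs_of_nonpos (sub_nonpos.2 h), abs_of_nonpos (sub_nonpos.2 hr.2)] at h1
    exact hrs (le_antisymm (by linarith) hr.1)

/-- A function with `|f'| ≤ B K'` varies by at most `B` times the variation of `K`. -/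
lemma abs_sub_le_mul_abs_sub {f f' K K' : ℝ → ℝ} {B a b : ℝ}
    (hf : ∀ s ∈ uIcc a b, HasDerivAt f (f' s) s) (hK : ∀ s ∈ uIcc a b, HasDerivAt K (K' s) s)
    (h : ∀ s ∈ uIcc a b, |f' s| ≤ B * K' s) : |f b - f a| ≤ |B * (K b - K a)| := by
  wlog hab : a ≤ b generalizing a b
  · rw [abs_sub_comm (f b), abs_mul, abs_sub_comm (K b), ← abs_mul]
    rw [uIcc_comm] at hf hK h
    exact this hf hK h (le_of_not_ge hab)
  rw [uIcc_of_le hab] at hf hK h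
  have hint : ∀ s ∈ interior (Icc a b), s ∈ Icc a b := fun s hs => interior_subset hs
  have h1 : MonotoneOn (fun s => B * K s - f s) (Icc a b) := by
    have hd : ∀ s ∈ Icc a b, HasDerivAt (fun s => B * K s - f s) (B * K' s - f' s) s :=
      fun s hs => ((hK s hs).const_mul B).sub (hf s hs)
    refine monotoneOn_of_deriv_nonneg (convex_Icc a b)
      (fun s hs => (hd s hs).continuousAt.continuousWithinAt)
      (fun s hs => (hd s (hint s hs)).differentiableAt.differentiableWithinAt) fun s hs => ?_
    rw [(hd s (hint s hs)).deriv]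
    linarith [(abs_le.1 (h s (hint s hs))).2]
  have h2 : MonotoneOn (fun s => B * K s + f s) (Icc a b) := by
    have hd : ∀ s ∈ Icc a b, HasDerivAt (fun s => B * K s + f s) (B * K' s + f' s) s :=
      fun s hs => ((hK s hs).const_mul B).add (hf s hs)
    refine monotoneOn_of_deriv_nonneg (convex_Icc a b)
      (fun s hs => (hd s hs).continuousAt.continuousWithinAt)
      (fun s hs => (hd s (hint s hs)).differentiableAt.differentiableWithinAt) fun s hs => ?_
    rw [(hd s (hint s hs)).deriv]
    linarith [(abs_le.1 (h s (hint s hs))).1]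
  have h3 := h1 (left_mem_Icc.2 hab) (right_mem_Icc.2 hab) hab
  have h4 := h2 (left_mem_Icc.2 hab) (right_mem_Icc.2 hab) hab
  simp only at h3 h4
  refine (abs_le.2 ⟨?_, ?_⟩).trans (le_abs_self _) <;> linarith

end RealLemmas

/-! ### The cutoff function and the height -/

section Cutoff

open Filter Topology

/-- A smooth step from `1`, for `t ≤ 0`, to `0`, for `t ≥ 1`. -/
noncomputable def heightCutoff (t : ℝ) : ℝ := Real.smoothTransition (1 - t)

lemma heightCutoff_eq_one {t : ℝ} (ht : t ≤ 0) : heightCutoff t = 1 :=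
  Real.smoothTransition.one_of_one_le (by linarith)

lemma heightCutoff_eq_zero {t : ℝ} (ht : 1 ≤ t) : heightCutoff t = 0 :=
  Real.smoothTransition.zero_of_nonpos (by linarith)

lemma abs_heightCutoff_le_one (t : ℝ) : |heightCutoff t| ≤ 1 := by
  unfold heightCutoff
  rw [abs_of_nonneg (Real.smoothTransition.nonneg _)]
  exact Real.smoothTransition.le_one _

lemma contDiff_heightCutoff : ContDiff ℝ ∞ heightCutoff :=
  (Real.smoothTransition.contDiff (n := ⊤)).comp (contDiff_const.sub contDiff_id)

variable {M : Type*} {σ T : M → ℝ}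

/-- The cutoff function on `ℝ × M`. It is `1` near the negative end and `0` near the positive end.
The transition occurs at the heights between `0` and `1` where `σ` is `1`, and at the heights
between `-T` and `1 - T` where `σ` is `0`. -/
noncomputable def endCutoff (σ T : M → ℝ) (p : ℝ × M) : ℝ :=
  σ p.2 * heightCutoff p.1 + (1 - σ p.2) * heightCutoff (p.1 + T p.2)

lemma contMDiff_endCutoff {E : Type*} [NormedAddCommGroup E] [NormedSpace ℝ E]
    [TopologicalSpace M] [ChartedSpace E M] (hσ : ContMDiff 𝓘(ℝ, E) 𝓘(ℝ, ℝ) ∞ σ)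
    (hT : ContMDiff 𝓘(ℝ, E) 𝓘(ℝ, ℝ) ∞ T) :
    ContMDiff (𝓘(ℝ, ℝ).prod 𝓘(ℝ, E)) 𝓘(ℝ, ℝ) ∞ (endCutoff σ T) := by
  have h := contDiff_heightCutoff.contMDiff
  have hσ' : ContMDiff (𝓘(ℝ, ℝ).prod 𝓘(ℝ, E)) 𝓘(ℝ, ℝ) ∞ (fun p : ℝ × M => σ p.2) :=
    hσ.comp contMDiff_snd
  have hT' : ContMDiff (𝓘(ℝ, ℝ).prod 𝓘(ℝ, E)) 𝓘(ℝ, ℝ) ∞ (fun p : ℝ × M => T p.2) :=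
    hT.comp contMDiff_snd
  exact (hσ'.mul (h.comp contMDiff_fst)).add
    ((contMDiff_const.sub hσ').mul (h.comp (contMDiff_fst.add hT')))

variable [TopologicalSpace M]

/-- Below height `0`, the cutoff is `1` where the wall function is. -/
lemma endCutoff_eventually_eq_one_of_wall {p : ℝ × M} (hp : p.1 < 0)
    (hσ : ∀ᶠ y in 𝓝 p.2, σ y = 1) : ∀ᶠ p' in 𝓝 p, endCutoff σ T p' = 1 := by
  filter_upwards [continuous_fst.continuousAt.eventually_lt continuousAt_const hp,
    continuous_snd.continuousAt.eventually hσ] with p' h1 h2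
  rw [endCutoff, h2, heightCutoff_eq_one h1.le]
  ring

lemma endCutoff_eventually_eq_one_of_deep {p : ℝ × M} (hT : Continuous T) (h1 : ∀ x, 1 ≤ T x)
    (hp : p.1 < - T p.2) : ∀ᶠ p' in 𝓝 p, endCutoff σ T p' = 1 := by
  have hc : Continuous fun p : ℝ × M => -T p.2 := (hT.comp continuous_snd).neg
  filter_upwards [continuous_fst.continuousAt.eventually_lt hc.continuousAt hp] with p' h
  rw [endCutoff, heightCutoff_eq_one (by linarith : p'.1 + T p'.2 ≤ 0),
    heightCutoff_eq_one (by linarith [h1 p'.2] : p'.1 ≤ 0)]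
  ring

lemma endCutoff_eventually_eq_zero_of_high {p : ℝ × M} (h1 : ∀ x, 1 ≤ T x)
    (hp : 1 < p.1) : ∀ᶠ p' in 𝓝 p, endCutoff σ T p' = 0 := by
  filter_upwards [continuousAt_const.eventually_lt continuous_fst.continuousAt hp] with p' h
  rw [endCutoff, heightCutoff_eq_zero (by linarith [h1 p'.2] : 1 ≤ p'.1 + T p'.2),
    heightCutoff_eq_zero h.le]
  ring

lemma endCutoff_eventually_eq_mul {p : ℝ × M} (hT : Continuous T) (hp : 1 < p.1 + T p.2) :
    ∀ᶠ p' in 𝓝 p, endCutoff σ T p' = σ p'.2 * heightCutoff p'.1 := by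
  have hc : Continuous fun p : ℝ × M => p.1 + T p.2 := continuous_fst.add (hT.comp continuous_snd)
  filter_upwards [continuousAt_const.eventually_lt hc.continuousAt hp] with p' h
  rw [endCutoff, heightCutoff_eq_zero h.le]
  ring

lemma endCutoff_eventually_eq_zero_of_not_wall {p : ℝ × M} (hT : Continuous T)
    (hp : 1 < p.1 + T p.2) (hσ : ∀ᶠ y in 𝓝 p.2, σ y = 0) :
    ∀ᶠ p' in 𝓝 p, endCutoff σ T p' = 0 := by
  filter_upwards [endCutoff_eventually_eq_mul (σ := σ) hT hp,
    continuous_snd.continuousAt.eventually hσ] with p' h1 h2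
  rw [h1, h2, zero_mul]

end Cutoff

section HeightVelocity

open Filter Topology

variable {E : Type*} [NormedAddCommGroup E] [NormedSpace ℝ E]
  {M : Type*} [TopologicalSpace M] [ChartedSpace E M] [IsManifold 𝓘(ℝ, E) ∞ M]
  {α : ∀ x : M, TangentSpace 𝓘(ℝ, E) x →L[ℝ] ℝ} {R : ∀ x : M, TangentSpace 𝓘(ℝ, E) x}

/-- The derivative of a time-dependent function in the direction of the Reeb field. -/
noncomputable def reebDerivative (R : ∀ x : M, TangentSpace 𝓘(ℝ, E) x) (g : ℝ × M → ℝ)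
    (q : ℝ × M) : ℝ :=
  differential (𝓘(ℝ, ℝ).prod 𝓘(ℝ, E)) g q (tpair 𝓘(ℝ, E) q 0 (R q.2))

lemma contMDiff_reebDerivative (hR : IsReebField α R) {g : ℝ × M → ℝ}
    (hg : ContMDiff (𝓘(ℝ, ℝ).prod 𝓘(ℝ, E)) 𝓘(ℝ, ℝ) ∞ g) :
    ContMDiff (𝓘(ℝ, ℝ).prod 𝓘(ℝ, E)) 𝓘(ℝ, ℝ) ∞ (reebDerivative R g) :=
  (isSmoothForm_differential hg).contMDiff_apply hR.smooth.tpair_snd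

lemma reebDerivative_eq_zero {g : ℝ × M → ℝ} {q : ℝ × M}
    (h : ∀ᶠ q' in 𝓝 q, g q' = 0) : reebDerivative R g q = 0 := by
  have h1 : mfderiv (𝓘(ℝ, ℝ).prod 𝓘(ℝ, E)) 𝓘(ℝ, ℝ) g q = 0 := by
    rw [EventuallyEq.mfderiv_eq (show g =ᶠ[𝓝 q] fun _ => 0 from h), mfderiv_const]
    rfl
  exact DFunLike.congr_fun h1 _

/-- The rate of change of the height `t` under the Hamiltonian flow of `-L`: for a function of the
form `L = e^t k` it is the derivative of `k` along the Reeb field. -/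
noncomputable def heightVelocity (R : ∀ x : M, TangentSpace 𝓘(ℝ, E) x) (L : ℝ × (ℝ × M) → ℝ)
    (q : ℝ × (ℝ × M)) : ℝ :=
  Real.exp (-q.2.1) * differential (𝓘(ℝ, ℝ).prod (𝓘(ℝ, ℝ).prod 𝓘(ℝ, E))) L q
    (tpair (𝓘(ℝ, ℝ).prod 𝓘(ℝ, E)) q 0 (tpair 𝓘(ℝ, E) q.2 0 (R q.2.2)))

lemma continuous_heightVelocity (hR : IsReebField α R) {L : ℝ × (ℝ × M) → ℝ}
    (hL : ContMDiff (𝓘(ℝ, ℝ).prod (𝓘(ℝ, ℝ).prod 𝓘(ℝ, E))) 𝓘(ℝ, ℝ) ∞ L) :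
    Continuous (heightVelocity R L) :=
  (Real.continuous_exp.comp (continuous_fst.comp continuous_snd).neg).mul
    ((isSmoothForm_differential hL).contMDiff_apply hR.smooth.tpair_snd.tpair_snd).continuous

/-- The height velocity for `L = e^t χ g`, where the cutoff `χ` depends on the height only. The
constant `c` shifts the cutoff, so that locally `χ = 1` is included. -/
lemma heightVelocity_eq {L : ℝ × (ℝ × M) → ℝ} {g : ℝ × M → ℝ}
    (hL : ContMDiff (𝓘(ℝ, ℝ).prod (𝓘(ℝ, ℝ).prod 𝓘(ℝ, E))) 𝓘(ℝ, ℝ) ∞ L)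
    (hg : ContMDiff (𝓘(ℝ, ℝ).prod 𝓘(ℝ, E)) 𝓘(ℝ, ℝ) ∞ g) (q : ℝ × (ℝ × M)) (c : ℝ)
    (h : ∀ᶠ p in 𝓝 q.2, L (q.1, p) = Real.exp p.1 * (heightCutoff (c + p.1) * g (q.1, p.2))) :
    heightVelocity R L q = heightCutoff (c + q.2.1) * reebDerivative R g (q.1, q.2.2) := by
  have hLd := hL.mdifferentiable (by simp) q
  have h1 := mfderiv_slice_right hLd (tpair 𝓘(ℝ, E) q.2 0 (R q.2.2))
  have hd : MDifferentiableAt (𝓘(ℝ, ℝ).prod 𝓘(ℝ, E)) 𝓘(ℝ, ℝ) (fun p => L (q.1, p)) q.2 :=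
    (hL.comp (contMDiff_const.prodMk contMDiff_id)).mdifferentiable (by simp) q.2
  have h2 := mfderiv_slice_right hd (R q.2.2)
  have h3 := mfderiv_slice_right (hg.mdifferentiable (by simp) (q.1, q.2.2)) (R q.2.2)
  have hev : (fun y => L (q.1, (q.2.1, y))) =ᶠ[𝓝 q.2.2]
      (Real.exp q.2.1 * heightCutoff (c + q.2.1)) • fun y => g (q.1, y) := by
    have hc : ContinuousAt (fun y : M => (q.2.1, y)) q.2.2 := by fun_prop
    filter_upwards [hc.eventually h] with y hy
    rw [hy]
    simp only [Pi.smul_apply, smul_eq_mul, mul_assoc]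
  have hgd : MDifferentiableAt 𝓘(ℝ, E) 𝓘(ℝ, ℝ) (fun y => g (q.1, y)) q.2.2 :=
    (hg.comp (contMDiff_const.prodMk contMDiff_id)).mdifferentiable (by simp) q.2.2
  have h4 := (hgd.hasMFDerivAt.const_smul (Real.exp q.2.1 * heightCutoff (c + q.2.1))).mfderiv
  have h5 := DFunLike.congr_fun (hev.mfderiv_eq.trans h4) (R q.2.2)
  have h6 : differential (𝓘(ℝ, ℝ).prod (𝓘(ℝ, ℝ).prod 𝓘(ℝ, E))) L q
      (tpair (𝓘(ℝ, ℝ).prod 𝓘(ℝ, E)) q 0 (tpair 𝓘(ℝ, E) q.2 0 (R q.2.2))) =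
      (Real.exp q.2.1 * heightCutoff (c + q.2.1)) * reebDerivative R g (q.1, q.2.2) :=
    h1.symm.trans (h2.symm.trans (h5.trans
      (congrArg (fun r : ℝ => (Real.exp q.2.1 * heightCutoff (c + q.2.1)) * r) h3)))
  rw [heightVelocity, h6, Real.exp_neg]
  field_simp

/-- The Hamiltonian field of `-L` changes the height at the rate `heightVelocity`. This is the
equation for the field, evaluated on the Reeb field. -/
lemma height_component_eq (hα : IsSmoothForm 𝓘(ℝ, E) α) (hR : IsReebField α R)
    {L : ℝ × (ℝ × M) → ℝ} {q : ℝ × (ℝ × M)} {Y : TangentSpace (𝓘(ℝ, ℝ).prod 𝓘(ℝ, E)) q.2}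
    (hY : ∀ w : TangentSpace (𝓘(ℝ, ℝ).prod 𝓘(ℝ, E)) q.2,
      extDerivOneForm (𝓘(ℝ, ℝ).prod 𝓘(ℝ, E)) (cylinderForm α) q.2 Y w =
        differential (𝓘(ℝ, ℝ).prod (𝓘(ℝ, ℝ).prod 𝓘(ℝ, E))) L q
          (tpair (𝓘(ℝ, ℝ).prod 𝓘(ℝ, E)) q 0 w)) :
    differential (𝓘(ℝ, ℝ).prod (𝓘(ℝ, ℝ).prod 𝓘(ℝ, E))) (fun q : ℝ × (ℝ × M) => q.2.1) q
      (tpair (𝓘(ℝ, ℝ).prod 𝓘(ℝ, E)) q 1 Y) = heightVelocity R L q := by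
  obtain ⟨a, w, rfl⟩ := exists_eq_tpair Y
  have h1 := hY (tpair 𝓘(ℝ, E) q.2 0 (R q.2.2))
  rw [extDerivOneForm_cylinderForm hα, hR.apply_eq_one, hR.extDeriv_eq_zero] at h1
  have h2 : differential (𝓘(ℝ, ℝ).prod (𝓘(ℝ, ℝ).prod 𝓘(ℝ, E))) (fun q : ℝ × (ℝ × M) => q.2.1) q
      (tpair (𝓘(ℝ, ℝ).prod 𝓘(ℝ, E)) q 1 (tpair 𝓘(ℝ, E) q.2 a w)) = a := by
    refine (differential_comp (f := Prod.fst) (F := Prod.snd) mdifferentiableAt_fst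
      mdifferentiableAt_snd _).trans ?_
    refine (congrArg (differential (𝓘(ℝ, ℝ).prod 𝓘(ℝ, E)) (Prod.fst : ℝ × M → ℝ) q.2)
      (mfderiv_snd_tpair _ _ _)).trans ?_
    exact mfderiv_fst_tpair _ _ _
  rw [h2, heightVelocity, ← h1, Real.exp_neg]
  field_simp
  ring

end HeightVelocity

/-! ### The cut-off Hamiltonian field -/

section CutoffFlow

open Filter Topology

variable {E : Type*} [NormedAddCommGroup E] [NormedSpace ℝ E] [FiniteDimensional ℝ E]
  {M : Type*} [TopologicalSpace M] [ChartedSpace E M] [IsManifold 𝓘(ℝ, E) ∞ M]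
  {α : ∀ x : M, TangentSpace 𝓘(ℝ, E) x →L[ℝ] ℝ} {R : ∀ x : M, TangentSpace 𝓘(ℝ, E) x}
  {Φ : ℝ → M ≃ₘ^∞⟮𝓘(ℝ, E), 𝓘(ℝ, E)⟯ M} {C : ℕ → Set M} {σ T : M → ℝ}
  {Y : ∀ q : ℝ × (ℝ × M), TangentSpace (𝓘(ℝ, ℝ).prod 𝓘(ℝ, E)) q.2}

/-- The Hamiltonian of the lifts, cut off near the positive end. -/
noncomputable def cutHamiltonian (α : ∀ x : M, TangentSpace 𝓘(ℝ, E) x →L[ℝ] ℝ)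
    (R : ∀ x : M, TangentSpace 𝓘(ℝ, E) x) (Φ : ℝ → M ≃ₘ^∞⟮𝓘(ℝ, E), 𝓘(ℝ, E)⟯ M) (σ T : M → ℝ)
    (q : ℝ × (ℝ × M)) : ℝ :=
  endCutoff σ T q.2 * liftHamiltonian α R Φ q

/-- The contact Hamiltonian, cut off away from the walls. -/
noncomputable def wallHamiltonian (α : ∀ x : M, TangentSpace 𝓘(ℝ, E) x →L[ℝ] ℝ)
    (R : ∀ x : M, TangentSpace 𝓘(ℝ, E) x) (Φ : ℝ → M ≃ₘ^∞⟮𝓘(ℝ, E), 𝓘(ℝ, E)⟯ M) (σ : M → ℝ)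
    (q : ℝ × M) : ℝ :=
  σ q.2 * contactHamiltonian α R Φ q

/-- The data of a cut-off flow: the wall function `σ`, the depth function `T`, and the Hamiltonian
field `Y` of minus the cut-off Hamiltonian. In `depth_large`, the speed at which the field changes
the height over an annulus at time `s` is at most `B` times the derivative of `2 arctan s`; as the
total variation of this function is `2 π < 7`, the height changes by at most `7 B`, and the depth of
the annulus is larger. -/
structure IsCutoffField (α : ∀ x : M, TangentSpace 𝓘(ℝ, E) x →L[ℝ] ℝ)
    (R : ∀ x : M, TangentSpace 𝓘(ℝ, E) x) (Φ : ℝ → M ≃ₘ^∞⟮𝓘(ℝ, E), 𝓘(ℝ, E)⟯ M) (C : ℕ → Set M)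
    (σ T : M → ℝ) (Y : ∀ q : ℝ × (ℝ × M), TangentSpace (𝓘(ℝ, ℝ).prod 𝓘(ℝ, E)) q.2) : Prop where
  form : IsContactForm α
  reeb : IsReebField α R
  path : IsContactPath α Φ
  exhaustion : IsTraceExhaustion Φ C
  smooth_wall : ContMDiff 𝓘(ℝ, E) 𝓘(ℝ, ℝ) ∞ σ
  smooth_depth : ContMDiff 𝓘(ℝ, E) 𝓘(ℝ, ℝ) ∞ T
  wall_eq_one : ∀ j, ∀ x ∈ trace Φ (wall C j), ∀ᶠ y in 𝓝 x, σ y = 1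
  wall_eq_zero : ∀ j, ∀ x ∈ closedAnnulus C j, x ∉ openAnnulus C j → ∀ᶠ y in 𝓝 x, σ y = 0
  one_le_depth : ∀ x, 1 ≤ T x
  depth_large : ∀ j, ∃ B, 0 ≤ B ∧ (∀ s, ∀ x ∈ C (4 * j + 3),
    |reebDerivative R (wallHamiltonian α R Φ σ) (s, x)| ≤ B * (2 / (1 + s ^ 2))) ∧
    ∀ x ∈ closedAnnulus C j, 7 * B + 3 ≤ T x
  hamiltonian : ∀ (q : ℝ × (ℝ × M)) (w : TangentSpace (𝓘(ℝ, ℝ).prod 𝓘(ℝ, E)) q.2),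
    extDerivOneForm (𝓘(ℝ, ℝ).prod 𝓘(ℝ, E)) (cylinderForm α) q.2 (Y q) w =
      differential (𝓘(ℝ, ℝ).prod (𝓘(ℝ, ℝ).prod 𝓘(ℝ, E))) (cutHamiltonian α R Φ σ T) q
        (tpair (𝓘(ℝ, ℝ).prod 𝓘(ℝ, E)) q 0 w)
  smooth_field : IsSmoothVectorField (𝓘(ℝ, ℝ).prod (𝓘(ℝ, ℝ).prod 𝓘(ℝ, E)))
    (fun q : ℝ × (ℝ × M) => tpair (𝓘(ℝ, ℝ).prod 𝓘(ℝ, E)) q 1 (Y q))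

lemma contMDiff_wallHamiltonian (hα : IsSmoothForm 𝓘(ℝ, E) α) (hR : IsReebField α R)
    (hΦ : IsContactPath α Φ) (hσ : ContMDiff 𝓘(ℝ, E) 𝓘(ℝ, ℝ) ∞ σ) :
    ContMDiff (𝓘(ℝ, ℝ).prod 𝓘(ℝ, E)) 𝓘(ℝ, ℝ) ∞ (wallHamiltonian α R Φ σ) :=
  (hσ.comp contMDiff_snd).mul (contMDiff_contactHamiltonian hα hR hΦ)

lemma contMDiff_cutHamiltonian (hα : IsSmoothForm 𝓘(ℝ, E) α) (hR : IsReebField α R)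
    (hΦ : IsContactPath α Φ) (hσ : ContMDiff 𝓘(ℝ, E) 𝓘(ℝ, ℝ) ∞ σ)
    (hT : ContMDiff 𝓘(ℝ, E) 𝓘(ℝ, ℝ) ∞ T) :
    ContMDiff (𝓘(ℝ, ℝ).prod (𝓘(ℝ, ℝ).prod 𝓘(ℝ, E))) 𝓘(ℝ, ℝ) ∞ (cutHamiltonian α R Φ σ T) :=
  ((contMDiff_endCutoff hσ hT).comp contMDiff_snd).mul (contMDiff_liftHamiltonian hα hR hΦ)

/-- There is a speed bound as in `IsCutoffField.depth_large`. The factor `2 / (1 + s ^ 2)` has a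
finite integral, and is at least `1` while the path moves. -/
lemma exists_speed_bound (hα : IsSmoothForm 𝓘(ℝ, E) α) (hR : IsReebField α R)
    (hΦ : IsContactPath α Φ) (hσ : ContMDiff 𝓘(ℝ, E) 𝓘(ℝ, ℝ) ∞ σ) {K : Set M} (hK : IsCompact K) :
    ∃ B, 0 ≤ B ∧ ∀ s, ∀ x ∈ K,
      |reebDerivative R (wallHamiltonian α R Φ σ) (s, x)| ≤ B * (2 / (1 + s ^ 2)) := by
  obtain ⟨B, hB⟩ := ((isCompact_Icc (a := (0 : ℝ)) (b := 1)).prod hK).exists_bound_of_continuousOn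
    (contMDiff_reebDerivative hR (contMDiff_wallHamiltonian hα hR hΦ hσ)).continuous.continuousOn
  refine ⟨|B|, abs_nonneg B, fun s x hx => ?_⟩
  by_cases hs : s ∈ Icc (0 : ℝ) 1
  · have h1 : |reebDerivative R (wallHamiltonian α R Φ σ) (s, x)| ≤ |B| :=
      (hB (s, x) ⟨hs, hx⟩).trans (le_abs_self B)
    have h2 : 1 ≤ 2 / (1 + s ^ 2) := by
      rw [le_div_iff₀ (by positivity)]
      nlinarith [hs.1, hs.2]
    nlinarith [abs_nonneg B]
  · have h1 : ∀ᶠ q in 𝓝 (s, x), wallHamiltonian α R Φ σ q = 0 := by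
      have h2 : ∀ᶠ q : ℝ × M in 𝓝 (s, x), q.1 < 0 ∨ 1 < q.1 := by
        have h3 : s < 0 ∨ 1 < s := by
          by_contra! h
          exact hs h
        have ho : IsOpen {q : ℝ × M | q.1 < 0 ∨ 1 < q.1} :=
          (isOpen_lt continuous_fst continuous_const).union
            (isOpen_lt continuous_const continuous_fst)
        exact ho.mem_nhds h3
      filter_upwards [h2] with q hq
      rw [wallHamiltonian, contactHamiltonian_eq_zero hΦ hq, mul_zero]
    rw [reebDerivative_eq_zero h1, abs_zero]
    positivity

lemma exists_isCutoffField [T2Space M] [SecondCountableTopology M] (hα : IsContactForm α)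
    (hR : IsReebField α R) (hΦ : IsContactPath α Φ) :
    ∃ C σ T Y, IsCutoffField α R Φ C σ T Y := by
  have hα' := hα.smooth.isSmoothForm
  obtain ⟨C, hC⟩ := exists_isTraceExhaustion hΦ
  obtain ⟨σ, hσ, h1, h0⟩ := hC.exists_wall_function hΦ
  choose B hB hBr using fun j => exists_speed_bound hα' hR hΦ hσ (hC.isCompact (4 * j + 3))
  obtain ⟨T, hT, hT1, hTB⟩ := hC.exists_depth_function (fun j => 7 * B j + 3)
  have hL := contMDiff_cutHamiltonian hα' hR hΦ hσ hT
  obtain ⟨Y, hY, hYs⟩ := exists_hamiltonianField (isSmoothForm_cylinderForm hα')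
    hα.isNondegenerateForm hL.neg
  refine ⟨C, σ, T, Y, hα, hR, hΦ, hC, hσ, hT, h1, h0, hT1, fun j => ⟨B j, hB j, hBr j, hTB j⟩,
    fun q w => (hY q w).trans ?_, hYs⟩
  have h2 := differential_neg (I := 𝓘(ℝ, ℝ).prod (𝓘(ℝ, ℝ).prod 𝓘(ℝ, E)))
    (cutHamiltonian α R Φ σ T) q (tpair (𝓘(ℝ, ℝ).prod 𝓘(ℝ, E)) q 0 w)
  exact (congrArg Neg.neg h2).trans (neg_neg _)

namespace IsCutoffField

lemma contMDiff_hamiltonian (H : IsCutoffField α R Φ C σ T Y) :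
    ContMDiff (𝓘(ℝ, ℝ).prod (𝓘(ℝ, ℝ).prod 𝓘(ℝ, E))) 𝓘(ℝ, ℝ) ∞ (cutHamiltonian α R Φ σ T) :=
  contMDiff_cutHamiltonian H.form.smooth.isSmoothForm H.reeb H.path H.smooth_wall H.smooth_depth

/-- The field vanishes where the cutoff does. -/
lemma field_eq_zero (H : IsCutoffField α R Φ C σ T Y) {q : ℝ × (ℝ × M)}
    (hq : ∀ᶠ p in 𝓝 q.2, endCutoff σ T p = 0) : Y q = 0 := by
  refine H.form.isNondegenerateForm q.2 (Y q) fun w => ?_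
  rw [H.hamiltonian]
  have h1 : cutHamiltonian α R Φ σ T =ᶠ[𝓝 q] fun _ => 0 := by
    filter_upwards [continuous_snd.continuousAt.eventually hq] with q' h
    rw [cutHamiltonian, h, zero_mul]
  have h2 : mfderiv (𝓘(ℝ, ℝ).prod (𝓘(ℝ, ℝ).prod 𝓘(ℝ, E))) 𝓘(ℝ, ℝ)
      (cutHamiltonian α R Φ σ T) q = 0 := by
    rw [h1.mfderiv_eq, mfderiv_const]
    rfl
  exact DFunLike.congr_fun h2 _

/-- Where the cutoff is `1`, the field moves the points in such a way that their images under the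
lifts are stationary. -/
lemma mfderiv_liftMap_field (H : IsCutoffField α R Φ C σ T Y) {q : ℝ × (ℝ × M)}
    (hq : ∀ᶠ p in 𝓝 q.2, endCutoff σ T p = 1) :
    mfderiv (𝓘(ℝ, ℝ).prod (𝓘(ℝ, ℝ).prod 𝓘(ℝ, E))) (𝓘(ℝ, ℝ).prod 𝓘(ℝ, E)) (liftMap α R Φ) q
      (tpair (𝓘(ℝ, ℝ).prod 𝓘(ℝ, E)) q 1 (Y q)) = 0 := by
  refine mfderiv_liftMap_eq_zero H.form H.reeb H.path q fun w => (H.hamiltonian q w).trans ?_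
  have h1 : cutHamiltonian α R Φ σ T =ᶠ[𝓝 q] liftHamiltonian α R Φ := by
    filter_upwards [continuous_snd.continuousAt.eventually hq] with q' h
    rw [cutHamiltonian, h, one_mul]
  exact DFunLike.congr_fun h1.mfderiv_eq _

variable {γ : ℝ → ℝ × (ℝ × M)} {a b s₁ : ℝ}

/-- Where the cutoff vanishes, the integral curves only move in time. -/
lemma snd_eq_of_cutoff_eq_zero [T2Space M] (H : IsCutoffField α R Φ C σ T Y)
    (hγ : IsMIntegralCurveOn γ (fun q => tpair (𝓘(ℝ, ℝ).prod 𝓘(ℝ, E)) q 1 (Y q)) (Ioo a b))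
    (hs₁ : s₁ ∈ Ioo a b) (h0 : ∀ᶠ p in 𝓝 (γ s₁).2, endCutoff σ T p = 0) :
    ∀ s ∈ Ioo a b, (γ s).2 = (γ s₁).2 := by
  have hc : IsMIntegralCurve (fun s : ℝ => (s, (γ s₁).2))
      (fun q => tpair (𝓘(ℝ, ℝ).prod 𝓘(ℝ, E)) q 1 (Y q)) := by
    intro s
    have h1 := hasMFDerivAt_slice_left (I := 𝓘(ℝ, ℝ).prod 𝓘(ℝ, E))
      (J := 𝓘(ℝ, ℝ).prod (𝓘(ℝ, ℝ).prod 𝓘(ℝ, E))) (F := fun q : ℝ × (ℝ × M) => q)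
      (q := (s, (γ s₁).2)) mdifferentiableAt_id
    have h2 : Y (s, (γ s₁).2) = 0 := H.field_eq_zero h0
    have h3 : ∀ u : TangentSpace (𝓘(ℝ, ℝ).prod (𝓘(ℝ, ℝ).prod 𝓘(ℝ, E))) (s, (γ s₁).2),
        mfderiv (𝓘(ℝ, ℝ).prod (𝓘(ℝ, ℝ).prod 𝓘(ℝ, E))) (𝓘(ℝ, ℝ).prod (𝓘(ℝ, ℝ).prod 𝓘(ℝ, E)))
          (fun q : ℝ × (ℝ × M) => q) (s, (γ s₁).2)
          (tpair (𝓘(ℝ, ℝ).prod 𝓘(ℝ, E)) (s, (γ s₁).2) 1 0) = u →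
        HasMFDerivAt 𝓘(ℝ, ℝ) (𝓘(ℝ, ℝ).prod (𝓘(ℝ, ℝ).prod 𝓘(ℝ, E)))
          (fun s : ℝ => (s, (γ s₁).2)) s ((1 : ℝ →L[ℝ] ℝ).smulRight u) := by
      rintro _ rfl
      exact h1
    refine h3 _ ?_
    refine (DFunLike.congr_fun mfderiv_id _).trans ?_
    exact congrArg (tpair (𝓘(ℝ, ℝ).prod 𝓘(ℝ, E)) (s, (γ s₁).2) 1) h2.symm
  have h3 := (hc.comp_add ((γ s₁).1 - s₁)).isMIntegralCurveOn (Ioo a b)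
  have : IsManifold (𝓘(ℝ, ℝ).prod (𝓘(ℝ, ℝ).prod 𝓘(ℝ, E))) 1 (ℝ × (ℝ × M)) :=
    IsManifold.of_le (n := ∞) (by simp)
  have h4 := isMIntegralCurveOn_Ioo_eqOn_of_contMDiff_boundaryless hs₁
    (H.smooth_field.contMDiff.of_le (by simp)) hγ h3
    (by simp only [Function.comp, add_sub_cancel, Prod.mk.eta])
  intro s hs
  rw [h4 hs]
  rfl

/-- If the cutoff is `1` wherever an integral curve keeps its image under the lifts, then the
integral curve keeps this image. -/
lemma liftMap_eq_of_cutoff_eq_one [T2Space M] (H : IsCutoffField α R Φ C σ T Y)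
    (hγ : IsMIntegralCurveOn γ (fun q => tpair (𝓘(ℝ, ℝ).prod 𝓘(ℝ, E)) q 1 (Y q)) (Ioo a b))
    (hs₁ : s₁ ∈ Ioo a b)
    (h1 : ∀ s ∈ Ioo a b, liftMap α R Φ (γ s) = liftMap α R Φ (γ s₁) →
      ∀ᶠ p in 𝓝 (γ s).2, endCutoff σ T p = 1) :
    ∀ s ∈ Ioo a b, liftMap α R Φ (γ s) = liftMap α R Φ (γ s₁) := by
  have hP := contMDiff_liftMap H.form.smooth.isSmoothForm H.reeb H.path
  have hcont : ∀ s ∈ Ioo a b, ContinuousAt γ s := fun s hs =>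
    hγ.continuousOn.continuousAt (isOpen_Ioo.mem_nhds hs)
  have : IsManifold (𝓘(ℝ, ℝ).prod 𝓘(ℝ, E)) 1 (ℝ × M) := IsManifold.of_le (n := ∞) (by simp)
  -- the set of times at which the image is the given one is open and closed in `Ioo a b`
  let u : Set ℝ := {s | s ∈ Ioo a b ∧ liftMap α R Φ (γ s) = liftMap α R Φ (γ s₁)}
  have hopen : IsOpen u := by
    rw [isOpen_iff_mem_nhds]
    rintro s ⟨hs, hsu⟩
    have h2 : IsMIntegralCurveAt (fun s => liftMap α R Φ (γ s))
        (fun p : ℝ × M => (0 : TangentSpace (𝓘(ℝ, ℝ).prod 𝓘(ℝ, E)) p)) s := by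
      have h3 := (continuous_snd.continuousAt.comp (hcont s hs)).eventually
        (eventually_eventually_nhds.2 (h1 s hs hsu))
      filter_upwards [h3, isOpen_Ioo.mem_nhds hs] with r hr hr'
      have h4 := hγ.hasMFDerivAt_comp (isOpen_Ioo.mem_nhds hr') (f := liftMap α R Φ)
        (hP.mdifferentiable (by simp) _)
      have h5 := H.mfderiv_liftMap_field hr
      rw [h5] at h4
      exact h4
    have h6 := isMIntegralCurveAt_eventuallyEq_of_contMDiffAt_boundaryless
      (γ' := fun _ => liftMap α R Φ (γ s₁))
      ((contMDiff_zeroSection ℝ (TangentSpace (𝓘(ℝ, ℝ).prod 𝓘(ℝ, E)) : ℝ × M → Type _)) _)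
      h2 (isMIntegralCurve_const rfl |>.isMIntegralCurveAt s) hsu
    filter_upwards [h6, isOpen_Ioo.mem_nhds hs] with r hr hr'
    exact ⟨hr', hr⟩
  have hsub := isPreconnected_Ioo.subset_of_closure_inter_subset hopen ⟨s₁, hs₁, hs₁, rfl⟩
    (by
      rintro s ⟨hsc, hs⟩
      refine ⟨hs, ?_⟩
      have h2 : ContinuousWithinAt (fun s => liftMap α R Φ (γ s)) u s :=
        (hP.continuous.continuousAt.comp (hcont s hs)).continuousWithinAt
      have h3 := h2.mem_closure_image hsc
      have h4 : (fun s => liftMap α R Φ (γ s)) '' u ⊆ {liftMap α R Φ (γ s₁)} := by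
        rintro _ ⟨r, hr, rfl⟩
        exact hr.2
      exact (closure_minimal h4 isClosed_singleton) h3)
  exact fun s hs => (hsub hs).2

end IsCutoffField

end CutoffFlow

/-! ### Completeness of the cut-off flow -/

section Trap

open Filter Topology

lemma mem_closure_uIcc_diff {s₁ s : ℝ} (h : s ≠ s₁) : s ∈ closure (uIcc s₁ s \ {s}) := by
  rcases lt_or_gt_of_ne h with h | h
  · rw [uIcc_of_ge h.le, Icc_sdiff_left, closure_Ioc h.ne]
    exact left_mem_Icc.2 h.le
  · rw [uIcc_of_le h.le, Icc_sdiff_right, closure_Ico h.ne]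
    exact right_mem_Icc.2 h.le

/-- A preconnected set that meets a closed set, but not its frontier, is contained in it. -/
lemma IsPreconnected.subset_of_disjoint_frontier {X : Type*} [TopologicalSpace X] {s K : Set X}
    (hs : IsPreconnected s) (hK : IsClosed K) (h : (s ∩ K).Nonempty)
    (hd : ∀ x ∈ s, x ∉ frontier K) : s ⊆ K := by
  have hint : ∀ x ∈ s, x ∈ K → x ∈ interior K := fun x hx hxK => by
    by_contra h'
    exact hd x hx ⟨subset_closure hxK, h'⟩
  obtain ⟨x, hx, hxK⟩ := h
  refine (hs.subset_of_closure_inter_subset isOpen_interior ⟨x, hx, hint x hx hxK⟩ ?_).trans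
    interior_subset
  rintro y ⟨hy, hys⟩
  exact hint y hys (closure_minimal interior_subset hK hy)

variable {E : Type*} [NormedAddCommGroup E] [NormedSpace ℝ E] [FiniteDimensional ℝ E]
  {M : Type*} [TopologicalSpace M] [ChartedSpace E M] [IsManifold 𝓘(ℝ, E) ∞ M]
  {α : ∀ x : M, TangentSpace 𝓘(ℝ, E) x →L[ℝ] ℝ} {R : ∀ x : M, TangentSpace 𝓘(ℝ, E) x}
  {Φ : ℝ → M ≃ₘ^∞⟮𝓘(ℝ, E), 𝓘(ℝ, E)⟯ M} {C : ℕ → Set M} {σ T : M → ℝ}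
  {Y : ∀ q : ℝ × (ℝ × M), TangentSpace (𝓘(ℝ, ℝ).prod 𝓘(ℝ, E)) q.2}
  {γ : ℝ → ℝ × (ℝ × M)} {a b s₁ : ℝ}

namespace IsCutoffField

lemma hasDerivAt_height (H : IsCutoffField α R Φ C σ T Y)
    (hγ : IsMIntegralCurveOn γ (fun q => tpair (𝓘(ℝ, ℝ).prod 𝓘(ℝ, E)) q 1 (Y q)) (Ioo a b))
    {s : ℝ} (hs : s ∈ Ioo a b) :
    HasDerivAt (fun s => (γ s).2.1) (heightVelocity R (cutHamiltonian α R Φ σ T) (γ s)) s := by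
  have h1 := hγ.hasDerivAt_comp (isOpen_Ioo.mem_nhds hs) (f := fun q : ℝ × (ℝ × M) => q.2.1)
    (mdifferentiableAt_fst.comp (γ s) mdifferentiableAt_snd)
  have h2 := height_component_eq H.form.smooth.isSmoothForm H.reeb (H.hamiltonian (γ s))
  rw [h2] at h1
  exact h1

lemma hasDerivAt_time
    (hγ : IsMIntegralCurveOn γ (fun q => tpair (𝓘(ℝ, ℝ).prod 𝓘(ℝ, E)) q 1 (Y q)) (Ioo a b))
    {s : ℝ} (hs : s ∈ Ioo a b) : HasDerivAt (fun s => (γ s).1) 1 s := by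
  have h1 := hγ.hasDerivAt_comp (isOpen_Ioo.mem_nhds hs) (f := Prod.fst) mdifferentiableAt_fst
  have h2 : differential (𝓘(ℝ, ℝ).prod (𝓘(ℝ, ℝ).prod 𝓘(ℝ, E)))
      (Prod.fst : ℝ × (ℝ × M) → ℝ) (γ s)
      (tpair (𝓘(ℝ, ℝ).prod 𝓘(ℝ, E)) (γ s) 1 (Y (γ s))) = 1 := mfderiv_fst_tpair _ _ _
  rw [h2] at h1
  exact h1

/-- Above the lower transition, only the cut-off contact Hamiltonian `σ h` moves the height. -/
lemma heightVelocity_of_not_deep (H : IsCutoffField α R Φ C σ T Y) {q : ℝ × (ℝ × M)}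
    (hq : 1 < q.2.1 + T q.2.2) :
    heightVelocity R (cutHamiltonian α R Φ σ T) q =
      heightCutoff q.2.1 * reebDerivative R (wallHamiltonian α R Φ σ) (q.1, q.2.2) := by
  have h := heightVelocity_eq (R := R) H.contMDiff_hamiltonian (contMDiff_wallHamiltonian
    H.form.smooth.isSmoothForm H.reeb H.path H.smooth_wall) q 0 (by
      filter_upwards [endCutoff_eventually_eq_mul (σ := σ) H.smooth_depth.continuous hq] with p hp
      rw [cutHamiltonian, liftHamiltonian, wallHamiltonian, hp, zero_add]
      ring)
  rwa [zero_add] at h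

lemma heightVelocity_of_deep (H : IsCutoffField α R Φ C σ T Y) {q : ℝ × (ℝ × M)}
    (hq : q.2.1 < - T q.2.2) :
    heightVelocity R (cutHamiltonian α R Φ σ T) q =
      reebDerivative R (contactHamiltonian α R Φ) (q.1, q.2.2) := by
  have h := heightVelocity_eq (R := R) H.contMDiff_hamiltonian (contMDiff_contactHamiltonian
    H.form.smooth.isSmoothForm H.reeb H.path) q (-q.2.1 - 1) (by
      filter_upwards [endCutoff_eventually_eq_one_of_deep (σ := σ) H.smooth_depth.continuous
        H.one_le_depth hq, continuous_fst.continuousAt.eventually_lt continuousAt_const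
        (lt_add_one q.2.1)] with p hp hp'
      rw [cutHamiltonian, liftHamiltonian, hp, heightCutoff_eq_one (by linarith)]
      simp only [one_mul])
  rw [h, heightCutoff_eq_one (by linarith), one_mul]

lemma heightVelocity_of_high (H : IsCutoffField α R Φ C σ T Y) {q : ℝ × (ℝ × M)}
    (hq : 1 < q.2.1) : heightVelocity R (cutHamiltonian α R Φ σ T) q = 0 := by
  have h := H.heightVelocity_of_not_deep (q := q) (by linarith [H.one_le_depth q.2.2])
  rw [h, heightCutoff_eq_zero hq.le, zero_mul]

/-- The height moves with bounded speed over a compact set, since it does not move near the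
positive end, and moves with a speed that does not depend on the height near the negative end. -/
lemma exists_heightVelocity_bound (H : IsCutoffField α R Φ C σ T Y) (c : ℝ) {K : Set M}
    (hK : IsCompact K) : ∃ A, 0 ≤ A ∧ ∀ q : ℝ × (ℝ × M), |q.1| ≤ c → q.2.2 ∈ K →
      |heightVelocity R (cutHamiltonian α R Φ σ T) q| ≤ A := by
  obtain ⟨τ, hτ⟩ := hK.bddAbove_image H.smooth_depth.continuous.continuousOn
  obtain ⟨A₁, hA₁⟩ := ((isCompact_Icc (a := -c) (b := c)).prod
    ((isCompact_Icc (a := -τ) (b := 1)).prod hK)).exists_bound_of_continuousOn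
    (continuous_heightVelocity H.reeb H.contMDiff_hamiltonian).continuousOn
  obtain ⟨A₂, hA₂⟩ := ((isCompact_Icc (a := -c) (b := c)).prod hK).exists_bound_of_continuousOn
    (contMDiff_reebDerivative H.reeb (contMDiff_contactHamiltonian H.form.smooth.isSmoothForm
      H.reeb H.path)).continuous.continuousOn
  refine ⟨|A₁| + |A₂|, by positivity, fun q hq hqK => ?_⟩
  have hq' : q.1 ∈ Icc (-c) c := abs_le.1 hq
  have hT : T q.2.2 ≤ τ := hτ ⟨_, hqK, rfl⟩
  rcases lt_or_ge 1 q.2.1 with h1 | h1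
  · rw [H.heightVelocity_of_high h1, abs_zero]
    positivity
  rcases lt_or_ge q.2.1 (-T q.2.2) with h2 | h2
  · rw [H.heightVelocity_of_deep h2]
    refine (hA₂ (q.1, q.2.2) ⟨hq', hqK⟩).trans ((le_abs_self _).trans ?_)
    exact le_add_of_nonneg_left (abs_nonneg _)
  · refine (hA₁ q ⟨hq', ⟨by linarith, h1⟩, hqK⟩).trans ((le_abs_self _).trans ?_)
    exact le_add_of_nonneg_right (abs_nonneg _)

variable [T2Space M]

/-- An integral curve that passes over an open annulus at a nonnegative height stays over this
annulus: it cannot descend to the depth where it could leave the annulus, because over the annulus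
and above the depth `- (7 B) - 1` the height has bounded variation. -/
lemma mem_openAnnulus_of_nonneg (H : IsCutoffField α R Φ C σ T Y)
    (hγ : IsMIntegralCurveOn γ (fun q => tpair (𝓘(ℝ, ℝ).prod 𝓘(ℝ, E)) q 1 (Y q)) (Ioo a b))
    (hs₁ : s₁ ∈ Ioo a b) {j : ℕ} (hj : (γ s₁).2.2 ∈ openAnnulus C j) (ht : 0 ≤ (γ s₁).2.1) :
    ∀ s ∈ Ioo a b, (γ s).2.2 ∈ openAnnulus C j := by
  obtain ⟨B, hB, hspeed, hdepth⟩ := H.depth_large j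
  have hcont : ∀ s ∈ Ioo a b, ContinuousAt γ s := fun s hs =>
    hγ.continuousOn.continuousAt (isOpen_Ioo.mem_nhds hs)
  have hZo : IsOpen {q : ℝ × (ℝ × M) | q.2.2 ∈ openAnnulus C j ∧ -(7 * B) - 1 < q.2.1} :=
    ((H.exhaustion.isOpen_openAnnulus j).preimage (continuous_snd.comp continuous_snd)).inter
      (isOpen_lt continuous_const (continuous_fst.comp continuous_snd))
  have hZc : IsClosed {q : ℝ × (ℝ × M) | q.2.2 ∈ closedAnnulus C j ∧ -(7 * B) - 1 ≤ q.2.1} :=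
    ((H.exhaustion.isClosed_closedAnnulus j).preimage (continuous_snd.comp continuous_snd)).inter
      (isClosed_le continuous_const (continuous_fst.comp continuous_snd))
  suffices hQ : ∀ s ∈ Ioo a b, (γ s).2.2 ∈ openAnnulus C j ∧ -(7 * B) - 1 < (γ s).2.1 from
    fun s hs => (hQ s hs).1
  refine forall_mem_of_open_of_closer hs₁ ⟨hj, by linarith⟩
    (fun s hs hQ => (hcont s hs).eventually (hZo.mem_nhds hQ)) fun s hs hr hne => ?_
  have hsub : uIcc s₁ s ⊆ Ioo a b := ordConnected_Ioo.uIcc_subset hs₁ hs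
  -- up to the time `s`, the curve stays in the closure of the region
  have hclosed : ∀ r ∈ uIcc s₁ s,
      (γ r).2.2 ∈ closedAnnulus C j ∧ -(7 * B) - 1 ≤ (γ r).2.1 := by
    have h1 : ∀ r ∈ uIcc s₁ s, r ≠ s →
        (γ r).2.2 ∈ closedAnnulus C j ∧ -(7 * B) - 1 ≤ (γ r).2.1 := fun r hr' hrs =>
      ⟨openAnnulus_subset_closedAnnulus j (hr r hr' hrs).1, (hr r hr' hrs).2.le⟩
    intro r hr'
    by_cases hrs : r = s
    · subst hrs
      have h2 := (hcont r hs).continuousWithinAt.mem_closure_image (mem_closure_uIcc_diff hne)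
      refine closure_minimal ?_ hZc h2
      rintro _ ⟨r', hr', rfl⟩
      exact h1 r' hr'.1 hr'.2
    · exact h1 r hr' hrs
  have hdeep : ∀ r ∈ uIcc s₁ s, 1 < (γ r).2.1 + T (γ r).2.2 := fun r hr' => by
    have h1 := hclosed r hr'
    have h2 := hdepth _ h1.1
    linarith [h1.2]
  -- hence it descends by less than `7 B`
  have hvar := abs_sub_le_mul_abs_sub (B := B) (fun r hr' => H.hasDerivAt_height hγ (hsub hr'))
    (fun r hr' => ((hasDerivAt_time hγ (hsub hr')).arctan).const_mul 2) (fun r hr' => by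
      rw [H.heightVelocity_of_not_deep (hdeep r hr'), abs_mul]
      refine (mul_le_of_le_one_left (abs_nonneg _) (abs_heightCutoff_le_one _)).trans
        ((hspeed _ _ (hclosed r hr').1.1).trans (le_of_eq ?_))
      ring)
  have hheight : -(7 * B) ≤ (γ s).2.1 := by
    have h1 : |2 * Real.arctan (γ s).1 - 2 * Real.arctan (γ s₁).1| ≤ 7 := by
      have := Real.pi_lt_d2
      have h2 := Real.arctan_lt_pi_div_two (γ s).1
      have h3 := Real.neg_pi_div_two_lt_arctan (γ s).1
      have h4 := Real.arctan_lt_pi_div_two (γ s₁).1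
      have h5 := Real.neg_pi_div_two_lt_arctan (γ s₁).1
      clear * - this h2 h3 h4 h5
      rw [abs_le]
      constructor <;> linarith
    rw [abs_mul, abs_of_nonneg hB] at hvar
    have h2 := (abs_le.1 hvar).1
    have h3 := mul_le_mul_of_nonneg_left h1 hB
    clear * - h2 h3 ht
    linarith
  refine ⟨?_, by linarith⟩
  -- it cannot leave the annulus either, since the field vanishes at the boundary of the annulus
  by_contra hx
  have hs' := right_mem_uIcc (a := s₁) (b := s)
  have h0 := endCutoff_eventually_eq_zero_of_not_wall (p := (γ s).2) H.smooth_depth.continuous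
    (hdeep s hs') (H.wall_eq_zero j _ (hclosed s hs').1 hx)
  have h1 := H.snd_eq_of_cutoff_eq_zero hγ hs h0 s₁ hs₁
  rw [h1] at hj
  exact hx hj

/-- An integral curve that passes over a wall stays over the annulus around this wall. -/
lemma mem_openAnnulus_of_mem_wall (H : IsCutoffField α R Φ C σ T Y)
    (hγ : IsMIntegralCurveOn γ (fun q => tpair (𝓘(ℝ, ℝ).prod 𝓘(ℝ, E)) q 1 (Y q)) (Ioo a b))
    (hs₁ : s₁ ∈ Ioo a b) {j : ℕ} (hj : (γ s₁).2.2 ∈ wall C j) :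
    ∀ s ∈ Ioo a b, (γ s).2.2 ∈ openAnnulus C j := by
  have htrace : ∀ s, liftMap α R Φ (γ s) = liftMap α R Φ (γ s₁) →
      (γ s).2.2 ∈ trace Φ (wall C j) := fun s hs =>
    ⟨(γ s).1, (γ s₁).1, (γ s₁).2.2, hj, congrArg Prod.snd hs⟩
  -- the curve keeps its image under the lifts as long as it stays below the height `0`
  by_cases h : ∃ s ∈ Ioo a b, liftMap α R Φ (γ s) = liftMap α R Φ (γ s₁) ∧ 0 ≤ (γ s).2.1
  · obtain ⟨s, hs, hP, ht⟩ := h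
    exact H.mem_openAnnulus_of_nonneg hγ hs
      (H.exhaustion.trace_wall_subset j (htrace s hP)) ht
  · push Not at h
    have h1 := H.liftMap_eq_of_cutoff_eq_one hγ hs₁ fun s hs hP =>
      endCutoff_eventually_eq_one_of_wall (h s hs hP) (H.wall_eq_one j _ (htrace s hP))
    exact fun s hs => H.exhaustion.trace_wall_subset j (htrace s (h1 s hs))

/-- The annuli trap the integral curves: either the curve passes over the wall and stays over its
annulus, or it stays on one side of the wall. -/
lemma mem_exhaustion (H : IsCutoffField α R Φ C σ T Y)
    (hγ : IsMIntegralCurveOn γ (fun q => tpair (𝓘(ℝ, ℝ).prod 𝓘(ℝ, E)) q 1 (Y q)) (Ioo a b))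
    (hs₁ : s₁ ∈ Ioo a b) {j : ℕ} (hj : (γ s₁).2.2 ∈ C (4 * j + 2)) :
    ∀ s ∈ Ioo a b, (γ s).2.2 ∈ C (4 * j + 3) := by
  by_cases h : ∃ s ∈ Ioo a b, (γ s).2.2 ∈ wall C j
  · obtain ⟨s, hs, hw⟩ := h
    exact fun r hr => interior_subset (H.mem_openAnnulus_of_mem_wall hγ hs hw r hr).1
  · push Not at h
    have h1 : IsPreconnected ((fun s => (γ s).2.2) '' Ioo a b) :=
      isPreconnected_Ioo.image _ ((continuous_snd.comp continuous_snd).comp_continuousOn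
        hγ.continuousOn)
    have h2 := h1.subset_of_disjoint_frontier (H.exhaustion.isCompact _).isClosed
      ⟨_, ⟨s₁, hs₁, rfl⟩, hj⟩ (by
        rintro _ ⟨s, hs, rfl⟩
        exact h s hs)
    exact fun s hs => interior_subset (H.exhaustion.subset_interior _ (h2 ⟨s, hs, rfl⟩))

/-- The cut-off flow is complete. -/
lemma exists_isMIntegralCurve (H : IsCutoffField α R Φ C σ T Y) (q : ℝ × (ℝ × M)) :
    ∃ γ : ℝ → ℝ × (ℝ × M), γ 0 = q ∧
      IsMIntegralCurve γ (fun q => tpair (𝓘(ℝ, ℝ).prod 𝓘(ℝ, E)) q 1 (Y q)) := by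
  refine H.smooth_field.exists_isMIntegralCurve (fun q a => ?_) q
  obtain ⟨n, hn⟩ := H.exhaustion.exists_mem q.2.2
  have hn' : q.2.2 ∈ C (4 * n + 2) := H.exhaustion.mono (by omega) hn
  obtain ⟨A, hA, hAb⟩ := H.exists_heightVelocity_bound (|q.1| + |a|)
    (H.exhaustion.isCompact (4 * n + 3))
  refine ⟨Icc (q.1 - |a|) (q.1 + |a|) ×ˢ
    (Icc (q.2.1 - A * |a|) (q.2.1 + A * |a|) ×ˢ C (4 * n + 3)),
    isCompact_Icc.prod (isCompact_Icc.prod (H.exhaustion.isCompact _)), ?_⟩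
  intro γ b hba hγ0 hγ s hs
  have h0 : (0 : ℝ) ∈ Ioo (-b) b := by
    have := hs.1.trans hs.2
    exact ⟨by linarith, by linarith⟩
  have hx : ∀ s ∈ Ioo (-b) b, (γ s).2.2 ∈ C (4 * n + 3) :=
    H.mem_exhaustion hγ h0 (by rw [hγ0]; exact hn')
  have hsa : ∀ s ∈ Ioo (-b) b, |s| ≤ |a| := fun s hs =>
    (abs_le.2 ⟨hs.1.le, hs.2.le⟩).trans (hba.trans (le_abs_self a))
  have htime : ∀ s ∈ Ioo (-b) b, (γ s).1 = q.1 + s := fun s hs => by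
    rw [fst_eq_of_isMIntegralCurveOn hγ hs, hγ0]
  have hsub : uIcc 0 s ⊆ Ioo (-b) b := ordConnected_Ioo.uIcc_subset h0 hs
  have hvar := abs_sub_le_mul_abs_sub (B := A) (fun r hr => H.hasDerivAt_height hγ (hsub hr))
    (fun r _ => hasDerivAt_id' r) (fun r hr => by
      rw [mul_one]
      refine hAb _ ?_ (hx r (hsub hr))
      rw [htime r (hsub hr)]
      exact (abs_add_le _ _).trans (add_le_add_right (hsa r (hsub hr)) _))
  rw [hγ0, sub_zero, abs_mul, abs_of_nonneg hA] at hvar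
  have h1 := abs_le.1 (hvar.trans (mul_le_mul_of_nonneg_left (hsa s hs) hA))
  have h2 := abs_le.1 (hsa s hs)
  refine ⟨?_, ?_, hx s hs⟩
  · rw [htime s hs]
    exact ⟨by linarith [h2.1], by linarith [h2.2]⟩
  · exact ⟨by linarith [h1.1], by linarith [h1.2]⟩

end IsCutoffField

end Trap

/-! ### The end of a contact isotopy -/

section EndOfIsotopy

open Filter Topology

variable {E : Type*} [NormedAddCommGroup E] [NormedSpace ℝ E] [FiniteDimensional ℝ E]
  {M : Type*} [TopologicalSpace M] [ChartedSpace E M] [IsManifold 𝓘(ℝ, E) ∞ M]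
  {α : ∀ x : M, TangentSpace 𝓘(ℝ, E) x →L[ℝ] ℝ} {R : ∀ x : M, TangentSpace 𝓘(ℝ, E) x}
  {Φ : ℝ → M ≃ₘ^∞⟮𝓘(ℝ, E), 𝓘(ℝ, E)⟯ M} {T : M → ℝ}

lemma liftMap_zero (hR : IsReebField α R) (hΦ : IsContactPath α Φ) (p : ℝ × M) :
    liftMap α R Φ (0, p) = p := by
  have hid : (Φ 0 : M → M) = id := funext fun x => hΦ.eq_id 0 le_rfl x
  have h1 : conformalFactor α R Φ (0, p.2) = 1 := by
    have h2 := (conformalFactor_spec hR hΦ (0, p.2)).2 (R p.2)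
    rw [mfderiv_pathMap hΦ, hR.apply_eq_one, mul_one] at h2
    refine h2.symm.trans ?_
    have h3 : ∀ f : M → M, f = id →
        α (f p.2) (mfderiv 𝓘(ℝ, E) 𝓘(ℝ, E) f p.2 (R p.2)) = 1 := by
      rintro _ rfl
      rw [mfderiv_id]
      exact hR.apply_eq_one _
    exact h3 _ hid
  have h2 : pathMap Φ (0, p.2) = p.2 := hΦ.eq_id 0 le_rfl _
  unfold liftMap
  simp only [h1, h2, Real.log_one, sub_zero]

lemma isCylinderSymplectic_liftDiffeo (hα : IsSmoothForm 𝓘(ℝ, E) α) (hR : IsReebField α R)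
    (hΦ : IsContactPath α Φ) (s : ℝ) : IsCylinderSymplectic α (liftDiffeo hα hR hΦ s) := by
  intro p u w
  have h1 := extDerivOneForm_pullbackForm (f := fun p => liftMap α R Φ (s, p))
    ((contMDiff_liftMap hα hR hΦ).comp (contMDiff_const.prodMk contMDiff_id))
    (isSmoothForm_cylinderForm hα) p u w
  rw [pullbackForm_liftMap_slice hα hR hΦ] at h1
  exact h1.symm

/-- The points that come from the depths along the whole path form a neighborhood of the negative
end. The interval `[-1, 2]` contains `[0, 1]` in its interior, as needed for integral curves on open
intervals. -/
lemma isNegEnd_deep (hα : IsSmoothForm 𝓘(ℝ, E) α) (hR : IsReebField α R)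
    (hΦ : IsContactPath α Φ) (hT : Continuous T) :
    IsNegEnd {p : ℝ × M | ∀ s ∈ Icc (-1 : ℝ) 2,
      (liftInv α R Φ (s, p)).1 < - T (liftInv α R Φ (s, p)).2} := by
  have hc := continuous_liftInv hα hR hΦ
  refine ⟨?_, fun r hr q hq s hs => ?_, fun x => ?_⟩
  · have hW : IsOpen {q : (ℝ × M) × ℝ |
        (liftInv α R Φ (q.2, q.1)).1 < - T (liftInv α R Φ (q.2, q.1)).2} := by
      have h1 : Continuous fun q : (ℝ × M) × ℝ => liftInv α R Φ (q.2, q.1) :=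
        hc.comp (continuous_snd.prodMk continuous_fst)
      exact isOpen_lt (continuous_fst.comp h1) (hT.comp (continuous_snd.comp h1)).neg
    rw [isOpen_iff_mem_nhds]
    exact fun p hp => isCompact_Icc.eventually_forall_of_forall_eventually fun s hs =>
      hW.mem_nhds (hp s hs)
  · have h1 := hq s hs
    unfold liftInv at h1 ⊢
    simp only at h1 ⊢
    linarith
  · let f : ℝ → ℝ := fun s => (liftInv α R Φ (s, (0, x))).1 + T (liftInv α R Φ (s, (0, x))).2
    have hf : Continuous f := by
      have h1 : Continuous fun s : ℝ => liftInv α R Φ (s, (0, x)) :=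
        hc.comp (continuous_id.prodMk continuous_const)
      exact (continuous_fst.comp h1).add (hT.comp (continuous_snd.comp h1))
    obtain ⟨m, hm⟩ := (isCompact_Icc (a := (-1 : ℝ)) (b := 2)).bddAbove_image hf.continuousOn
    refine ⟨-m - 1, fun s hs => ?_⟩
    have h1 : f s ≤ m := hm ⟨s, hs, rfl⟩
    simp only [f] at h1
    unfold liftInv at h1 ⊢
    simp only at h1 ⊢
    linarith

/-- The end of a contact isotopy is induced by a symplectic pseudo-isotopy: the lift of the
isotopy, composed with the cut-off inverse flow. -/
lemma exists_isCylinderPseudoIsotopy [T2Space M] [SecondCountableTopology M]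
    (hα : IsContactForm α) (hΦ : IsContactPath α Φ) :
    ∃ f : (ℝ × M) ≃ₘ^∞⟮𝓘(ℝ, ℝ).prod 𝓘(ℝ, E), 𝓘(ℝ, ℝ).prod 𝓘(ℝ, E)⟯ (ℝ × M),
      IsCylinderPseudoIsotopy α f (Φ 1) := by
  obtain ⟨R, hR⟩ := hα.exists_isReebField
  have hα' := hα.smooth.isSmoothForm
  obtain ⟨C, σ, T, Y, H⟩ := exists_isCutoffField hα hR hΦ
  obtain ⟨G, hG, hGγ⟩ := exists_symplectic_time_one (isSmoothForm_cylinderForm hα')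
    H.contMDiff_hamiltonian.neg (Y := Y) (fun q w => by
      have h1 := differential_neg (I := 𝓘(ℝ, ℝ).prod (𝓘(ℝ, ℝ).prod 𝓘(ℝ, E)))
        (cutHamiltonian α R Φ σ T) q (tpair (𝓘(ℝ, ℝ).prod 𝓘(ℝ, E)) q 0 w)
      exact (H.hamiltonian q w).trans ((congrArg Neg.neg h1).trans (neg_neg _)).symm)
    H.smooth_field H.exists_isMIntegralCurve
  have h0 : (0 : ℝ) ∈ Ioo (-1 : ℝ) 2 := by constructor <;> norm_num
  have h1 : (1 : ℝ) ∈ Ioo (-1 : ℝ) 2 := by constructor <;> norm_num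
  let D := liftDiffeo hα' hR hΦ 1
  refine ⟨G.trans D, ⟨fun q u w => ?_, ⟨_, isNegEnd_deep hα' hR hΦ H.smooth_depth.continuous,
    fun p hp => ?_⟩, ⟨{p | 1 < p.1}, ⟨?_, ?_, ?_⟩, fun p hp => ?_⟩⟩⟩
  · have h2 : ∀ u : TangentSpace (𝓘(ℝ, ℝ).prod 𝓘(ℝ, E)) q,
        mfderiv (𝓘(ℝ, ℝ).prod 𝓘(ℝ, E)) (𝓘(ℝ, ℝ).prod 𝓘(ℝ, E)) (G.trans D) q u =
        mfderiv (𝓘(ℝ, ℝ).prod 𝓘(ℝ, E)) (𝓘(ℝ, ℝ).prod 𝓘(ℝ, E)) D (G q)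
          (mfderiv (𝓘(ℝ, ℝ).prod 𝓘(ℝ, E)) (𝓘(ℝ, ℝ).prod 𝓘(ℝ, E)) G q u) :=
      fun u => mfderiv_comp_apply_of_contMDiff D.contMDiff G.contMDiff q u
    rw [h2, h2]
    exact (isCylinderSymplectic_liftDiffeo hα' hR hΦ 1 (G q) _ _).trans (hG q u w)
  · obtain ⟨γ, hγ0, hγt, hγ1, hγ⟩ := hGγ p
    have hP0 : liftMap α R Φ (γ 0) = p := by rw [hγ0, liftMap_zero hR hΦ]
    -- the whole curve with the image `p` under the lifts lies where the cutoff is `1`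
    have h2 := H.liftMap_eq_of_cutoff_eq_one (hγ.isMIntegralCurveOn _) h0 (fun s hs hPs => by
      have h3 : (γ s).2 = liftInv α R Φ (s, p) := by
        rw [← liftInv_liftMap (α := α) (R := R) (Φ := Φ) s (γ s).2, ← hP0, ← hPs]
        have h4 : (s, (γ s).2) = γ s := Prod.ext (hγt s).symm rfl
        rw [h4]
      refine endCutoff_eventually_eq_one_of_deep H.smooth_depth.continuous H.one_le_depth ?_
      rw [h3]
      exact hp s ⟨hs.1.le, hs.2.le⟩) 1 h1
    rw [hP0] at h2
    have h4 : (1, G p) = γ 1 := Prod.ext (hγt 1).symm hγ1.symm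
    change liftMap α R Φ (1, G p) = p
    rw [h4, h2]
  · exact isOpen_lt continuous_const continuous_fst
  · intro s hs q hq
    exact lt_of_lt_of_le hq (le_add_of_nonneg_right hs)
  · exact fun x => ⟨2, show (1 : ℝ) < 2 from one_lt_two⟩
  · have hGid : ∀ p : ℝ × M, 1 < p.1 → G p = p := fun p hp => by
      obtain ⟨γ, hγ0, -, hγ1, hγ⟩ := hGγ p
      have h2 := H.snd_eq_of_cutoff_eq_zero (hγ.isMIntegralCurveOn _) h0 (by
        rw [hγ0]
        exact endCutoff_eventually_eq_zero_of_high H.one_le_depth hp) 1 h1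
      rw [← hγ1, h2, hγ0]
    have hp' : (1 : ℝ) < p.1 := hp
    have hev : (G.trans D : ℝ × M → ℝ × M) =ᶠ[𝓝 p] fun p => liftMap α R Φ (1, p) := by
      filter_upwards [(isOpen_lt continuous_const continuous_fst).mem_nhds hp'] with q hq
      change liftMap α R Φ (1, G q) = _
      rw [hGid q hq]
    constructor
    · have h3 : ∀ f g : ℝ × M → ℝ × M, f =ᶠ[𝓝 p] g →
          pullbackForm (𝓘(ℝ, ℝ).prod 𝓘(ℝ, E)) (𝓘(ℝ, ℝ).prod 𝓘(ℝ, E)) f (cylinderForm α) p =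
          pullbackForm (𝓘(ℝ, ℝ).prod 𝓘(ℝ, E)) (𝓘(ℝ, ℝ).prod 𝓘(ℝ, E)) g (cylinderForm α) p := by
        intro f g hfg
        have h4 := hfg.mfderiv_eq (I := 𝓘(ℝ, ℝ).prod 𝓘(ℝ, E)) (I' := 𝓘(ℝ, ℝ).prod 𝓘(ℝ, E))
        have h5 : ∀ y : ℝ × M, y = g p → ∀ u : ℝ × E,
            cylinderForm α y u = cylinderForm α (g p) u := by
          rintro _ rfl _
          rfl
        ext w
        exact (congrArg (cylinderForm α (f p)) (DFunLike.congr_fun h4 w)).trans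
          (h5 _ hfg.eq_of_nhds _)
      have h6 := h3 _ _ hev
      rw [pullbackForm_liftMap_slice hα' hR hΦ 1] at h6
      exact h6
    · rw [hev.eq_of_nhds]
      rfl

end EndOfIsotopy

section IdentityComponent

variable {E : Type*} [NormedAddCommGroup E] [NormedSpace ℝ E]
  {M : Type*} [TopologicalSpace M] [ChartedSpace E M] [IsManifold 𝓘(ℝ, E) ∞ M]
  {ξ : ContactStructure E M}

/-- A contactomorphism multiplies the contact form by a positive function. -/
lemma ContactGeometry.ContactStructure.Diff.exists_conformal_factor (φ : ξ.Diff) (x : M) :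
    ∃ c > 0, ∀ w : TangentSpace 𝓘(ℝ, E) x,
      ξ.form (φ x) (mfderiv 𝓘(ℝ, E) 𝓘(ℝ, E) φ.toDiffeo x w) = c * ξ.form x w := by
  obtain ⟨v, hv⟩ := ContactStructure.Symplectization.exists_pos_vector (ξ := ξ) x
  set D : TangentSpace 𝓘(ℝ, E) x →L[ℝ] TangentSpace 𝓘(ℝ, E) (φ x) :=
    mfderiv 𝓘(ℝ, E) 𝓘(ℝ, E) φ.toDiffeo x with hD
  have hpos : 0 < ξ.form (φ x) (D v) := by
    rw [(ξ.kerEq_form (φ x) _).2]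
    exact (φ.map_pos x v).2 ((ξ.kerEq_form x v).2.1 hv)
  refine ⟨ξ.form (φ x) (D v) / ξ.form x v, div_pos hpos hv, fun w => ?_⟩
  have h0 : ξ.form x (w - (ξ.form x w / ξ.form x v) • v) = 0 := by
    rw [map_sub, map_smul, smul_eq_mul, div_mul_cancel₀ _ hv.ne', sub_self]
  have h1 : ξ.form (φ x) (D (w - (ξ.form x w / ξ.form x v) • v)) = 0 := by
    rw [(ξ.kerEq_form (φ x) _).1]
    exact (φ.map_plane x _).2 ((ξ.kerEq_form x _).1.1 h0)
  rw [map_sub, map_smul, map_sub, map_smul, smul_eq_mul, sub_eq_zero] at h1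
  rw [h1]
  ring

/-- A contact isotopy can be reparametrized to be constant near its ends, and extended to all
times. -/
lemma ContactGeometry.ContactStructure.Diff.IsContactIsotopicToId.exists_isContactPath
    {φ : ξ.Diff} (hφ : φ.IsContactIsotopicToId) :
    ∃ Φ : ℝ → M ≃ₘ^∞⟮𝓘(ℝ, E), 𝓘(ℝ, E)⟯ M, IsContactPath ξ.form Φ ∧ Φ 1 = φ.toDiffeo := by
  obtain ⟨Ψ, hΨ, rfl⟩ := hφ
  refine ⟨fun s => (Ψ (Real.smoothTransition s)).toDiffeo, ⟨?_, ?_, ?_, ?_⟩, ?_⟩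
  · have h1 : ContMDiff (𝓘(ℝ, ℝ).prod 𝓘(ℝ, E)) (𝓘(ℝ, ℝ).prod 𝓘(ℝ, E)) ∞
        (fun q : ℝ × M => (Real.smoothTransition q.1, q.2)) :=
      ((Real.smoothTransition.contDiff (n := ⊤)).contMDiff.comp contMDiff_fst).prodMk contMDiff_snd
    exact hΨ.smooth.comp_contMDiff h1 fun q =>
      ⟨⟨Real.smoothTransition.nonneg _, Real.smoothTransition.le_one _⟩, trivial⟩
  · exact fun s x => (Ψ _).exists_conformal_factor x
  · intro s hs x
    simp only [Real.smoothTransition.zero_of_nonpos hs, hΨ.zero]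
    rfl
  · intro s hs
    simp only [Real.smoothTransition.one_of_one_le hs, Real.smoothTransition.one]
  · simp only [Real.smoothTransition.one]

end IdentityComponent

theorem mainTheorem6
    {E : Type*} [NormedAddCommGroup E] [NormedSpace ℝ E] [FiniteDimensional ℝ E]
    {M : Type*} [TopologicalSpace M] [T2Space M] [SecondCountableTopology M]
    [ChartedSpace E M] [IsManifold 𝓘(ℝ, E) ∞ M]
    (ξ : ContactGeometry.ContactStructure E M) :
    ∃ DiffP : Subgroup ξ.Diff,
      (∀ φ : ξ.Diff, φ ∈ DiffP ↔ φ.IsSymplecticallyPseudoIsotopicToId) ∧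
      ContactGeometry.ContactStructure.Diff.identityComponent ξ ≤ DiffP := by
  refine ⟨pseudoIsotopySubgroup ξ, fun φ => Iff.rfl, fun φ hφ => ?_⟩
  have hφ' : φ.IsContactIsotopicToId := hφ
  obtain ⟨Φ, hΦ, h1⟩ := hφ'.exists_isContactPath
  obtain ⟨f, hf⟩ := exists_isCylinderPseudoIsotopy ξ.isContactForm_form hΦ
  rw [h1] at hf
  exact (isSymplecticallyPseudoIsotopicToId_iff φ).2 ⟨f, hf⟩
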